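/- **Setting.** Let $q\ge 1$, let $\pi$ be a permutation of $\mathcal A=\{0,\dots,q-1\}$, and let $N\ge 1$ be an integer with $2^N\ge q$. Put $I=[0,1)$ and let $F_\pi=\mathfrak a\circ R_\pi:I\to I$, where $R_\pi$ translates $[\frac iq,\frac{i+1}q)$ onto $[\frac{\pi(i)}q,\frac{\pi(i)+1}q)$ and $\mathfrak a(x)=x-(1-3\cdot 2^{-n})$ for $x\in[1-2^{1-n},1-2^{-n})$, $n\ge1$. Let $I_{per}$ be the set of $F_\pi$-periodic points and $I_{np}=I\setminus I_{per}$. Let $D_0\subset I$ consist of $0$, the points $x$ with $R_\pi(x)=1-2^{-n}$ for some $n\ge 0$, and all discontinuities of $F_\pi$; let $D$ be the union of the forward and backward $F_\pi$-orbits of the points of $D_0$. Let $\Delta$ be one of the two sets $D$ and $\{\frac{p}{q2^n}: n,p\ge 0\}\cap I$. *Doubling.* Let $I^*$ be $I$ together with a new point $x^-$ for every $x\in\Delta\setminus\{0\}$ and the point $1=1^-$, ordered so that $x^-$ is the immediate predecessor of $x=x^+$, with the order topology. Let $F_\pi^*:I^*\to I^*$ be $F_\pi$ on $I$, with $F^*_\pi(x^-)=\lim_{y\nearrow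 x}F_\pi(y)$ (limit in $I^*$). Let $I^*_{per}$ be the union of the intervals $[x^+,y^-]$ with $x\in\Delta$, $y\in\Delta\cup\{1\}$ and $[x,y)\subset I_{per}$, and let $I^*_{np}=I^*\setminus I^*_{per}$. *Coding.* For $k\ge0$ let $L_k=[0,2^{-kN})$, and cut $L_k$ at those points $\frac{i}{q2^{kN}}$, $0\le i<q$, that belong to $\Delta$. Label the piece with left endpoint $\frac{i}{q2^{kN}}$ by $i$ and call it $J_{k,i}$ (with $J_{k,i}=\emptyset$ if $\frac{i}{q2^{kN}}\notin\Delta$). If $\Delta=\{\frac p{q2^n}\}\cap I$, then $J_{k,i}=[\frac i{q2^{kN}},\frac{i+1}{q2^{kN}})$ for all $i$. Let $F_{\pi,k}$ be the first return map of $F_\pi$ to $L_k$. **Theorem.** Every point of $L_k$ returns to $L_k$ under $F_\pi$, for every $k\ge 0$. There is a sequence $(\chi_k)_{k\ge1}$ of substitutions $\chi_k:\mathcal A\to\mathcal A^*$ such that: 1. Every $\chi_k$ is proper: all words $\chi_k(i)$, $i\in\mathcal A$, begin with a common letter and end with a common letter. The sequence is eventually periodic: there are $k_0\ge 1$, $p_0\ge1$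 with $\chi_{k+p_0}=\chi_k$ for all $k\ge k_0$. 2. The substitutions are those of the successive first return maps: for $k\ge1$ and every $x\in J_{k,i}$, the length $|\chi_k(i)|$ is the least $t>0$ with $F_{\pi,k-1}^t(x)\in L_k$, and for $0\le s<|\chi_k(i)|$ the point $F_{\pi,k-1}^s(x)$ lies in $J_{k-1,e_s}$, where $\chi_k(i)=e_0e_1\dots$. 3. Let $V_0=\{v_0\}$ and $V_k=\{i\in\mathcal A: J_{k-1,i}\cap I_{np}\ne\emptyset\}$ for $k\ge1$. Each $V_k$ is a non-empty subset of $\mathcal A$ (for $k\ge 1$), and for $i\in V_{k+1}$ all letters of $\chi_k(i)$ are in $V_k$. Let $(V,E,<)$ be the ordered Bratteli diagram with vertex sets $V_k$, with one edge from $v_0$ to each vertex of $V_1$, and, for $k\ge1$, with the edges from $V_k$ into $i\in V_{k+1}$ given by the letters of the word $\chi_k(i)$, in the order in which they occur in it. Every vertex has an outgoing edge, and every vertex other than $v_0$ has an incoming edge. 4. The path space $X_{(V,E,<)}$ contains exactly one minimal path and exactly one maximal path, and the Vershik map $\tau$ on $X_{(V,E,<)}$ is a homeomorphism. 5. $F^*_\pi(I^*_{np})\subset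 I^*_{np}$, and there is a homeomorphism $\psi:I^*_{np}\to X_{(V,E,<)}$ with $\psi\circ F^*_\pi=\tau\circ\psi$ on $I^*_{np}$. -/

import Mathlib

open Set Filter Topology

noncomputable section

/-! ### The rotated odometer -/

namespace RotatedOdometer

/-- The number `n ≥ 1` of the interval `[1 - 2^{1-n}, 1 - 2^{-n})` that contains `x ∈ [0,1)`. -/
def pieceIndex (x : ℝ) : ℕ := sInf {n : ℕ | x < 1 - (1 / 2 : ℝ) ^ n}

/-- The von Neumann–Kakutani map on `[0,1)`:
`x ↦ x - (1 - 3 · 2^{-n})` for `x ∈ [1 - 2^{1-n}, 1 - 2^{-n})`, `n ≥ 1`. -/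
def kakutani (x : ℝ) : ℝ := x - (1 - 3 * (1 / 2 : ℝ) ^ pieceIndex x)

/-- The finite interval exchange of `[0,1)` that translates `[i/q, (i+1)/q)` onto
`[π(i)/q, (π(i)+1)/q)`.  (The value outside `[0,1)` is irrelevant.) -/
def exchange (q : ℕ) (π : Equiv.Perm (Fin q)) (x : ℝ) : ℝ :=
  if h : ⌊(q : ℝ) * x⌋₊ < q then
    x + (((π ⟨⌊(q : ℝ) * x⌋₊, h⟩ : ℕ) : ℝ) - (⌊(q : ℝ) * x⌋₊ : ℝ)) / q
  else x

/-- The rotated odometer `F_π`, the exchange followed by the von Neumann–Kakutani map. -/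
def F (q : ℕ) (π : Equiv.Perm (Fin q)) (x : ℝ) : ℝ := kakutani (exchange q π x)

/-- The points of `[0,1)` that are periodic under `F_π`. -/
def Iper (q : ℕ) (π : Equiv.Perm (Fin q)) : Set ℝ :=
  {x | x ∈ Ico (0 : ℝ) 1 ∧ ∃ n : ℕ, 0 < n ∧ (F q π)^[n] x = x}

/-- The points of `[0,1)` that are not periodic under `F_π`. -/
def Inp (q : ℕ) (π : Equiv.Perm (Fin q)) : Set ℝ := Ico (0 : ℝ) 1 \ Iper q π

/-! ### The points that are doubled -/

/-- Left endpoints of the intervals of continuity of `F_π`: the point `0`, the points mapped by the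
exchange to some `1 - 2^{-n}`, and all discontinuities of `F_π : [0,1) → [0,1)`. -/
def discPoints (q : ℕ) (π : Equiv.Perm (Fin q)) : Set ℝ :=
  {x | x ∈ Ico (0 : ℝ) 1 ∧ (x = 0 ∨ (∃ n : ℕ, exchange q π x = 1 - (1 / 2 : ℝ) ^ n) ∨
    ¬ ContinuousWithinAt (F q π) (Ico (0 : ℝ) 1) x)}

/-- The union of the forward and backward `F_π`-orbits of the points of `discPoints`. -/
def discOrbits (q : ℕ) (π : Equiv.Perm (Fin q)) : Set ℝ :=
  {x | x ∈ Ico (0 : ℝ) 1 ∧ ∃ d ∈ discPoints q π, ∃ n : ℕ,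
    (F q π)^[n] d = x ∨ (F q π)^[n] x = d}

/-- All the points `p / (q 2^n)` of `[0,1)`. -/
def gridPoints (q : ℕ) : Set ℝ :=
  {x | x ∈ Ico (0 : ℝ) 1 ∧ ∃ p n : ℕ, x = (p : ℝ) / ((q : ℝ) * 2 ^ n)}

/-! ### The doubled interval and the extended map -/

/-- The interval `[0,1)` with the points of `Δ \ {0}` doubled and `1` added, as a subset of the
lexicographic product `ℝ ×ₗ Bool`.  A point `x ∈ [0,1)` (also written `x⁺`) is `(x, true)`; the
added point `x⁻`, for `x ∈ Δ \ {0}` or `x = 1`, is `(x, false)`.  So `x⁻ < x⁺` are adjacent. -/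
def Doubled (Δ : Set ℝ) : Type :=
  {p : ℝ ×ₗ Bool // ((ofLex p).2 = true ∧ (ofLex p).1 ∈ Ico (0 : ℝ) 1) ∨
    ((ofLex p).2 = false ∧ (((ofLex p).1 ∈ Δ ∧ (ofLex p).1 ∈ Ioo (0 : ℝ) 1) ∨ (ofLex p).1 = 1))}

instance (Δ : Set ℝ) : LinearOrder (Doubled Δ) :=
  inferInstanceAs (LinearOrder (Subtype _))

/-- The order topology. -/
instance (Δ : Set ℝ) : TopologicalSpace (Doubled Δ) := Preorder.topology _

instance (Δ : Set ℝ) : OrderTopology (Doubled Δ) := ⟨rfl⟩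

/-- The underlying real number of a point of the doubled interval. -/
def Doubled.val {Δ : Set ℝ} (z : Doubled Δ) : ℝ := (ofLex z.1).1

/-- Whether a point of the doubled interval is one of the added points `x⁻`. -/
def Doubled.IsMinus {Δ : Set ℝ} (z : Doubled Δ) : Prop := (ofLex z.1).2 = false

/-- The inclusion of `[0,1)` into the doubled interval (with value `0` outside `[0,1)`). -/
def incl (Δ : Set ℝ) (x : ℝ) : Doubled Δ :=
  open Classical in
  if h : x ∈ Ico (0 : ℝ) 1 then ⟨toLex (x, true), Or.inl ⟨rfl, h⟩⟩
  else ⟨toLex (0, true), Or.inl ⟨rfl, by simp⟩⟩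

instance (Δ : Set ℝ) : Nonempty (Doubled Δ) := ⟨incl Δ 0⟩

/-- The extension `F_π^*` of `F_π` to the doubled interval: it is `F_π` on `[0,1)`, and its value
at an added point `x⁻` is the limit of `F_π(y)` in the doubled interval as `y ↗ x`. -/
def Fstar (q : ℕ) (π : Equiv.Perm (Fin q)) (Δ : Set ℝ) (z : Doubled Δ) : Doubled Δ :=
  open Classical in
  if z.IsMinus then limUnder (𝓝[<] z.val) (fun y : ℝ => incl Δ (F q π y))
  else incl Δ (F q π z.val)

/-- The periodic part: the union of the intervals `[x⁺, y⁻]` with `x ∈ Δ`, with `y ∈ Δ` or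
`y = 1`, and with `[x, y)` contained in the set of periodic points. -/
def IperStar (q : ℕ) (π : Equiv.Perm (Fin q)) (Δ : Set ℝ) : Set (Doubled Δ) :=
  {z | ∃ a b : Doubled Δ, ¬ a.IsMinus ∧ a.val ∈ Δ ∧ b.IsMinus ∧
    Ico a.val b.val ⊆ Iper q π ∧ a ≤ z ∧ z ≤ b}

/-- The aperiodic part `I_np^*`, with the subspace topology when used as a type. -/
def InpStar (q : ℕ) (π : Equiv.Perm (Fin q)) (Δ : Set ℝ) : Set (Doubled Δ) :=
  (IperStar q π Δ)ᶜ

/-! ### First return maps and coding -/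

/-- The section `L_k = [0, 2^{-kN})`. -/
def section_ (N k : ℕ) : Set ℝ := Ico 0 ((1 / 2 : ℝ) ^ (k * N))

/-- The first return map of `F_π` to `L_k`. -/
def firstReturn (q N : ℕ) (π : Equiv.Perm (Fin q)) (k : ℕ) (x : ℝ) : ℝ :=
  (F q π)^[sInf {n : ℕ | 0 < n ∧ (F q π)^[n] x ∈ section_ N k}] x

/-- The point `i / (q 2^{kN})`. -/
def cutPoint (q N k : ℕ) (i : Fin q) : ℝ := ((i : ℕ) : ℝ) / ((q : ℝ) * 2 ^ (k * N))

/-- The coding intervals of `L_k`: the section `L_k` is cut at those of the points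
`j / (q 2^{kN})`, `0 ≤ j < q`, that belong to `Δ`; the piece with left endpoint
`i / (q 2^{kN})` has label `i` (and is empty if that point is not in `Δ`).
If all these points are in `Δ`, it is `[i / (q 2^{kN}), (i+1) / (q 2^{kN}))`. -/
def codingInterval (q N : ℕ) (Δ : Set ℝ) (k : ℕ) (i : Fin q) : Set ℝ :=
  {x | x ∈ section_ N k ∧ cutPoint q N k i ∈ Δ ∧ cutPoint q N k i ≤ x ∧
    ∀ j : Fin q, i < j → cutPoint q N k j ∈ Δ → x < cutPoint q N k j}

/-- The word `w` is the itinerary of `x ∈ L_{k+1}` under the first return map to `L_k`, with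
respect to the coding intervals of `L_k`, up to the first return to `L_{k+1}`. -/
def IsReturnWord (q N : ℕ) (π : Equiv.Perm (Fin q)) (Δ : Set ℝ) (k : ℕ) (x : ℝ)
    (w : List (Fin q)) : Prop :=
  IsLeast {n : ℕ | 0 < n ∧ (firstReturn q N π k)^[n] x ∈ section_ N (k + 1)} w.length ∧
  ∀ (s : ℕ) (hs : s < w.length),
    (firstReturn q N π k)^[s] x ∈ codingInterval q N Δ k w[s]

/-- The labels of the coding intervals of `L_k` that contain non-periodic points. -/
def aperiodicLabels (q N : ℕ) (π : Equiv.Perm (Fin q)) (Δ : Set ℝ) (k : ℕ) : Set (Fin q) :=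
  {i | (codingInterval q N Δ k i ∩ Inp q π).Nonempty}

end RotatedOdometer

/-! ### Substitutions -/

/-- A substitution on `q` letters is proper if all its words begin with the same letter and end
with the same letter (in particular they are not empty). -/
def IsProperSubstitution {q : ℕ} (χ : Fin q → List (Fin q)) : Prop :=
  ∃ a b : Fin q, ∀ i : Fin q, (χ i).head? = some a ∧ (χ i).getLast? = some b

/-! ### Ordered Bratteli diagrams and Vershik maps -/

/-- An ordered Bratteli diagram: finite vertex sets `V k` with `V 0` a single root, finite edge
sets `E k` from `V k` to `V (k+1)`, and a strict total order on the edges with each given target. -/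
structure OrderedBratteliDiagram where
  V : ℕ → Type
  E : ℕ → Type
  finite_V : ∀ k, Finite (V k)
  finite_E : ∀ k, Finite (E k)
  root : Unique (V 0)
  src : ∀ k, E k → V k
  tgt : ∀ k, E k → V (k + 1)
  lt : ∀ k, E k → E k → Prop
  strictTotal : ∀ k (v : V (k + 1)),
    IsStrictTotalOrder {e : E k // tgt k e = v} (fun a b => lt k a.1 b.1)

namespace OrderedBratteliDiagram

variable (B : OrderedBratteliDiagram)

/-- Every vertex has an outgoing edge, every vertex other than the root has an incoming edge, and
every vertex of level `1` is joined to the root by exactly one edge. -/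
def IsRegular : Prop :=
  (∀ k (v : B.V k), ∃ e : B.E k, B.src k e = v) ∧
  (∀ k (v : B.V (k + 1)), ∃ e : B.E k, B.tgt k e = v) ∧
  (∀ v : B.V 1, ∃! e : B.E 0, B.tgt 0 e = v)

/-- The space of infinite paths that start at the root. -/
def Path : Type :=
  {x : ∀ k, B.E k // ∀ k, B.tgt k (x k) = B.src (k + 1) (x (k + 1))}

/-- The topology induced by the product of the discrete topologies on the edge sets. -/
instance : TopologicalSpace B.Path :=
  TopologicalSpace.induced Subtype.val (@Pi.topologicalSpace ℕ B.E (fun _ => ⊥))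

variable {B}

/-- The edge is maximal among the edges with the same target. -/
def IsMaxEdge {k : ℕ} (e : B.E k) : Prop := ∀ e' : B.E k, B.tgt k e' = B.tgt k e → ¬ B.lt k e e'

/-- The edge is minimal among the edges with the same target. -/
def IsMinEdge {k : ℕ} (e : B.E k) : Prop := ∀ e' : B.E k, B.tgt k e' = B.tgt k e → ¬ B.lt k e' e

/-- The edge `e'` is the successor of `e` among the edges with the same target. -/
def IsSuccEdge {k : ℕ} (e e' : B.E k) : Prop :=
  B.tgt k e' = B.tgt k e ∧ B.lt k e e' ∧
  ∀ f : B.E k, B.tgt k f = B.tgt k e → ¬ (B.lt k e f ∧ B.lt k f e')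

/-- All edges of the path are maximal. -/
def IsMaxPath (x : B.Path) : Prop := ∀ k, IsMaxEdge (x.1 k)

/-- All edges of the path are minimal. -/
def IsMinPath (x : B.Path) : Prop := ∀ k, IsMinEdge (x.1 k)

/-- The path `y` is the successor of `x`: if `k` is the least level at which the edge of `x` is not
maximal, then `y` agrees with `x` above `k`, its edge at `k` is the successor of that of `x`, and
all its edges below `k` are minimal. -/
def IsSuccPath (x y : B.Path) : Prop :=
  ∃ k, (∀ j < k, IsMaxEdge (x.1 j)) ∧ ¬ IsMaxEdge (x.1 k) ∧
    (∀ j, k < j → y.1 j = x.1 j) ∧ IsSuccEdge (x.1 k) (y.1 k) ∧ ∀ j < k, IsMinEdge (y.1 j)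

/-- The map is the Vershik map: it sends every non-maximal path to its successor, and maximal
paths to minimal paths.  For a diagram with a unique minimal and a unique maximal path this
determines the map. -/
def IsVershikMap (τ : B.Path → B.Path) : Prop :=
  (∀ x, ¬ IsMaxPath x → IsSuccPath x (τ x)) ∧ (∀ x, IsMaxPath x → IsMinPath (τ x))

end OrderedBratteliDiagram

/-- The vertices of level `0` (the root) and of level `k + 1` (the letters in `S k`). -/
def substVertex {q : ℕ} (S : ℕ → Set (Fin q)) : ℕ → Type
  | 0 => Unit
  | k + 1 => S k

/-- The edges.  At level `0` there is one edge from the root to every vertex of level `1`.  At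
level `k + 1` there is an edge with target `i ∈ S (k+1)` and source `j ∈ S k` for each position of
the word `χ k i` at which the letter `j` occurs. -/
def substEdge {q : ℕ} (χ : ℕ → Fin q → List (Fin q)) (S : ℕ → Set (Fin q)) : ℕ → Type
  | 0 => S 0
  | k + 1 => {e : (Σ i : S (k + 1), Fin (χ k i).length) // (χ k e.1).get e.2 ∈ S k}

/-- The ordered Bratteli diagram of a sequence of substitutions `χ k` and of sets of letters `S k`:
the vertices of level `k + 1` are the letters in `S k`, the edges into `i ∈ S (k+1)` come from the
letters of the word `χ k i` that are in `S k`, and they are ordered by their position in it. -/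
def substDiagram {q : ℕ} (χ : ℕ → Fin q → List (Fin q)) (S : ℕ → Set (Fin q)) :
    OrderedBratteliDiagram where
  V := substVertex S
  E := substEdge χ S
  finite_V k := by
    cases k with
    | zero => exact inferInstanceAs (Finite Unit)
    | succ k => exact inferInstanceAs (Finite (S k))
  finite_E k := by
    cases k with
    | zero => exact inferInstanceAs (Finite (S 0))
    | succ k =>
      exact inferInstanceAs
        (Finite {e : (Σ i : S (k + 1), Fin (χ k i).length) // (χ k e.1).get e.2 ∈ S k})
  root := inferInstanceAs (Unique Unit)
  src k := match k with
    | 0 => fun _ => ()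
    | k + 1 => fun e => (⟨(χ k e.1.1).get e.1.2, e.2⟩ : S k)
  tgt k := match k with
    | 0 => fun e => e
    | _ + 1 => fun e => e.1.1
  lt k := match k with
    | 0 => fun _ _ => False
    | _ + 1 => fun e e' => (e.1.2 : ℕ) < (e'.1.2 : ℕ)
  strictTotal k v := by
    cases k with
    | zero =>
      exact
        { trichotomous := fun a b _ _ => Subtype.ext (a.2.trans b.2.symm)
          irrefl := fun _ h => h
          trans := fun _ _ _ h _ => h }
    | succ k =>
      refine
        { trichotomous := ?_
          irrefl := fun _ h => lt_irrefl _ h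
          trans := fun _ _ _ h h' => lt_trans h h' }
      rintro ⟨⟨⟨i, m⟩, h⟩, ha⟩ ⟨⟨⟨i', m'⟩, h'⟩, hb⟩ h1 h2
      have hi : i = i' := ha.trans hb.symm
      subst hi
      have hm : m = m' := Fin.ext (le_antisymm (not_lt.mp h2) (not_lt.mp h1))
      subst hm
      rfl

end

/-!
The idea is renormalization. For `N ≥ 1`, replace the von Neumann–Kakutani map by the cyclic
permutation of the dyadic intervals of length `2 ^ -N` (`trunc`). The truncated map preserves each
finite set of points of `[0,1)` that differ by multiples of `1 / (q 2 ^ N)`, so that all its points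
are periodic, and it agrees with `F_π` until the orbit returns to `[0, 2 ^ -N)`. Therefore every
point of this section returns (`recurrent_section`), every point of `[0,1)` that is not periodic
lies in a tower over the section (`exists_tower`), and, as the von Neumann–Kakutani map is a
rescaled copy of itself on `[1 - 2 ^ -N, 1)`, the first return map to the section is a rescaled
rotated odometer, for another permutation of the same set (`exists_renorm`, `ret_half_pow_mul`).

The set `Δ` enters only through the properties listed in `Admissible`, which pass to the rescaled
section. They imply that `F_π` moves two points in parallel until they return if no cut point of
mesh `1 / (q 2 ^ N)` separates them (`Joined.return`); this yields the substitutions and their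
description of the first return maps (`isReturnWord`). The words are proper since they begin with
the label of `0` and end with that of the interval that the exchange moves to the last place
(`isProper_word`). The permutation and the labels of the cut points at one level determine those at
the next, and both range over finite sets, so the sequence is eventually periodic
(`returnSubst_eventually_periodic`); for the orbits of the discontinuities this rests on
`discOrbits_eq_generated` and `rescale_generated`.

The orbits of the coding intervals of `L_k` until their return form towers, whose floors are
intervals with endpoints in `Δ` and without cut points of mesh `1 / (q 2 ^ (k N))` inside
(`exists_floor_eq_Ico`). The floors of level `k + 1` are contained in those of level `k`, in the
order given by the substitution (`floor_succ_subset`), so an infinite path of the Bratteli diagram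
is the same thing as a decreasing sequence of floors, one of each level. As the lengths of the
floors tend to zero, and as each point of `Δ` eventually is an endpoint of floors, such a sequence
shrinks to one point of the doubled interval; the points obtained are those outside the periodic
part, since a tower over a coding interval without aperiodic points consists of periodic points
(`mem_InpStar_iff`). This is the homeomorphism `ψ`. If a path is not maximal, then from some level
on its floor is not the top one, and the extended map goes to the next floor, which is the successor
(`Codes.Fstar_succ`). A point in the top floors of all levels is mapped to `0`
(`Fstar_eq_incl_zero`), whose path is minimal (`exists_codes_zero`). That there is one minimal and
one maximal path and that the Vershik map is a homeomorphism holds for every proper sequence of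
substitutions (`SubstPath.exists_vershikHomeo`).
-/

noncomputable section

/-! ### Paths of the diagram of a sequence of substitutions -/

namespace SubstPath

open OrderedBratteliDiagram

variable {q : ℕ} {χ : ℕ → Fin q → List (Fin q)} {S : ℕ → Set (Fin q)}

/-- The letter of a path at level `k + 1` of the diagram (level `0` has only the root, which is not
a letter). -/
def letter (x : (substDiagram χ S).Path) (k : ℕ) : Fin q :=
  ((substDiagram χ S).tgt k (x.1 k) : S k).1

/-- The position, in the word of the letter at level `k + 2`, of the edge of the path that ends
there. -/
def pos (x : (substDiagram χ S).Path) (k : ℕ) : ℕ :=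
  ((x.1 (k + 1) : substEdge χ S (k + 1)).1.2 : ℕ)

theorem letter_mem (x : (substDiagram χ S).Path) (k : ℕ) : letter x k ∈ S k :=
  ((substDiagram χ S).tgt k (x.1 k) : S k).2

theorem pos_lt (x : (substDiagram χ S).Path) (k : ℕ) :
    pos x k < (χ k (letter x (k + 1))).length :=
  (x.1 (k + 1) : substEdge χ S (k + 1)).1.2.2

theorem getElem_pos (x : (substDiagram χ S).Path) (k : ℕ) :
    (χ k (letter x (k + 1)))[pos x k]'(pos_lt x k) = letter x k :=
  (congrArg Subtype.val (x.2 k)).symm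

theorem edge_ext {k : ℕ} {e e' : substEdge χ S (k + 1)} (h : e.1.1 = e'.1.1)
    (h' : (e.1.2 : ℕ) = (e'.1.2 : ℕ)) : e = e' := by
  obtain ⟨⟨i, m⟩, he⟩ := e
  obtain ⟨⟨i', m'⟩, he'⟩ := e'
  dsimp only at h h'
  subst h
  have : m = m' := Fin.ext h'
  subst this
  rfl

theorem edge_zero_eq_iff (x y : (substDiagram χ S).Path) :
    y.1 0 = x.1 0 ↔ letter y 0 = letter x 0 := by
  constructor
  · intro h; unfold letter; rw [h]
  · intro h; exact Subtype.ext h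

theorem edge_succ_eq_iff (x y : (substDiagram χ S).Path) (k : ℕ) :
    y.1 (k + 1) = x.1 (k + 1) ↔ letter y (k + 1) = letter x (k + 1) ∧ pos y k = pos x k := by
  constructor
  · intro h; unfold letter pos; rw [h]; exact ⟨rfl, rfl⟩
  · rintro ⟨h, h'⟩
    exact edge_ext (Subtype.ext h) h'

theorem path_ext {x y : (substDiagram χ S).Path} (h : ∀ k, letter x k = letter y k)
    (h' : ∀ k, pos x k = pos y k) : x = y := by
  apply Subtype.ext
  funext k
  cases k with
  | zero => exact (edge_zero_eq_iff y x).2 (h 0)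
  | succ k => exact (edge_succ_eq_iff y x k).2 ⟨h _, h' _⟩

/-- Letters and positions that fit together come from a path. -/
theorem exists_path {i : ℕ → Fin q} {p : ℕ → ℕ} (hi : ∀ k, i k ∈ S k)
    (hp : ∀ k, ∃ h : p k < (χ k (i (k + 1))).length, (χ k (i (k + 1)))[p k] = i k) :
    ∃ x : (substDiagram χ S).Path, (∀ k, letter x k = i k) ∧ ∀ k, pos x k = p k := by
  let e : ∀ k, substEdge χ S k := fun k => match k with
    | 0 => (⟨i 0, hi 0⟩ : S 0)
    | k + 1 => ⟨⟨⟨i (k + 1), hi (k + 1)⟩, ⟨p k, (hp k).1⟩⟩, by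
        have := (hp k).2
        simp only [List.get_eq_getElem]
        rw [this]; exact hi k⟩
  refine ⟨⟨e, fun k => ?_⟩, fun k => ?_, fun k => rfl⟩
  · cases k with
    | zero => exact Subtype.ext (hp 0).2.symm
    | succ k => exact Subtype.ext (hp (k + 1)).2.symm
  · cases k with
    | zero => rfl
    | succ k => rfl

/-- All edges into a vertex that are described by its word belong to the diagram. -/
def LetterClosed (χ : ℕ → Fin q → List (Fin q)) (S : ℕ → Set (Fin q)) : Prop :=
  ∀ k, ∀ i ∈ S (k + 1), ∀ a ∈ χ k i, a ∈ S k

theorem exists_edge (hS : LetterClosed χ S) {k : ℕ} {i : Fin q} (hi : i ∈ S (k + 1)) {m : ℕ}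
    (hm : m < (χ k i).length) :
    ∃ e : substEdge χ S (k + 1), e.1.1 = ⟨i, hi⟩ ∧ (e.1.2 : ℕ) = m :=
  ⟨⟨⟨⟨i, hi⟩, ⟨m, hm⟩⟩, hS k i hi _ (List.get_mem _ _)⟩, rfl, rfl⟩

theorem isMaxEdge_zero (x : (substDiagram χ S).Path) : IsMaxEdge (x.1 0) := fun _ _ h => h

theorem isMinEdge_zero (x : (substDiagram χ S).Path) : IsMinEdge (x.1 0) := fun _ _ h => h

theorem isMaxEdge_succ_iff (hS : LetterClosed χ S) (x : (substDiagram χ S).Path) (k : ℕ) :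
    IsMaxEdge (x.1 (k + 1)) ↔ pos x k + 1 = (χ k (letter x (k + 1))).length := by
  have hlt := pos_lt x k
  constructor
  · intro h
    by_contra hne
    obtain ⟨e, he, hm⟩ := exists_edge hS (letter_mem x (k + 1)) (m := pos x k + 1) (by omega)
    refine h e he ?_
    change pos x k < (e.1.2 : ℕ)
    omega
  · intro h e he hl
    have he' : e.1.1 = (x.1 (k + 1) : substEdge χ S (k + 1)).1.1 := he
    have hl' : pos x k < (e.1.2 : ℕ) := hl
    have h1 := e.1.2.2
    have h2 : (χ k (e.1.1 : Fin q)).length = (χ k (letter x (k + 1))).length :=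
      congrArg (fun v : S (k + 1) => (χ k v.1).length) he'
    omega

theorem isMinEdge_succ_iff (hS : LetterClosed χ S) (x : (substDiagram χ S).Path) (k : ℕ) :
    IsMinEdge (x.1 (k + 1)) ↔ pos x k = 0 := by
  have hlt := pos_lt x k
  constructor
  · intro h
    by_contra hne
    obtain ⟨e, he, hm⟩ := exists_edge hS (letter_mem x (k + 1)) (m := 0) (by omega)
    refine h e he ?_
    change (e.1.2 : ℕ) < pos x k
    omega
  · intro h e he hl
    have hl' : (e.1.2 : ℕ) < pos x k := hl
    omega

theorem isSuccEdge_succ_iff (hS : LetterClosed χ S) (x y : (substDiagram χ S).Path) (k : ℕ) :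
    IsSuccEdge (x.1 (k + 1)) (y.1 (k + 1)) ↔
      letter y (k + 1) = letter x (k + 1) ∧ pos y k = pos x k + 1 := by
  have hlt := pos_lt x k
  have hlt' := pos_lt y k
  constructor
  · rintro ⟨h1, h2, h3⟩
    have h1' : letter y (k + 1) = letter x (k + 1) := congrArg Subtype.val h1
    have h2' : pos x k < pos y k := h2
    refine ⟨h1', ?_⟩
    by_contra hne
    rw [h1'] at hlt'
    obtain ⟨e, he, hm⟩ := exists_edge hS (letter_mem x (k + 1)) (m := pos x k + 1) (by omega)
    refine h3 e he ⟨?_, ?_⟩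
    · change pos x k < (e.1.2 : ℕ)
      omega
    · change (e.1.2 : ℕ) < pos y k
      omega
  · rintro ⟨h1, h2⟩
    refine ⟨Subtype.ext h1, ?_, ?_⟩
    · change pos x k < pos y k
      omega
    · rintro e - ⟨h3, h4⟩
      have h3' : pos x k < (e.1.2 : ℕ) := h3
      have h4' : (e.1.2 : ℕ) < pos y k := h4
      omega

theorem isMaxPath_iff (hS : LetterClosed χ S) (x : (substDiagram χ S).Path) :
    IsMaxPath x ↔ ∀ k, pos x k + 1 = (χ k (letter x (k + 1))).length := by
  constructor
  · intro h k; exact (isMaxEdge_succ_iff hS x k).1 (h (k + 1))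
  · intro h k
    cases k with
    | zero => exact isMaxEdge_zero x
    | succ k => exact (isMaxEdge_succ_iff hS x k).2 (h k)

theorem isMinPath_iff (hS : LetterClosed χ S) (x : (substDiagram χ S).Path) :
    IsMinPath x ↔ ∀ k, pos x k = 0 := by
  constructor
  · intro h k; exact (isMinEdge_succ_iff hS x k).1 (h (k + 1))
  · intro h k
    cases k with
    | zero => exact isMinEdge_zero x
    | succ k => exact (isMinEdge_succ_iff hS x k).2 (h k)

/-- The path `y` is the successor of `x`, in terms of letters and positions: the `k`-th position is
increased by one, all lower positions go from last to first, and nothing changes above. -/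
def SuccAt (x y : (substDiagram χ S).Path) (k : ℕ) : Prop :=
  (∀ j < k, pos x j + 1 = (χ j (letter x (j + 1))).length) ∧ (∀ j < k, pos y j = 0) ∧
    pos y k = pos x k + 1 ∧ (∀ j, k < j → letter y j = letter x j ∧ pos y j = pos x j)

theorem isSuccPath_iff (hS : LetterClosed χ S) (x y : (substDiagram χ S).Path) :
    IsSuccPath x y ↔ ∃ k, SuccAt x y k := by
  constructor
  · rintro ⟨k, h1, h2, h3, h4, h5⟩
    cases k with
    | zero => exact absurd (isMaxEdge_zero x) h2
    | succ k =>
      have h4' := (isSuccEdge_succ_iff hS x y k).1 h4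
      refine ⟨k, fun j hj => (isMaxEdge_succ_iff hS x j).1 (h1 _ (by omega)),
        fun j hj => (isMinEdge_succ_iff hS y j).1 (h5 _ (by omega)), h4'.2, fun j hj => ?_⟩
      refine ⟨?_, ((edge_succ_eq_iff x y j).1 (h3 (j + 1) (by omega))).2⟩
      obtain ⟨j, rfl⟩ : ∃ j', j = j' + 1 := ⟨j - 1, by omega⟩
      rcases Nat.lt_or_ge k j with hkj | hkj
      · exact ((edge_succ_eq_iff x y j).1 (h3 (j + 1) (by omega))).1
      · obtain rfl : j = k := by omega
        exact h4'.1
  · rintro ⟨k, h1, h2, h3, h4⟩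
    refine ⟨k + 1, ?_, ?_, ?_, ?_, ?_⟩
    · intro j hj
      cases j with
      | zero => exact isMaxEdge_zero x
      | succ j => exact (isMaxEdge_succ_iff hS x j).2 (h1 j (by omega))
    · rw [isMaxEdge_succ_iff hS]
      have := pos_lt y k
      rw [(h4 (k + 1) (by omega)).1] at this
      omega
    · intro j hj
      obtain ⟨j, rfl⟩ : ∃ j', j = j' + 1 := ⟨j - 1, by omega⟩
      exact (edge_succ_eq_iff x y j).2 ⟨(h4 _ (by omega)).1, (h4 _ (by omega)).2⟩
    · exact (isSuccEdge_succ_iff hS x y k).2 ⟨(h4 _ (by omega)).1, h3⟩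
    · intro j hj
      cases j with
      | zero => exact isMinEdge_zero y
      | succ j => exact (isMinEdge_succ_iff hS y j).2 (h2 j (by omega))

theorem isRegular (hp : ∀ k i, χ k i ≠ []) (hne : ∀ k, (S k).Nonempty)
    (hS : LetterClosed χ S) (hout : ∀ k, ∀ a ∈ S k, ∃ i ∈ S (k + 1), a ∈ χ k i) :
    (substDiagram χ S).IsRegular := by
  refine ⟨fun k v => ?_, fun k v => ?_, fun v => ⟨v, rfl, fun e he => he⟩⟩
  · cases k with
    | zero =>
      obtain ⟨i, hi⟩ := hne 0
      exact ⟨(⟨i, hi⟩ : S 0), Subsingleton.elim (α := Unit) _ _⟩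
    | succ k =>
      obtain ⟨i, hi, ha⟩ := hout k _ (show (v : S k).1 ∈ S k from (v : S k).2)
      obtain ⟨m, hm⟩ := List.get_of_mem ha
      exact ⟨(⟨⟨⟨i, hi⟩, m⟩, by rw [hm]; exact (v : S k).2⟩ : substEdge χ S (k + 1)),
        Subtype.ext hm⟩
  · cases k with
    | zero => exact ⟨v, rfl⟩
    | succ k =>
      obtain ⟨e, he, -⟩ := exists_edge hS (show (v : S (k + 1)).1 ∈ S (k + 1) from
        (v : S (k + 1)).2) (m := 0) (List.length_pos_iff.2 (hp k _))
      exact ⟨e, he⟩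

/-! ### The Vershik map of a proper sequence of substitutions -/

section Proper

variable {a b : ℕ → Fin q}

/-- Data of a proper sequence of substitutions: `a k` and `b k` are the common first and last
letters of the words of `χ k`. -/
def ProperWith (χ : ℕ → Fin q → List (Fin q)) (a b : ℕ → Fin q) : Prop :=
  ∀ k i, (χ k i).head? = some (a k) ∧ (χ k i).getLast? = some (b k)

theorem ProperWith.length_pos (hab : ProperWith χ a b) (k : ℕ) (i : Fin q) :
    0 < (χ k i).length := by
  have := (hab k i).1
  cases h : χ k i with
  | nil => simp [h] at this
  | cons c l => simp

theorem ProperWith.getElem_zero (hab : ProperWith χ a b) (k : ℕ) (i : Fin q) :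
    (χ k i)[0]'(hab.length_pos k i) = a k := by
  have := (hab k i).1
  rw [List.head?_eq_getElem?, List.getElem?_eq_getElem (hab.length_pos k i)] at this
  exact Option.some_injective _ this

theorem ProperWith.getElem_last (hab : ProperWith χ a b) (k : ℕ) (i : Fin q) (m : ℕ)
    (hm : m + 1 = (χ k i).length) :
    (χ k i)[m]'(by omega) = b k := by
  have := (hab k i).2
  rw [List.getLast?_eq_getElem?, ← hm, Nat.add_sub_cancel,
    List.getElem?_eq_getElem (by omega)] at this
  exact Option.some_injective _ this

theorem ProperWith.first_mem (hab : ProperWith χ a b) (hne : ∀ k, (S k).Nonempty)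
    (hS : LetterClosed χ S) (k : ℕ) : a k ∈ S k := by
  obtain ⟨i, hi⟩ := hne (k + 1)
  exact hS k i hi _ (List.mem_of_getElem (hab.getElem_zero k i))

theorem ProperWith.last_mem (hab : ProperWith χ a b) (hne : ∀ k, (S k).Nonempty)
    (hS : LetterClosed χ S) (k : ℕ) : b k ∈ S k := by
  obtain ⟨i, hi⟩ := hne (k + 1)
  have := hab.length_pos k i
  exact hS k i hi _ (List.mem_of_getElem (hab.getElem_last k i ((χ k i).length - 1) (by omega)))

theorem letter_eq_first (hab : ProperWith χ a b) (x : (substDiagram χ S).Path) {k : ℕ}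
    (h : pos x k = 0) : letter x k = a k := by
  rw [← getElem_pos x k, ← hab.getElem_zero k (letter x (k + 1))]
  congr 1

theorem letter_eq_last (hab : ProperWith χ a b) (x : (substDiagram χ S).Path) {k : ℕ}
    (h : pos x k + 1 = (χ k (letter x (k + 1))).length) : letter x k = b k := by
  rw [← getElem_pos x k, ← hab.getElem_last k (letter x (k + 1)) _ h]

theorem existsUnique_minPath (hab : ProperWith χ a b) (hne : ∀ k, (S k).Nonempty)
    (hS : LetterClosed χ S) : ∃! x : (substDiagram χ S).Path, IsMinPath x := by
  obtain ⟨x, hx, hx'⟩ := exists_path (χ := χ) (S := S) (i := a) (p := fun _ => 0)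
    (hab.first_mem hne hS) (fun k => ⟨hab.length_pos _ _, hab.getElem_zero _ _⟩)
  refine ⟨x, (isMinPath_iff hS x).2 hx', fun y hy => ?_⟩
  have hy := (isMinPath_iff hS y).1 hy
  exact path_ext (fun k => by rw [hx, letter_eq_first hab y (hy k)])
    (fun k => by rw [hx', hy])

theorem existsUnique_maxPath (hab : ProperWith χ a b) (hne : ∀ k, (S k).Nonempty)
    (hS : LetterClosed χ S) : ∃! x : (substDiagram χ S).Path, IsMaxPath x := by
  have hl := fun k => hab.length_pos k (b (k + 1))
  obtain ⟨x, hx, hx'⟩ := exists_path (χ := χ) (S := S) (i := b)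
    (p := fun k => (χ k (b (k + 1))).length - 1) (hab.last_mem hne hS)
    (fun k => ⟨by have := hl k; omega, hab.getElem_last _ _ _ (by have := hl k; omega)⟩)
  refine ⟨x, (isMaxPath_iff hS x).2 fun k => ?_, fun y hy => ?_⟩
  · rw [hx', hx]; have := hl k; omega
  · have hy := (isMaxPath_iff hS y).1 hy
    have hy' : ∀ k, letter y k = b k := fun k => letter_eq_last hab y (hy k)
    refine path_ext (fun k => by rw [hx, hy']) (fun k => ?_)
    have := hy k
    rw [hy'] at this
    rw [hx']; omega

theorem exists_succAt (hab : ProperWith χ a b) (hne : ∀ k, (S k).Nonempty)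
    (hS : LetterClosed χ S) (x : (substDiagram χ S).Path) (hx : ¬ IsMaxPath x) :
    ∃ y k, SuccAt x y k := by
  classical
  rw [isMaxPath_iff hS, not_forall] at hx
  obtain ⟨k, hk, hmin⟩ : ∃ k, ¬ (pos x k + 1 = (χ k (letter x (k + 1))).length) ∧
      ∀ j < k, pos x j + 1 = (χ j (letter x (j + 1))).length :=
    ⟨Nat.find hx, Nat.find_spec hx, fun j hj => not_not.1 (Nat.find_min hx hj)⟩
  have hlt := pos_lt x k
  have hlt' : pos x k + 1 < (χ k (letter x (k + 1))).length := by omega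
  obtain ⟨y, hy, hy'⟩ := exists_path (χ := χ) (S := S)
    (i := fun j => if j < k then a j else if h : j = k then
      (χ k (letter x (k + 1)))[pos x k + 1] else letter x j)
    (p := fun j => if j < k then 0 else if j = k then pos x k + 1 else pos x j)
    (fun j => by
      split_ifs with h1 h2
      · exact hab.first_mem hne hS j
      · subst h2; exact hS _ _ (letter_mem x _) _ (List.getElem_mem _)
      · exact letter_mem x j)
    (fun j => by
      rcases lt_trichotomy j k with h | h | h
      · simp only [h, if_true]
        exact ⟨hab.length_pos _ _, hab.getElem_zero _ _⟩
      · subst h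
        simp only [lt_irrefl, if_false, if_true, dif_pos]
        simp only [show ¬ (j + 1 < j) by omega, show ¬ (j + 1 = j) by omega, if_false, dif_neg,
          not_false_eq_true]
        exact ⟨hlt', trivial⟩
      · simp only [show ¬ (j < k) by omega, show ¬ (j = k) by omega, if_false,
          show ¬ (j + 1 < k) by omega, show ¬ (j + 1 = k) by omega, dif_neg, not_false_eq_true]
        exact ⟨pos_lt x j, getElem_pos x j⟩)
  refine ⟨y, k, hmin, fun j hj => by simp [hy', hj], by simp [hy'], fun j hj => ?_⟩
  simp [hy, hy', show ¬ (j < k) by omega, show ¬ (j = k) by omega]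

theorem exists_predAt (hab : ProperWith χ a b) (hne : ∀ k, (S k).Nonempty)
    (hS : LetterClosed χ S) (y : (substDiagram χ S).Path) (hy : ¬ IsMinPath y) :
    ∃ x k, SuccAt x y k := by
  classical
  rw [isMinPath_iff hS, not_forall] at hy
  obtain ⟨k, hk, hmin⟩ : ∃ k, ¬ (pos y k = 0) ∧ ∀ j < k, pos y j = 0 :=
    ⟨Nat.find hy, Nat.find_spec hy, fun j hj => not_not.1 (Nat.find_min hy hj)⟩
  have hlt := pos_lt y k
  have hlt' : pos y k - 1 < (χ k (letter y (k + 1))).length := by omega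
  let i : ℕ → Fin q := fun j => if j < k then b j else if h : j = k then
      (χ k (letter y (k + 1)))[pos y k - 1] else letter y j
  obtain ⟨x, hx, hx'⟩ := exists_path (χ := χ) (S := S) (i := i)
    (p := fun j => if j < k then (χ j (i (j + 1))).length - 1 else
      if j = k then pos y k - 1 else pos y j)
    (fun j => by
      dsimp only [i]
      split_ifs with h1 h2
      · exact hab.last_mem hne hS j
      · subst h2; exact hS _ _ (letter_mem y _) _ (List.getElem_mem _)
      · exact letter_mem y j)
    (fun j => by
      rcases lt_trichotomy j k with h | h | h
      · have := hab.length_pos j (i (j + 1))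
        have hi : i j = b j := by simp [i, h]
        simp only [h, if_true, hi]
        exact ⟨by omega, hab.getElem_last _ _ _ (by omega)⟩
      · subst h
        have hi : i (j + 1) = letter y (j + 1) := by simp [i]
        have hi' : i j = (χ j (letter y (j + 1)))[pos y j - 1] := by simp [i]
        simp only [lt_irrefl, if_false, if_true, hi, hi']
        exact ⟨hlt', trivial⟩
      · have hi : i (j + 1) = letter y (j + 1) := by
          simp [i, show ¬ (j + 1 < k) by omega, show ¬ (j + 1 = k) by omega]
        have hi' : i j = letter y j := by
          simp [i, show ¬ (j < k) by omega, show ¬ (j = k) by omega]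
        simp only [show ¬ (j < k) by omega, show ¬ (j = k) by omega, if_false, hi, hi']
        exact ⟨pos_lt y j, getElem_pos y j⟩)
  refine ⟨x, k, fun j hj => ?_, hmin, ?_, fun j hj => ?_⟩
  · have := hab.length_pos j (i (j + 1))
    rw [hx', hx, if_pos hj]
    omega
  · simp only [hx', lt_irrefl, if_false, if_true]
    omega
  · simp [hx, hx', i, show ¬ (j < k) by omega, show ¬ (j = k) by omega]

/-- The level of change is the lowest one at which the edge of `x` is not maximal. -/
theorem succAt_level_unique {x y y' : (substDiagram χ S).Path} {k k' : ℕ}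
    (h : SuccAt x y k) (h' : SuccAt x y' k') : k = k' := by
  by_contra hne
  wlog hlt : k < k' generalizing k k' y y'
  · exact this h' h (Ne.symm hne) (by omega)
  have h1 := h'.1 k hlt
  have h2 := pos_lt y k
  rw [(h.2.2.2 (k + 1) (by omega)).1, h.2.2.1] at h2
  omega

/-- The level of change is the lowest one at which the edge of `y` is not minimal. -/
theorem succAt_level_unique' {x x' y : (substDiagram χ S).Path} {k k' : ℕ}
    (h : SuccAt x y k) (h' : SuccAt x' y k') : k = k' := by
  by_contra hne
  wlog hlt : k < k' generalizing k k' x x'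
  · exact this h' h (Ne.symm hne) (by omega)
  have h1 := h'.2.1 k hlt
  rw [h.2.2.1] at h1
  omega

/-- The letter at one level and the positions below determine the letters below. -/
theorem letter_eq_of_pos_eq {x y : (substDiagram χ S).Path} {k : ℕ}
    (h : letter x k = letter y k) {j : ℕ} (hjk : j ≤ k)
    (hpos : ∀ m, j ≤ m → m < k → pos x m = pos y m) : letter x j = letter y j := by
  induction hjk using Nat.decreasingInduction with
  | self => exact h
  | of_succ m hm ih =>
    have h1 := ih (fun l hl hl' => hpos l (by omega) hl')
    rw [← getElem_pos x m, ← getElem_pos y m]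
    simp only [h1, hpos m le_rfl hm]

theorem succAt_right_unique {x y y' : (substDiagram χ S).Path} {k k' : ℕ}
    (h : SuccAt x y k) (h' : SuccAt x y' k') : y = y' := by
  obtain rfl := succAt_level_unique h h'
  have hpos : ∀ j, pos y j = pos y' j := fun j => by
    rcases lt_trichotomy j k with hj | rfl | hj
    · rw [h.2.1 j hj, h'.2.1 j hj]
    · rw [h.2.2.1, h'.2.2.1]
    · rw [(h.2.2.2 j hj).2, (h'.2.2.2 j hj).2]
  have hl : ∀ j, k < j → letter y j = letter y' j := fun j hj => by
    rw [(h.2.2.2 j hj).1, (h'.2.2.2 j hj).1]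
  refine path_ext (fun j => ?_) hpos
  rcases Nat.lt_or_ge k j with hj | hj
  · exact hl j hj
  · exact letter_eq_of_pos_eq (hl (k + 1) (by omega)) (by omega) (fun m _ _ => hpos m)

theorem succAt_left_unique {x x' y : (substDiagram χ S).Path} {k k' : ℕ}
    (h : SuccAt x y k) (h' : SuccAt x' y k') : x = x' := by
  obtain rfl := succAt_level_unique' h h'
  have hk : ∀ j, k ≤ j → pos x j = pos x' j := fun j hj => by
    rcases hj.eq_or_lt with rfl | hj
    · have h1 := h.2.2.1
      have h2 := h'.2.2.1
      omega
    · rw [← (h.2.2.2 j hj).2, ← (h'.2.2.2 j hj).2]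
  have hl : ∀ j, k < j → letter x j = letter x' j := fun j hj => by
    rw [← (h.2.2.2 j hj).1, ← (h'.2.2.2 j hj).1]
  have key : ∀ j ≤ k, letter x j = letter x' j ∧ pos x j = pos x' j := by
    intro j hj
    induction hj using Nat.decreasingInduction with
    | self =>
      exact ⟨letter_eq_of_pos_eq (hl (k + 1) (by omega)) (by omega) (fun m hm _ => hk m hm),
        hk k le_rfl⟩
    | of_succ m hm ih =>
      have h1 := h.1 m hm
      have h2 := h'.1 m hm
      rw [ih.1] at h1
      have h3 : pos x m = pos x' m := by omega
      refine ⟨?_, h3⟩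
      rw [← getElem_pos x m, ← getElem_pos x' m]
      simp only [ih.1, h3]
  refine path_ext (fun j => ?_) (fun j => ?_)
  · rcases Nat.lt_or_ge k j with hj | hj
    · exact hl j hj
    · exact (key j hj).1
  · rcases Nat.lt_or_ge k j with hj | hj
    · exact hk j hj.le
    · exact (key j hj).2

/-- The paths that agree with `x` up to level `n` form a neighbourhood of `x`. -/
theorem cylinder_mem_nhds (x : (substDiagram χ S).Path) (n : ℕ) :
    {y : (substDiagram χ S).Path | ∀ k ≤ n, letter y k = letter x k ∧ pos y k = pos x k} ∈ 𝓝 x := by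
  let _ : ∀ k, TopologicalSpace ((substDiagram χ S).E k) := fun _ => ⊥
  have _ : ∀ k, DiscreteTopology ((substDiagram χ S).E k) := fun _ => ⟨rfl⟩
  have hc : ∀ k, Continuous fun y : (substDiagram χ S).Path => y.1 k := fun k =>
    (continuous_apply k).comp continuous_induced_dom
  have h : ∀ k ∈ Finset.range (n + 2), {y : (substDiagram χ S).Path | y.1 k = x.1 k} ∈ 𝓝 x :=
    fun k _ => (hc k).continuousAt.preimage_mem_nhds
      ((isOpen_discrete {x.1 k}).mem_nhds rfl)
  refine Filter.mem_of_superset ((Filter.biInter_finset_mem _).2 h) fun y hy k hk => ?_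
  simp only [mem_iInter, Finset.mem_range, mem_ofPred_eq] at hy
  refine ⟨?_, ((edge_succ_eq_iff x y k).1 (hy (k + 1) (by omega))).2⟩
  unfold letter
  rw [hy k (by omega)]

/-- Continuity of a map into the path space can be checked on the first letters and positions. -/
theorem continuous_of_eventually_agree {Y : Type*} [TopologicalSpace Y]
    {f : Y → (substDiagram χ S).Path}
    (h : ∀ y n, ∀ᶠ y' in 𝓝 y, ∀ k ≤ n, letter (f y') k = letter (f y) k ∧
      pos (f y') k = pos (f y) k) : Continuous f := by
  let _ : ∀ k, TopologicalSpace ((substDiagram χ S).E k) := fun _ => ⊥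
  have _ : ∀ k, DiscreteTopology ((substDiagram χ S).E k) := fun _ => ⟨rfl⟩
  refine continuous_induced_rng.2 (continuous_pi fun k => ?_)
  refine (continuous_iff_continuousAt.2 fun y => ?_)
  refine tendsto_nhds.2 fun U _ hy => ?_
  filter_upwards [h y k] with y' hy'
  have : (f y').1 k = (f y).1 k := by
    cases k with
    | zero => exact (edge_zero_eq_iff _ _).2 (hy' 0 le_rfl).1
    | succ k =>
      exact (edge_succ_eq_iff _ _ k).2 ⟨(hy' (k + 1) le_rfl).1, (hy' k (by omega)).2⟩
  change (f y').1 k ∈ U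
  rw [this]
  exact hy

instance : CompactSpace (substDiagram χ S).Path := by
  let _ : ∀ k, TopologicalSpace ((substDiagram χ S).E k) := fun _ => ⊥
  let _ : ∀ k, TopologicalSpace ((substDiagram χ S).V k) := fun _ => ⊥
  have _ : ∀ k, DiscreteTopology ((substDiagram χ S).E k) := fun _ => ⟨rfl⟩
  have _ : ∀ k, DiscreteTopology ((substDiagram χ S).V k) := fun _ => ⟨rfl⟩
  have _ : ∀ k, Finite ((substDiagram χ S).E k) := (substDiagram χ S).finite_E
  have hcl : IsClosed {x : ∀ k, (substDiagram χ S).E k |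
      ∀ k, (substDiagram χ S).tgt k (x k) = (substDiagram χ S).src (k + 1) (x (k + 1))} := by
    simp only [ofPred_forall]
    refine isClosed_iInter fun k => isClosed_eq ?_ ?_
    · exact continuous_of_discreteTopology.comp (continuous_apply k)
    · exact (continuous_of_discreteTopology (f := (substDiagram χ S).src (k + 1))).comp
        (continuous_apply (k + 1))
  exact isCompact_iff_compactSpace.1 hcl.isCompact

instance : T2Space (substDiagram χ S).Path := by
  let _ : ∀ k, TopologicalSpace ((substDiagram χ S).E k) := fun _ => ⊥
  have _ : ∀ k, DiscreteTopology ((substDiagram χ S).E k) := fun _ => ⟨rfl⟩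
  exact T2Space.of_injective_continuous Subtype.val_injective continuous_induced_dom

/-- For a proper sequence of substitutions, the Vershik map of the diagram is a homeomorphism.
It is a bijection because successors and predecessors of paths are unique, and it is continuous at
the maximal path because minimal edges of one level have the same source. -/
theorem exists_vershikHomeo (hab : ProperWith χ a b) (hne : ∀ k, (S k).Nonempty)
    (hS : LetterClosed χ S) :
    ∃ τ : (substDiagram χ S).Path ≃ₜ (substDiagram χ S).Path, IsVershikMap τ := by
  classical
  obtain ⟨xmin, hmin, hminu⟩ := existsUnique_minPath hab hne hS
  obtain ⟨xmax, hmax, hmaxu⟩ := existsUnique_maxPath hab hne hS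
  have hsucc := exists_succAt hab hne hS
  choose s hs using hsucc
  let τ : (substDiagram χ S).Path → (substDiagram χ S).Path := fun x =>
    if h : IsMaxPath x then xmin else s x h
  have hτmax : ∀ x, IsMaxPath x → τ x = xmin := fun x hx => dif_pos hx
  have hτ : ∀ x, ¬ IsMaxPath x → ∃ k, SuccAt x (τ x) k := fun x hx => by
    have h : τ x = s x hx := dif_neg hx
    rw [h]; exact hs x hx
  have hposmin := (isMinPath_iff hS xmin).1 hmin
  have hnotmin : ∀ x y k, SuccAt x y k → y ≠ xmin := by
    rintro x y k h rfl
    have h1 := h.2.2.1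
    rw [hposmin] at h1
    omega
  have hinj : Function.Injective τ := by
    intro x x' hxx
    by_cases hx : IsMaxPath x <;> by_cases hx' : IsMaxPath x'
    · rw [hmaxu x hx, hmaxu x' hx']
    · obtain ⟨k, hk⟩ := hτ x' hx'
      exact absurd (hxx.symm.trans (hτmax x hx)) (hnotmin _ _ _ hk)
    · obtain ⟨k, hk⟩ := hτ x hx
      exact absurd (hxx.trans (hτmax x' hx')) (hnotmin _ _ _ hk)
    · obtain ⟨k, hk⟩ := hτ x hx
      obtain ⟨k', hk'⟩ := hτ x' hx'
      rw [hxx] at hk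
      exact succAt_left_unique hk hk'
  have hsurj : Function.Surjective τ := by
    intro y
    by_cases hy : IsMinPath y
    · exact ⟨xmax, by rw [hτmax _ hmax, hminu y hy]⟩
    · obtain ⟨x, k, hk⟩ := exists_predAt hab hne hS y hy
      have hx : ¬ IsMaxPath x := by
        intro hx
        have h1 := (isMaxPath_iff hS x).1 hx k
        have h2 := pos_lt y k
        rw [(hk.2.2.2 (k + 1) (by omega)).1, hk.2.2.1] at h2
        omega
      obtain ⟨k', hk'⟩ := hτ x hx
      exact ⟨x, succAt_right_unique hk' hk⟩
  have hcont : Continuous τ := by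
    refine continuous_of_eventually_agree fun x n => ?_
    by_cases hx : IsMaxPath x
    · have hxp := (isMaxPath_iff hS x).1 hx
      -- a path that is maximal up to level `n + 2` changes above that level, so that its image
      -- is minimal up to level `n`
      filter_upwards [cylinder_mem_nhds x (n + 2)] with y hy m hm
      rw [hτmax x hx, hposmin, letter_eq_first hab _ (hposmin m)]
      suffices h : pos (τ y) m = 0 from ⟨letter_eq_first hab _ h, h⟩
      by_cases hy' : IsMaxPath y
      · rw [hτmax y hy', hposmin]
      · obtain ⟨k, hk⟩ := hτ y hy'
        refine hk.2.1 m ?_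
        by_contra hkm
        have h2 := pos_lt (τ y) k
        rw [(hk.2.2.2 (k + 1) (by omega)).1, hk.2.2.1, (hy k (by omega)).2,
          (hy (k + 1) (by omega)).1, ← hxp k] at h2
        omega
    · obtain ⟨k, hk⟩ := hτ x hx
      -- paths that agree with `x` beyond the level of change `k` change at that level, too
      filter_upwards [cylinder_mem_nhds x (max n k + 2)] with y hy
      have hyk : pos y k + 1 < (χ k (letter y (k + 1))).length := by
        have h2 := pos_lt (τ x) k
        rw [(hk.2.2.2 (k + 1) (by omega)).1, hk.2.2.1] at h2
        rwa [(hy k (by omega)).2, (hy (k + 1) (by omega)).1]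
      have hy' : ¬ IsMaxPath y := fun h => by
        have := (isMaxPath_iff hS y).1 h k
        omega
      obtain ⟨k', hk'⟩ := hτ y hy'
      obtain rfl : k' = k := by
        rcases lt_trichotomy k' k with h | h | h
        · have h1 := hk.1 k' h
          have h2 := pos_lt (τ y) k'
          rw [(hk'.2.2.2 (k' + 1) (by omega)).1, hk'.2.2.1, (hy k' (by omega)).2,
            (hy (k' + 1) (by omega)).1] at h2
          omega
        · exact h
        · have := hk'.1 k h
          omega
      have hpos : ∀ m ≤ max n k' + 1, pos (τ y) m = pos (τ x) m := fun m hm => by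
        rcases lt_trichotomy m k' with h | rfl | h
        · rw [hk.2.1 m h, hk'.2.1 m h]
        · rw [hk.2.2.1, hk'.2.2.1, (hy m (by omega)).2]
        · rw [(hk.2.2.2 m h).2, (hk'.2.2.2 m h).2, (hy m (by omega)).2]
      intro m hm
      refine ⟨?_, hpos m (by omega)⟩
      refine letter_eq_of_pos_eq (k := max n k' + 1) ?_ (by omega)
        (fun j _ hj' => hpos j (by omega))
      rw [(hk.2.2.2 _ (by omega)).1, (hk'.2.2.2 _ (by omega)).1, (hy _ (by omega)).1]
  refine ⟨Continuous.homeoOfEquivCompactToT2 (f := Equiv.ofBijective τ ⟨hinj, hsurj⟩) hcont,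
    fun x hx => (isSuccPath_iff hS _ _).2 (hτ x hx), fun x hx => ?_⟩
  change IsMinPath (τ x)
  rw [hτmax x hx]
  exact hmin

end Proper

end SubstPath

/-! ### First return maps -/

namespace FirstReturn

variable {α : Type*} {f : α → α} {A B : Set α} {x y z : α}

/-- The first return time to `A` (`0` if there is no return). -/
def retTime (f : α → α) (A : Set α) (x : α) : ℕ := sInf {n : ℕ | 0 < n ∧ f^[n] x ∈ A}

/-- The first return map to `A`. -/
def ret (f : α → α) (A : Set α) (x : α) : α := f^[retTime f A x] x

/-- Every point of `A` returns to `A`. -/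
def Recurrent (f : α → α) (A : Set α) : Prop := ∀ x ∈ A, ∃ n, 0 < n ∧ f^[n] x ∈ A

theorem retTime_isLeast (h : ∃ n, 0 < n ∧ f^[n] x ∈ A) :
    IsLeast {n : ℕ | 0 < n ∧ f^[n] x ∈ A} (retTime f A x) :=
  ⟨Nat.sInf_mem h, fun _ hn => Nat.sInf_le hn⟩

theorem retTime_pos (h : ∃ n, 0 < n ∧ f^[n] x ∈ A) : 0 < retTime f A x :=
  (retTime_isLeast h).1.1

theorem ret_mem (h : ∃ n, 0 < n ∧ f^[n] x ∈ A) : ret f A x ∈ A := (retTime_isLeast h).1.2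

theorem notMem_of_lt_retTime {n : ℕ} (h0 : 0 < n) (h : n < retTime f A x) : f^[n] x ∉ A :=
  fun hA => Nat.notMem_of_lt_sInf h ⟨h0, hA⟩

theorem retTime_eq {n : ℕ} (h0 : 0 < n) (h : f^[n] x ∈ A)
    (h' : ∀ m, 0 < m → m < n → f^[m] x ∉ A) : retTime f A x = n := by
  have hl := retTime_isLeast (f := f) (A := A) (x := x) ⟨n, h0, h⟩
  refine le_antisymm (hl.2 ⟨h0, h⟩) (not_lt.1 fun hlt => h' _ hl.1.1 hlt hl.1.2)

/-- The time of the `n`-th return to `A`. -/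
def visitTime (f : α → α) (A : Set α) (x : α) (n : ℕ) : ℕ :=
  ∑ j ∈ Finset.range n, retTime f A ((ret f A)^[j] x)

theorem visitTime_succ (n : ℕ) : visitTime f A x (n + 1) =
    visitTime f A x n + retTime f A ((ret f A)^[n] x) := Finset.sum_range_succ _ _

theorem visitTime_succ' (n : ℕ) : visitTime f A x (n + 1) =
    visitTime f A (ret f A x) n + retTime f A x := by
  unfold visitTime
  rw [Finset.sum_range_succ']
  rfl

theorem ret_iterate (n : ℕ) : (ret f A)^[n] x = f^[visitTime f A x n] x := by
  induction n with
  | zero => rfl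
  | succ n ih =>
    rw [Function.iterate_succ_apply', visitTime_succ, add_comm, Function.iterate_add_apply, ← ih]
    rfl

theorem ret_iterate_mem (hA : Recurrent f A) (hx : x ∈ A) (n : ℕ) : (ret f A)^[n] x ∈ A := by
  induction n with
  | zero => exact hx
  | succ n ih =>
    rw [Function.iterate_succ_apply']
    exact ret_mem (hA _ ih)

theorem visitTime_strictMono (hA : Recurrent f A) (hx : x ∈ A) : StrictMono (visitTime f A x) :=
  strictMono_nat_of_lt_succ fun n => by
    rw [visitTime_succ]
    have := retTime_pos (hA _ (ret_iterate_mem hA hx n))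
    omega

/-- Every time at which the orbit is in `A` is the time of some return. -/
theorem exists_visitTime_eq (hA : Recurrent f A) {m : ℕ} (hx : x ∈ A) (h : f^[m] x ∈ A) :
    ∃ n, visitTime f A x n = m := by
  induction m using Nat.strong_induction_on generalizing x with
  | _ m ih =>
    rcases Nat.eq_zero_or_pos m with rfl | hm
    · exact ⟨0, rfl⟩
    · have hl := retTime_isLeast (hA x hx)
      have hle : retTime f A x ≤ m := hl.2 ⟨hm, h⟩
      have h' : f^[m - retTime f A x] (ret f A x) ∈ A := by
        unfold ret
        rwa [← Function.iterate_add_apply, Nat.sub_add_cancel hle]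
      obtain ⟨n, hn⟩ := ih _ (by have := hl.1.1; omega) (ret_mem (hA x hx)) h'
      exact ⟨n + 1, by rw [visitTime_succ', hn]; omega⟩

/-- The first return to a subset of `A` can be computed with the first return map to `A`. -/
theorem retTime_retTime (hA : Recurrent f A) (hBA : B ⊆ A) (hx : x ∈ A)
    (h : ∃ n, 0 < n ∧ f^[n] x ∈ B) :
    (∃ n, 0 < n ∧ (ret f A)^[n] x ∈ B) ∧
      visitTime f A x (retTime (ret f A) B x) = retTime f B x := by
  have key : ∀ m, 0 < m → f^[m] x ∈ B →
      ∃ n, 0 < n ∧ (ret f A)^[n] x ∈ B ∧ visitTime f A x n = m := by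
    intro m hm hmB
    obtain ⟨n, hn⟩ := exists_visitTime_eq hA hx (hBA hmB)
    refine ⟨n, ?_, by rw [ret_iterate, hn]; exact hmB, hn⟩
    rcases Nat.eq_zero_or_pos n with rfl | h0
    · exact absurd hn (by simp [visitTime]; omega)
    · exact h0
  have h' : ∃ n, 0 < n ∧ (ret f A)^[n] x ∈ B := by
    obtain ⟨m, hm, hmB⟩ := h
    obtain ⟨n, h1, h2, -⟩ := key m hm hmB
    exact ⟨n, h1, h2⟩
  refine ⟨h', ?_⟩
  have hl := retTime_isLeast h'
  have hmono := visitTime_strictMono hA hx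
  symm
  refine retTime_eq ?_ ?_ fun m hm hlt hmB => ?_
  · exact lt_of_le_of_lt (Nat.zero_le _) (hmono hl.1.1)
  · rw [← ret_iterate]; exact hl.1.2
  · obtain ⟨n, h1, h2, h3⟩ := key m hm hmB
    have h4 := hl.2 ⟨h1, h2⟩
    have h5 := hmono.monotone h4
    omega

theorem ret_ret (hA : Recurrent f A) (hBA : B ⊆ A) (hx : x ∈ A)
    (h : ∃ n, 0 < n ∧ f^[n] x ∈ B) : ret (ret f A) B x = ret f B x := by
  rw [ret, ret_iterate, (retTime_retTime hA hBA hx h).2, ret]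

/-- The points have a common iterate. -/
def SameOrbit (f : α → α) (x y : α) : Prop := ∃ m n, f^[m] x = f^[n] y

theorem SameOrbit.symm (h : SameOrbit f x y) : SameOrbit f y x := by
  obtain ⟨m, n, h⟩ := h
  exact ⟨n, m, h.symm⟩

theorem SameOrbit.trans (h : SameOrbit f x y) (h' : SameOrbit f y z) : SameOrbit f x z := by
  obtain ⟨m, n, h⟩ := h
  obtain ⟨k, l, h'⟩ := h'
  refine ⟨k + m, n + l, ?_⟩
  rw [Function.iterate_add_apply, h, ← Function.iterate_add_apply, add_comm,
    Function.iterate_add_apply, h', ← Function.iterate_add_apply]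

theorem sameOrbit_iterate (n : ℕ) : SameOrbit f x (f^[n] x) := ⟨n, 0, rfl⟩

theorem sameOrbit_ret_iff (hA : Recurrent f A) (hx : x ∈ A) (hy : y ∈ A) :
    SameOrbit (ret f A) x y ↔ SameOrbit f x y := by
  constructor
  · rintro ⟨m, n, h⟩
    rw [ret_iterate, ret_iterate] at h
    exact ⟨_, _, h⟩
  · rintro ⟨m, n, h⟩
    have hbig : ∃ l, m ≤ l ∧ f^[l] x ∈ A := by
      refine ⟨visitTime f A x m, (visitTime_strictMono hA hx).le_apply, ?_⟩
      rw [← ret_iterate]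
      exact ret_iterate_mem hA hx m
    obtain ⟨l, hml, hl⟩ := hbig
    have h' : f^[l] x = f^[l - m + n] y := by
      rw [Function.iterate_add_apply, ← h, ← Function.iterate_add_apply, Nat.sub_add_cancel hml]
    obtain ⟨m', hm'⟩ := exists_visitTime_eq hA hx hl
    obtain ⟨n', hn'⟩ := exists_visitTime_eq hA hy (h' ▸ hl)
    exact ⟨m', n', by rw [ret_iterate, ret_iterate, hm', hn', h']⟩

/-- An injective self-map of a finite set has only periodic points. -/
theorem exists_iterate_eq_of_finite (hA : A.Finite) (hm : MapsTo f A A) (hi : InjOn f A)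
    (hx : x ∈ A) : ∃ n, 0 < n ∧ f^[n] x = x := by
  have hmaps : ∀ n, f^[n] x ∈ A := fun n => hm.iterate n hx
  obtain ⟨m, n, hne, heq⟩ : ∃ m n, m ≠ n ∧ f^[m] x = f^[n] x := by
    by_contra! h
    exact hA.not_infinite ((infinite_range_of_injective (f := fun n => f^[n] x)
      fun m n hmn => by_contra fun hne => h m n hne hmn).mono (range_subset_iff.2 hmaps))
  wlog hlt : m < n generalizing m n
  · exact this n m hne.symm heq.symm (by omega)
  refine ⟨n - m, by omega, ?_⟩
  refine (hi.iterate hm m) (hmaps _) hx ?_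
  rw [← Function.iterate_add_apply, Nat.add_sub_cancel' hlt.le, heq]

theorem iterate_conj {β : Type*} {φ : β → α} {g : β → β} {I : Set β} (hg : MapsTo g I I)
    (h : ∀ v ∈ I, f (φ v) = φ (g v)) {v : β} (hv : v ∈ I) (n : ℕ) :
    f^[n] (φ v) = φ (g^[n] v) := by
  induction n with
  | zero => rfl
  | succ n ih =>
    rw [Function.iterate_succ_apply', Function.iterate_succ_apply', ih, h _ (hg.iterate n hv)]

theorem retTime_conj {β : Type*} {φ : β → α} {g : β → β} {I C : Set β} (hg : MapsTo g I I)
    (h : ∀ v ∈ I, f (φ v) = φ (g v)) (hC : ∀ v ∈ I, φ v ∈ B ↔ v ∈ C) {v : β} (hv : v ∈ I) :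
    retTime f B (φ v) = retTime g C v := by
  unfold retTime
  congr 1
  ext n
  change (0 < n ∧ f^[n] (φ v) ∈ B) ↔ (0 < n ∧ g^[n] v ∈ C)
  rw [iterate_conj hg h hv, hC _ (hg.iterate n hv)]

end FirstReturn

/-! ### The von Neumann–Kakutani map and the exchange -/

namespace RotatedOdometer

open FirstReturn

theorem half_pow_pos (n : ℕ) : (0 : ℝ) < (1 / 2) ^ n := by positivity

theorem half_pow_le_one (n : ℕ) : ((1 : ℝ) / 2) ^ n ≤ 1 := pow_le_one₀ (by norm_num) (by norm_num)

theorem half_pow_lt_iff {m n : ℕ} : ((1 : ℝ) / 2) ^ m < (1 / 2) ^ n ↔ n < m :=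
  pow_lt_pow_iff_right_of_lt_one₀ (by norm_num) (by norm_num)

theorem half_pow_le_iff {m n : ℕ} : ((1 : ℝ) / 2) ^ m ≤ (1 / 2) ^ n ↔ n ≤ m :=
  pow_le_pow_iff_right_of_lt_one₀ (by norm_num) (by norm_num)

theorem exists_piece {x : ℝ} (hx : x ∈ Ico (0 : ℝ) 1) :
    ∃ n : ℕ, 1 - (1 / 2 : ℝ) ^ n ≤ x ∧ x < 1 - (1 / 2 : ℝ) ^ (n + 1) := by
  obtain ⟨n, h1, h2⟩ := exists_nat_pow_near_of_lt_one (x := 1 - x) (y := (1 / 2 : ℝ))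
    (by linarith [hx.2]) (by linarith [hx.1]) (by norm_num) (by norm_num)
  exact ⟨n, by linarith, by linarith⟩

theorem kakutani_eq {n : ℕ} {x : ℝ} (h1 : 1 - (1 / 2 : ℝ) ^ n ≤ x)
    (h2 : x < 1 - (1 / 2 : ℝ) ^ (n + 1)) : kakutani x = x - 1 + 3 * (1 / 2) ^ (n + 1) := by
  have : pieceIndex x = n + 1 := by
    refine IsLeast.csInf_eq ⟨h2, fun m hm => ?_⟩
    have hm : x < 1 - (1 / 2 : ℝ) ^ m := hm
    exact half_pow_lt_iff.1 (show ((1 : ℝ) / 2) ^ m < (1 / 2) ^ n by linarith)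
  rw [kakutani, this]
  ring

theorem kakutani_mem_piece {n : ℕ} {x : ℝ} (h1 : 1 - (1 / 2 : ℝ) ^ n ≤ x)
    (h2 : x < 1 - (1 / 2 : ℝ) ^ (n + 1)) :
    (1 / 2 : ℝ) ^ (n + 1) ≤ kakutani x ∧ kakutani x < (1 / 2) ^ n := by
  rw [kakutani_eq h1 h2]
  rw [pow_succ] at *
  constructor <;> linarith

theorem kakutani_special (n : ℕ) : kakutani (1 - (1 / 2 : ℝ) ^ n) = (1 / 2) ^ (n + 1) := by
  have := half_pow_pos n
  rw [kakutani_eq le_rfl (by rw [pow_succ]; linarith), pow_succ]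
  ring

theorem kakutani_mem {x : ℝ} (hx : x ∈ Ico (0 : ℝ) 1) : kakutani x ∈ Ioo (0 : ℝ) 1 := by
  obtain ⟨n, h1, h2⟩ := exists_piece hx
  have h := kakutani_mem_piece h1 h2
  exact ⟨(half_pow_pos _).trans_le h.1, h.2.trans_le (half_pow_le_one n)⟩

theorem kakutani_injOn : InjOn kakutani (Ico (0 : ℝ) 1) := by
  intro x hx y hy hxy
  obtain ⟨n, h1, h2⟩ := exists_piece hx
  obtain ⟨m, h3, h4⟩ := exists_piece hy
  have h5 := kakutani_mem_piece h1 h2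
  have h6 := kakutani_mem_piece h3 h4
  rw [hxy] at h5
  have h7 := half_pow_lt_iff.1 (h5.1.trans_lt h6.2)
  have h8 := half_pow_lt_iff.1 (h6.1.trans_lt h5.2)
  obtain rfl : n = m := by omega
  rw [kakutani_eq h1 h2, kakutani_eq h3 h4] at hxy
  linarith

theorem exists_half_pow_near {y : ℝ} (hy : y ∈ Ioo (0 : ℝ) 1) :
    ∃ n : ℕ, (1 / 2 : ℝ) ^ (n + 1) ≤ y ∧ y < (1 / 2) ^ n := by
  obtain ⟨n, h1, h2⟩ := exists_piece (x := 1 - y) ⟨by linarith [hy.2], by linarith [hy.1]⟩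
  rcases h1.eq_or_lt with h | h
  · cases n with
    | zero => exact absurd hy.2 (by norm_num at h; linarith)
    | succ n =>
      have := half_pow_pos n
      rw [pow_succ] at h
      exact ⟨n, by rw [pow_succ]; linarith, by linarith⟩
  · exact ⟨n, by linarith, by linarith⟩

theorem kakutani_surjOn : SurjOn kakutani (Ico (0 : ℝ) 1) (Ioo (0 : ℝ) 1) := by
  intro y hy
  obtain ⟨n, h1, h2⟩ := exists_half_pow_near hy
  have h3 : 1 - (1 / 2 : ℝ) ^ n ≤ y + 1 - 3 * (1 / 2) ^ (n + 1) := by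
    rw [pow_succ] at *; linarith
  have h4 : y + 1 - 3 * (1 / 2) ^ (n + 1) < 1 - (1 / 2 : ℝ) ^ (n + 1) := by
    rw [pow_succ] at *; linarith
  refine ⟨y + 1 - 3 * (1 / 2) ^ (n + 1), ⟨?_, ?_⟩, ?_⟩
  · linarith [half_pow_le_one n]
  · linarith [half_pow_pos (n + 1)]
  · rw [kakutani_eq h3 h4]; ring

/-- The preimage of `[0, 2 ^ -N)` under the von Neumann–Kakutani map. -/
theorem kakutani_lt_iff {x : ℝ} (hx : x ∈ Ico (0 : ℝ) 1) (N : ℕ) :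
    kakutani x < (1 / 2) ^ N ↔ 1 - (1 / 2 : ℝ) ^ N ≤ x := by
  obtain ⟨n, h1, h2⟩ := exists_piece hx
  have h := kakutani_mem_piece h1 h2
  constructor
  · intro hlt
    have h3 := half_pow_lt_iff.1 (h.1.trans_lt hlt)
    have := half_pow_le_iff.2 (show N ≤ n by omega)
    linarith
  · intro hle
    have h3 := half_pow_lt_iff.1 (show ((1 : ℝ) / 2) ^ (n + 1) < (1 / 2) ^ N by linarith)
    have := half_pow_le_iff.2 (show N ≤ n by omega)
    linarith

/-- The von Neumann–Kakutani map is self-similar: on `[1 - 2 ^ -N, 1)` it is a rescaled copy of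
itself. -/
theorem kakutani_scale {v : ℝ} (hv : v ∈ Ico (0 : ℝ) 1) (N : ℕ) :
    kakutani (1 - (1 / 2 : ℝ) ^ N + (1 / 2) ^ N * v) = (1 / 2) ^ N * kakutani v := by
  obtain ⟨n, h1, h2⟩ := exists_piece hv
  have hN := half_pow_pos N
  rw [kakutani_eq h1 h2, kakutani_eq (n := N + n)]
  · rw [pow_succ, pow_succ, pow_add]; ring
  · rw [pow_add]; nlinarith
  · rw [add_assoc, pow_add]; nlinarith

variable {q : ℕ} {π : Equiv.Perm (Fin q)}

theorem exchange_rep (i : Fin q) {t : ℝ} (h0 : 0 ≤ t) (h1 : t < 1) :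
    exchange q π (((i : ℕ) + t) / q) = ((π i : ℕ) + t) / q := by
  have hq : (0 : ℝ) < q := by exact_mod_cast i.pos
  have hfl : ⌊(q : ℝ) * (((i : ℕ) + t) / q)⌋₊ = i := by
    rw [mul_div_cancel₀ _ hq.ne', Nat.floor_eq_iff (by positivity)]
    constructor <;> linarith
  rw [exchange]
  simp only [hfl, Fin.is_lt, dif_pos]
  field_simp
  ring

theorem exists_rep [NeZero q] {x : ℝ} (hx : x ∈ Ico (0 : ℝ) 1) :
    ∃ i : Fin q, ∃ t : ℝ, 0 ≤ t ∧ t < 1 ∧ x = ((i : ℕ) + t) / q := by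
  have hq : (0 : ℝ) < q := by exact_mod_cast NeZero.pos q
  have hx0 : 0 ≤ (q : ℝ) * x := mul_nonneg hq.le hx.1
  have hlt : ⌊(q : ℝ) * x⌋₊ < q := by
    rw [Nat.floor_lt hx0]
    nlinarith [hx.2]
  refine ⟨⟨_, hlt⟩, (q : ℝ) * x - ⌊(q : ℝ) * x⌋₊, by linarith [Nat.floor_le hx0],
    by linarith [Nat.lt_floor_add_one ((q : ℝ) * x)], ?_⟩
  field_simp
  ring

theorem rep_mem (i : Fin q) {t : ℝ} (h0 : 0 ≤ t) (h1 : t < 1) :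
    ((i : ℕ) + t) / (q : ℝ) ∈ Ico (0 : ℝ) 1 := by
  have hq : (0 : ℝ) < q := by exact_mod_cast i.pos
  have hi : ((i : ℕ) : ℝ) + 1 ≤ q := by exact_mod_cast i.2
  refine ⟨by positivity, ?_⟩
  rw [div_lt_one hq]
  linarith

theorem exchange_mem [NeZero q] {x : ℝ} (hx : x ∈ Ico (0 : ℝ) 1) :
    exchange q π x ∈ Ico (0 : ℝ) 1 := by
  obtain ⟨i, t, h0, h1, rfl⟩ := exists_rep (q := q) hx
  rw [exchange_rep i h0 h1]
  exact rep_mem _ h0 h1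

theorem rep_inj {i j : Fin q} {s t : ℝ} (hs0 : 0 ≤ s) (hs1 : s < 1) (ht0 : 0 ≤ t) (ht1 : t < 1)
    (h : ((i : ℕ) + s) / (q : ℝ) = ((j : ℕ) + t) / q) : i = j ∧ s = t := by
  have hq : (0 : ℝ) < q := by exact_mod_cast i.pos
  have h' : ((i : ℕ) : ℝ) + s = (j : ℕ) + t := by
    field_simp at h
    exact h
  have h1 : ((i : ℕ) : ℝ) < (j : ℕ) + 1 := by linarith
  have h2 : ((j : ℕ) : ℝ) < (i : ℕ) + 1 := by linarith
  have h3 : (i : ℕ) < (j : ℕ) + 1 := by exact_mod_cast h1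
  have h4 : (j : ℕ) < (i : ℕ) + 1 := by exact_mod_cast h2
  obtain rfl : i = j := Fin.ext (by omega)
  exact ⟨rfl, by linarith⟩

theorem exchange_injOn [NeZero q] : InjOn (exchange q π) (Ico (0 : ℝ) 1) := by
  intro x hx y hy hxy
  obtain ⟨i, t, h0, h1, rfl⟩ := exists_rep (q := q) hx
  obtain ⟨j, s, h2, h3, rfl⟩ := exists_rep (q := q) hy
  rw [exchange_rep i h0 h1, exchange_rep j h2 h3] at hxy
  obtain ⟨h4, rfl⟩ := rep_inj h0 h1 h2 h3 hxy
  rw [π.injective h4]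

theorem exchange_surjOn [NeZero q] : SurjOn (exchange q π) (Ico (0 : ℝ) 1) (Ico (0 : ℝ) 1) := by
  intro y hy
  obtain ⟨i, t, h0, h1, rfl⟩ := exists_rep (q := q) hy
  exact ⟨_, rep_mem (π.symm i) h0 h1, by rw [exchange_rep _ h0 h1, π.apply_symm_apply]⟩

theorem F_mem_Ioo [NeZero q] {x : ℝ} (hx : x ∈ Ico (0 : ℝ) 1) : F q π x ∈ Ioo (0 : ℝ) 1 :=
  kakutani_mem (exchange_mem hx)

theorem F_mapsTo [NeZero q] : MapsTo (F q π) (Ico (0 : ℝ) 1) (Ico (0 : ℝ) 1) :=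
  fun _ hx => Ioo_subset_Ico_self (F_mem_Ioo hx)

theorem F_injOn [NeZero q] : InjOn (F q π) (Ico (0 : ℝ) 1) :=
  kakutani_injOn.comp exchange_injOn fun _ hx => exchange_mem hx

theorem F_surjOn [NeZero q] : SurjOn (F q π) (Ico (0 : ℝ) 1) (Ioo (0 : ℝ) 1) :=
  kakutani_surjOn.comp exchange_surjOn

/-! ### The lattice of mesh `1 / (q 2 ^ K)` -/

/-- The multiples of `1 / (q 2 ^ K)`. -/
def lattice (q K : ℕ) : AddSubgroup ℝ := AddSubgroup.zmultiples ((1 / 2 : ℝ) ^ K / q)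

theorem mem_lattice_iff {K : ℕ} {x : ℝ} :
    x ∈ lattice q K ↔ ∃ m : ℤ, x = m * ((1 / 2 : ℝ) ^ K / q) := by
  rw [lattice, AddSubgroup.mem_zmultiples_iff]
  simp only [zsmul_eq_mul, eq_comm]

theorem lattice_mono {K K' : ℕ} (h : K ≤ K') : lattice q K ≤ lattice q K' := by
  intro x hx
  obtain ⟨m, rfl⟩ := mem_lattice_iff.1 hx
  refine mem_lattice_iff.2 ⟨m * 2 ^ (K' - K), ?_⟩
  obtain ⟨l, rfl⟩ := Nat.exists_eq_add_of_le h
  simp only [Nat.add_sub_cancel_left, pow_add]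
  push_cast
  have : (2 : ℝ) ^ l * (1 / 2) ^ l = 1 := by rw [← mul_pow]; norm_num
  calc (m : ℝ) * ((1 / 2) ^ K / q) = m * ((1 / 2) ^ K / q) * (2 ^ l * (1 / 2) ^ l) := by
        rw [this, mul_one]
    _ = _ := by ring

theorem int_div_mem_lattice (K : ℕ) (m : ℤ) : (m : ℝ) / q ∈ lattice q K :=
  lattice_mono (Nat.zero_le K) (mem_lattice_iff.2 ⟨m, by simp [div_eq_mul_inv]⟩)

theorem nat_div_mem_lattice (K m : ℕ) : (m : ℝ) / q ∈ lattice q K :=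
  int_div_mem_lattice K (m : ℤ)

theorem half_pow_mem_lattice [NeZero q] {n K : ℕ} (h : n ≤ K) : (1 / 2 : ℝ) ^ n ∈ lattice q K := by
  have hq : (q : ℝ) ≠ 0 := by exact_mod_cast NeZero.ne q
  refine lattice_mono h (mem_lattice_iff.2 ⟨q, ?_⟩)
  push_cast
  field_simp

theorem one_mem_lattice [NeZero q] (K : ℕ) : (1 : ℝ) ∈ lattice q K := by
  simpa using half_pow_mem_lattice (q := q) (Nat.zero_le K)

theorem half_pow_mul_mem_lattice {K : ℕ} (M : ℕ) {x : ℝ} (hx : x ∈ lattice q K) :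
    (1 / 2 : ℝ) ^ M * x ∈ lattice q (M + K) := by
  obtain ⟨m, rfl⟩ := mem_lattice_iff.1 hx
  exact mem_lattice_iff.2 ⟨m, by rw [pow_add]; ring⟩

theorem mem_lattice_of_half_pow_mul_mem {K M : ℕ} {x : ℝ}
    (hx : (1 / 2 : ℝ) ^ M * x ∈ lattice q (M + K)) : x ∈ lattice q K := by
  obtain ⟨m, hm⟩ := mem_lattice_iff.1 hx
  refine mem_lattice_iff.2 ⟨m, mul_left_cancel₀ (half_pow_pos M).ne' ?_⟩
  rw [hm, pow_add]; ring

theorem exchange_sub_mem_lattice [NeZero q] (K : ℕ) {x : ℝ} (hx : x ∈ Ico (0 : ℝ) 1) :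
    exchange q π x - x ∈ lattice q K := by
  obtain ⟨i, t, h0, h1, rfl⟩ := exists_rep (q := q) hx
  rw [exchange_rep i h0 h1]
  convert int_div_mem_lattice K ((π i : ℕ) - (i : ℕ) : ℤ) using 1
  push_cast
  ring

theorem kakutani_sub_mem_lattice [NeZero q] {K : ℕ} {x : ℝ} (hx : x ∈ Ico (0 : ℝ) 1)
    (h : x < 1 - (1 / 2) ^ K) : kakutani x - x ∈ lattice q K := by
  obtain ⟨n, h1, h2⟩ := exists_piece hx
  have hn : n < K := half_pow_lt_iff.1 (show ((1 : ℝ) / 2) ^ K < (1 / 2) ^ n by linarith)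
  have h3 := half_pow_mem_lattice (q := q) (show n + 1 ≤ K by omega)
  rw [kakutani_eq h1 h2, show x - 1 + 3 * (1 / 2 : ℝ) ^ (n + 1) - x =
    (1 / 2) ^ (n + 1) + (1 / 2) ^ (n + 1) + (1 / 2) ^ (n + 1) - 1 by ring]
  exact sub_mem (add_mem (add_mem h3 h3) h3) (one_mem_lattice K)

theorem F_sub_mem_lattice [NeZero q] {K : ℕ} {x : ℝ} (hx : x ∈ Ico (0 : ℝ) 1)
    (h : exchange q π x < 1 - (1 / 2) ^ K) : F q π x - x ∈ lattice q K := by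
  have := add_mem (kakutani_sub_mem_lattice (q := q) (exchange_mem hx) h)
    (exchange_sub_mem_lattice (π := π) K hx)
  rwa [sub_add_sub_cancel] at this

/-- The lattice points of the section `[0, 2 ^ -K)`. -/
theorem lattice_section [NeZero q] {K : ℕ} {x : ℝ} (hx : x ∈ lattice q K)
    (h : x ∈ Ico (0 : ℝ) ((1 / 2) ^ K)) : ∃ i : Fin q, x = (1 / 2) ^ K * ((i : ℕ) / q) := by
  have hq : (0 : ℝ) < q := by exact_mod_cast NeZero.pos q
  have hK := half_pow_pos K
  obtain ⟨m, rfl⟩ := mem_lattice_iff.1 hx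
  have h1 : (0 : ℝ) ≤ m := by
    by_contra hneg
    have := mul_neg_of_neg_of_pos (not_le.1 hneg) (div_pos hK hq)
    linarith [h.1]
  have h2 : (m : ℝ) < q := by
    have h3 := h.2
    rw [mul_div_assoc', div_lt_iff₀ hq, mul_comm] at h3
    exact lt_of_mul_lt_mul_left h3 hK.le
  have h1' : 0 ≤ m := by exact_mod_cast h1
  lift m to ℕ using h1'
  exact ⟨⟨m, by exact_mod_cast h2⟩, by push_cast; ring⟩

end RotatedOdometer

namespace RotatedOdometer

open FirstReturn

variable {q : ℕ} {π : Equiv.Perm (Fin q)} {N : ℕ}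

/-! ### The truncated map and returns to a section -/

/-- The map `F_π` with the von Neumann–Kakutani map replaced by a cyclic permutation of the
intervals of length `2 ^ -N`: the interval `[1 - 2 ^ -N, 1)` is translated onto `[0, 2 ^ -N)`. -/
def trunc (q N : ℕ) (π : Equiv.Perm (Fin q)) (x : ℝ) : ℝ :=
  if exchange q π x < 1 - (1 / 2) ^ N then F q π x else exchange q π x - (1 - (1 / 2) ^ N)

theorem trunc_of_lt {x : ℝ} (h : exchange q π x < 1 - (1 / 2) ^ N) : trunc q N π x = F q π x :=
  if_pos h

theorem trunc_of_le {x : ℝ} (h : 1 - (1 / 2) ^ N ≤ exchange q π x) :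
    trunc q N π x = exchange q π x - (1 - (1 / 2) ^ N) := if_neg (not_lt.2 h)

variable [NeZero q]

theorem F_mem_section_iff {x : ℝ} (hx : x ∈ Ico (0 : ℝ) 1) :
    F q π x ∈ Ico (0 : ℝ) ((1 / 2) ^ N) ↔ 1 - (1 / 2 : ℝ) ^ N ≤ exchange q π x := by
  rw [← kakutani_lt_iff (exchange_mem hx)]
  exact ⟨fun h => h.2, fun h => ⟨(F_mem_Ioo hx).1.le, h⟩⟩

theorem trunc_mem_section_iff {x : ℝ} (hx : x ∈ Ico (0 : ℝ) 1) :
    trunc q N π x ∈ Ico (0 : ℝ) ((1 / 2) ^ N) ↔ 1 - (1 / 2 : ℝ) ^ N ≤ exchange q π x := by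
  rcases lt_or_ge (exchange q π x) (1 - (1 / 2) ^ N) with h | h
  · rw [trunc_of_lt h, F_mem_section_iff hx]
  · rw [trunc_of_le h]
    have := (exchange_mem (π := π) hx).2
    exact ⟨fun _ => h, fun _ => ⟨by linarith, by linarith⟩⟩

theorem section_subset {x : ℝ} (hx : x ∈ Ico (0 : ℝ) ((1 / 2) ^ N)) : x ∈ Ico (0 : ℝ) 1 :=
  ⟨hx.1, hx.2.trans_le (half_pow_le_one N)⟩

theorem trunc_mapsTo : MapsTo (trunc q N π) (Ico (0 : ℝ) 1) (Ico (0 : ℝ) 1) := by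
  intro x hx
  rcases lt_or_ge (exchange q π x) (1 - (1 / 2) ^ N) with h | h
  · rw [trunc_of_lt h]; exact F_mapsTo hx
  · exact section_subset ((trunc_mem_section_iff hx).2 h)

theorem trunc_injOn : InjOn (trunc q N π) (Ico (0 : ℝ) 1) := by
  intro x hx y hy hxy
  have hiff := trunc_mem_section_iff (π := π) (N := N) hx
  rw [hxy, trunc_mem_section_iff hy] at hiff
  rcases lt_or_ge (exchange q π x) (1 - (1 / 2) ^ N) with h | h
  · have h' := not_le.1 (mt hiff.1 (not_le.2 h))
    rw [trunc_of_lt h, trunc_of_lt h'] at hxy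
    exact F_injOn hx hy hxy
  · rw [trunc_of_le h, trunc_of_le (hiff.2 h)] at hxy
    exact exchange_injOn hx hy (by linarith)

theorem F_eq_of_le_exchange {x : ℝ} (hx : x ∈ Ico (0 : ℝ) 1)
    (h : 1 - (1 / 2) ^ N ≤ exchange q π x) :
    F q π x = (1 / 2) ^ N * kakutani (trunc q N π x / (1 / 2) ^ N) := by
  have hN := half_pow_pos N
  have hm := (trunc_mem_section_iff hx).2 h
  have hv : trunc q N π x / (1 / 2) ^ N ∈ Ico (0 : ℝ) 1 :=
    ⟨div_nonneg hm.1 hN.le, (div_lt_one hN).2 hm.2⟩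
  rw [← kakutani_scale hv, mul_div_cancel₀ _ hN.ne', trunc_of_le h, F]
  congr 1
  ring

theorem trunc_sub_mem_lattice {x : ℝ} (hx : x ∈ Ico (0 : ℝ) 1) :
    trunc q N π x - x ∈ lattice q N := by
  rcases lt_or_ge (exchange q π x) (1 - (1 / 2) ^ N) with h | h
  · rw [trunc_of_lt h]; exact F_sub_mem_lattice hx h
  · rw [trunc_of_le h, sub_right_comm]
    exact sub_mem (exchange_sub_mem_lattice N hx)
      (sub_mem (one_mem_lattice N) (half_pow_mem_lattice le_rfl))

theorem trunc_iterate_sub_mem_lattice {x : ℝ} (hx : x ∈ Ico (0 : ℝ) 1) (n : ℕ) :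
    (trunc q N π)^[n] x - x ∈ lattice q N := by
  induction n with
  | zero => simp
  | succ n ih =>
    rw [Function.iterate_succ_apply']
    have := add_mem (trunc_sub_mem_lattice (π := π) (N := N)
      ((trunc_mapsTo (π := π) (N := N)).iterate n hx)) ih
    rwa [sub_add_sub_cancel] at this

theorem finite_lattice_coset {x : ℝ} (hx : x ∈ Ico (0 : ℝ) 1) (K : ℕ) :
    {y | y ∈ Ico (0 : ℝ) 1 ∧ y - x ∈ lattice q K}.Finite := by
  have hq : (0 : ℝ) < q := by exact_mod_cast NeZero.pos q
  have hη : (0 : ℝ) < (1 / 2) ^ K / q := div_pos (half_pow_pos K) hq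
  obtain ⟨M, hM⟩ := exists_nat_gt (1 / ((1 / 2 : ℝ) ^ K / q))
  rw [div_lt_iff₀ hη] at hM
  refine ((finite_Icc (-(M : ℤ)) M).image fun m : ℤ => x + m * ((1 / 2 : ℝ) ^ K / q)).subset ?_
  rintro y ⟨hy, hl⟩
  obtain ⟨m, hm⟩ := mem_lattice_iff.1 hl
  refine ⟨m, ?_, by dsimp only; linarith⟩
  have h1 : (m : ℝ) < M := by
    refine lt_of_mul_lt_mul_right ?_ hη.le
    linarith [hx.1, hy.2]
  have h2 : (-(M : ℤ) : ℝ) < m := by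
    refine lt_of_mul_lt_mul_right ?_ hη.le
    push_cast
    linarith [hx.2, hy.1]
  exact ⟨by exact_mod_cast h2.le, by exact_mod_cast h1.le⟩

/-- All points are periodic under the truncated map, which permutes the finitely many points of
`[0,1)` that differ from a given one by a lattice point. -/
theorem exists_trunc_iterate_eq {x : ℝ} (hx : x ∈ Ico (0 : ℝ) 1) :
    ∃ n, 0 < n ∧ (trunc q N π)^[n] x = x := by
  refine exists_iterate_eq_of_finite (A := {y | y ∈ Ico (0 : ℝ) 1 ∧ y - x ∈ lattice q N})
    (finite_lattice_coset hx N) (fun y hy => ⟨trunc_mapsTo hy.1, ?_⟩)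
    (trunc_injOn.mono fun y hy => hy.1) ⟨hx, by simp⟩
  have := add_mem (trunc_sub_mem_lattice (π := π) (N := N) hy.1) hy.2
  rwa [sub_add_sub_cancel] at this

theorem trunc_eq_F {x : ℝ} (hx : x ∈ Ico (0 : ℝ) 1)
    (h : F q π x ∉ Ico (0 : ℝ) ((1 / 2) ^ N)) : trunc q N π x = F q π x :=
  trunc_of_lt (not_le.1 (mt (F_mem_section_iff hx).2 h))

theorem F_eq_trunc {x : ℝ} (hx : x ∈ Ico (0 : ℝ) 1)
    (h : trunc q N π x ∉ Ico (0 : ℝ) ((1 / 2) ^ N)) : F q π x = trunc q N π x :=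
  (trunc_of_lt (not_le.1 (mt (trunc_mem_section_iff hx).2 h))).symm

theorem trunc_iterate_eq {x : ℝ} (hx : x ∈ Ico (0 : ℝ) 1) {n : ℕ}
    (h : ∀ m, 0 < m → m ≤ n → (F q π)^[m] x ∉ Ico (0 : ℝ) ((1 / 2) ^ N)) :
    (trunc q N π)^[n] x = (F q π)^[n] x := by
  induction n with
  | zero => rfl
  | succ n ih =>
    have h' := h (n + 1) (by omega) le_rfl
    rw [Function.iterate_succ_apply'] at h' ⊢
    rw [Function.iterate_succ_apply', ih fun m hm hm' => h m hm (by omega),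
      trunc_eq_F (F_mapsTo.iterate n hx) h']

theorem F_iterate_eq {x : ℝ} (hx : x ∈ Ico (0 : ℝ) 1) {n : ℕ}
    (h : ∀ m, 0 < m → m ≤ n → (trunc q N π)^[m] x ∉ Ico (0 : ℝ) ((1 / 2) ^ N)) :
    (F q π)^[n] x = (trunc q N π)^[n] x := by
  induction n with
  | zero => rfl
  | succ n ih =>
    have h' := h (n + 1) (by omega) le_rfl
    rw [Function.iterate_succ_apply'] at h' ⊢
    rw [Function.iterate_succ_apply', ih fun m hm hm' => h m hm (by omega),
      F_eq_trunc (trunc_mapsTo.iterate n hx) h']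

/-- Every point of the section returns: as long as its orbit avoids the section, it is an orbit of
the truncated map, which is periodic. -/
theorem recurrent_section : Recurrent (F q π) (Ico (0 : ℝ) ((1 / 2) ^ N)) := by
  intro x hx
  by_contra! h
  obtain ⟨n, hn, hnx⟩ := exists_trunc_iterate_eq (π := π) (N := N) (section_subset hx)
  rw [trunc_iterate_eq (section_subset hx) fun m hm _ => h m hm] at hnx
  exact h n hn (hnx.symm ▸ hx)

/-- A point whose orbit visits the section, and every aperiodic point, lies in the tower over the
section, and it differs from the base point of its floor by a lattice point. -/
theorem exists_tower {x : ℝ} (hx : x ∈ Ico (0 : ℝ) 1)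
    (h : (∃ n, (F q π)^[n] x ∈ Ico (0 : ℝ) ((1 / 2) ^ N)) ∨ ¬ ∃ n, 0 < n ∧ (F q π)^[n] x = x) :
    ∃ u ∈ Ico (0 : ℝ) ((1 / 2) ^ N), ∃ s < retTime (F q π) (Ico (0 : ℝ) ((1 / 2) ^ N)) u,
      (F q π)^[s] u = x ∧ x - u ∈ lattice q N := by
  classical
  obtain ⟨p, hp, hpx⟩ := exists_trunc_iterate_eq (π := π) (N := N) hx
  -- the orbit under the truncated map visits the section, and being periodic it also comes from
  -- there; the base point is its last visit before `x`
  have hj : ∃ j, (trunc q N π)^[j] x ∈ Ico (0 : ℝ) ((1 / 2) ^ N) := by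
    by_contra! hnot
    have heq : ∀ j, (F q π)^[j] x = (trunc q N π)^[j] x := fun j =>
      F_iterate_eq hx fun m _ _ => hnot m
    rcases h with ⟨n, hn⟩ | h
    · exact hnot n (heq n ▸ hn)
    · exact h ⟨p, hp, (heq p).trans hpx⟩
  have hs : ∃ s, ∃ u ∈ Ico (0 : ℝ) ((1 / 2) ^ N), (trunc q N π)^[s] u = x := by
    obtain ⟨j, hj⟩ := hj
    refine ⟨p * j - j, _, hj, ?_⟩
    rw [← Function.iterate_add_apply, Nat.sub_add_cancel (Nat.le_mul_of_pos_left j hp),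
      Function.iterate_mul]
    exact Function.iterate_fixed hpx j
  obtain ⟨u, hu, hux⟩ := Nat.find_spec hs
  have hmin := fun m hm => Nat.find_min hs (m := m) hm
  generalize Nat.find hs = s at *
  have hu1 := section_subset hu
  have hout : ∀ m, 0 < m → m ≤ s → (trunc q N π)^[m] u ∉ Ico (0 : ℝ) ((1 / 2) ^ N) := by
    intro m hm hms hmem
    refine hmin (s - m) (by omega) ⟨_, hmem, ?_⟩
    rw [← Function.iterate_add_apply, Nat.sub_add_cancel hms, hux]
  refine ⟨u, hu, s, ?_, by rw [F_iterate_eq hu1 hout, hux], ?_⟩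
  · by_contra hle
    have hl := retTime_isLeast (recurrent_section (π := π) (N := N) u hu)
    have hle := not_lt.1 hle
    have h2 := hl.1.2
    rw [F_iterate_eq hu1 fun m hm hm' => hout m hm (hm'.trans hle)] at h2
    exact hout _ hl.1.1 hle h2
  · rw [← hux]
    exact trunc_iterate_sub_mem_lattice hu1 s

/-- The first return of `x` to `[0, 2 ^ -N)` under the truncated map. The first return under `F_π`
takes the same time, and it is `2 ^ -N kakutani (2 ^ N y)` with `y` the value of this map, so that
this map plays the role of the exchange on the section. -/
def returnPoint (q N : ℕ) (π : Equiv.Perm (Fin q)) (x : ℝ) : ℝ :=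
  (trunc q N π)^[retTime (F q π) (Ico (0 : ℝ) ((1 / 2) ^ N)) x] x

theorem returnPoint_spec {x : ℝ} (hx : x ∈ Ico (0 : ℝ) ((1 / 2) ^ N)) :
    ∃ n, retTime (F q π) (Ico (0 : ℝ) ((1 / 2) ^ N)) x = n + 1 ∧
      (∀ m ≤ n, (trunc q N π)^[m] x = (F q π)^[m] x) ∧
      (∀ m, 0 < m → m ≤ n → (F q π)^[m] x ∉ Ico (0 : ℝ) ((1 / 2) ^ N)) ∧
      1 - (1 / 2) ^ N ≤ exchange q π ((F q π)^[n] x) ∧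
      returnPoint q N π x = exchange q π ((F q π)^[n] x) - (1 - (1 / 2) ^ N) := by
  have hl := retTime_isLeast (recurrent_section (π := π) (N := N) x hx)
  obtain ⟨n, hn⟩ := Nat.exists_eq_add_of_lt hl.1.1
  rw [zero_add] at hn
  have hx1 := section_subset hx
  have hout : ∀ m, 0 < m → m ≤ n → (F q π)^[m] x ∉ Ico (0 : ℝ) ((1 / 2) ^ N) :=
    fun m hm hmn => notMem_of_lt_retTime hm (by omega)
  have heq : ∀ m ≤ n, (trunc q N π)^[m] x = (F q π)^[m] x := fun m hm =>
    trunc_iterate_eq hx1 fun l hl hl' => hout l hl (hl'.trans hm)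
  have hmem := hl.1.2
  rw [hn, Function.iterate_succ_apply', F_mem_section_iff (F_mapsTo.iterate n hx1)] at hmem
  refine ⟨n, hn, heq, hout, hmem, ?_⟩
  rw [returnPoint, hn, Function.iterate_succ_apply', heq n le_rfl, trunc_of_le hmem]

theorem returnPoint_mem {x : ℝ} (hx : x ∈ Ico (0 : ℝ) ((1 / 2) ^ N)) :
    returnPoint q N π x ∈ Ico (0 : ℝ) ((1 / 2) ^ N) := by
  obtain ⟨n, h1, h2, h3, h4, h5⟩ := returnPoint_spec (π := π) hx
  have := (exchange_mem (π := π) ((F_mapsTo (π := π)).iterate n (section_subset hx))).2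
  rw [h5]
  exact ⟨by linarith, by linarith⟩

theorem ret_eq_returnPoint {x : ℝ} (hx : x ∈ Ico (0 : ℝ) ((1 / 2) ^ N)) :
    ret (F q π) (Ico (0 : ℝ) ((1 / 2) ^ N)) x =
      (1 / 2) ^ N * kakutani (returnPoint q N π x / (1 / 2) ^ N) := by
  obtain ⟨n, h1, h2, h3, h4, h5⟩ := returnPoint_spec (π := π) hx
  rw [ret, h1, Function.iterate_succ_apply',
    F_eq_of_le_exchange (F_mapsTo.iterate n (section_subset hx)) h4, trunc_of_le h4, h5]

theorem returnPoint_injOn : InjOn (returnPoint q N π) (Ico (0 : ℝ) ((1 / 2) ^ N)) := by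
  intro x hx y hy hxy
  wlog hle : retTime (F q π) (Ico (0 : ℝ) ((1 / 2) ^ N)) x ≤
      retTime (F q π) (Ico (0 : ℝ) ((1 / 2) ^ N)) y generalizing x y
  · exact (this hy hx hxy.symm (not_le.1 hle).le).symm
  obtain ⟨l, hl⟩ := Nat.exists_eq_add_of_le hle
  have hxy' : x = (trunc q N π)^[l] y := by
    rw [returnPoint, returnPoint, hl, Function.iterate_add_apply] at hxy
    exact trunc_injOn.iterate trunc_mapsTo _ (section_subset hx)
      (trunc_mapsTo.iterate l (section_subset hy)) hxy
  rcases Nat.eq_zero_or_pos l with rfl | hl0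
  · exact hxy'
  · obtain ⟨n, h1, h2, h3, -⟩ := returnPoint_spec (π := π) hy
    have := retTime_pos (recurrent_section (π := π) (N := N) x hx)
    have hln : l ≤ n := by omega
    rw [h2 l hln] at hxy'
    exact absurd (hxy' ▸ hx) (h3 l hl0 hln)

theorem returnPoint_sub_mem_lattice {x : ℝ} (hx : x ∈ Ico (0 : ℝ) ((1 / 2) ^ N)) :
    returnPoint q N π x - x ∈ lattice q N :=
  trunc_iterate_sub_mem_lattice (section_subset hx) _

/-! ### Admissible sets of cut points -/

/-- The properties of the set `Δ` of doubled points on which the coding depends: it consists of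
lattice points, it is invariant under `F_π` in both directions, it contains the points that the
exchange maps to an endpoint `1 - 2 ^ -n` of a piece of the von Neumann–Kakutani map, and it
contains each inner endpoint of the exchange at which the exchange is not continuous. These
properties pass to the rescaled first return map, whereas those of being the whole grid or the
orbits of the discontinuities are used only to see that the renormalization is eventually
periodic. -/
structure Admissible (q : ℕ) (π : Equiv.Perm (Fin q)) (Δ : Set ℝ) : Prop where
  subset : Δ ⊆ Ico 0 1
  zero_mem : (0 : ℝ) ∈ Δ
  lattice : ∀ x ∈ Δ, ∃ K, x ∈ lattice q K
  map_mem_iff : ∀ x ∈ Ico (0 : ℝ) 1, F q π x ∈ Δ ↔ x ∈ Δ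
  special : ∀ x ∈ Ico (0 : ℝ) 1, ∀ n : ℕ, exchange q π x = 1 - (1 / 2) ^ n → x ∈ Δ
  cont : ∀ (i : ℕ) (hi : i + 1 < q), ((i + 1 : ℕ) : ℝ) / q ∉ Δ →
    (π ⟨i + 1, hi⟩ : ℕ) = (π ⟨i, by omega⟩ : ℕ) + 1

theorem Admissible.half_pow_mem {Δ : Set ℝ} (hΔ : Admissible q π Δ) (n : ℕ) :
    (1 / 2 : ℝ) ^ (n + 1) ∈ Δ := by
  obtain ⟨x, hx, hxn⟩ := exchange_surjOn (q := q) (π := π)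
    (show (1 - (1 / 2 : ℝ) ^ n) ∈ Ico (0 : ℝ) 1 from
      ⟨by linarith [half_pow_le_one n], by linarith [half_pow_pos n]⟩)
  have := (hΔ.map_mem_iff x hx).2 (hΔ.special x hx n hxn)
  rwa [F, hxn, kakutani_special] at this

theorem Admissible.iterate_mem_iff {Δ : Set ℝ} (hΔ : Admissible q π Δ) {x : ℝ}
    (hx : x ∈ Ico (0 : ℝ) 1) (n : ℕ) : (F q π)^[n] x ∈ Δ ↔ x ∈ Δ := by
  induction n with
  | zero => rfl
  | succ n ih =>
    rw [Function.iterate_succ_apply', hΔ.map_mem_iff _ (F_mapsTo.iterate n hx), ih]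

/-- There is no cut point of mesh `1 / (q 2 ^ N)` in `(x, y]`. -/
def Joined (q N : ℕ) (Δ : Set ℝ) (x y : ℝ) : Prop :=
  x ≤ y ∧ ∀ p ∈ Δ, p ∈ lattice q N → x < p → y < p

variable {Δ : Set ℝ}

/-- The exchange translates `[x, y]` if there is no cut point in `(x, y]`. -/
theorem Joined.exchange_sub (hΔ : Admissible q π Δ) {x y : ℝ} (hx : x ∈ Ico (0 : ℝ) 1)
    (hy : y ∈ Ico (0 : ℝ) 1) (hJ : Joined q N Δ x y) :
    exchange q π y - exchange q π x = y - x := by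
  have hq : (0 : ℝ) < q := by exact_mod_cast NeZero.pos q
  obtain ⟨i, t, h0, h1, rfl⟩ := exists_rep (q := q) hx
  obtain ⟨j, s, h2, h3, rfl⟩ := exists_rep (q := q) hy
  have hij : (i : ℕ) ≤ j := by
    have h := hJ.1
    rw [div_le_div_iff_of_pos_right hq] at h
    have h' : ((i : ℕ) : ℝ) < ((j : ℕ) + 1 : ℕ) := by push_cast; linarith
    have : (i : ℕ) < (j : ℕ) + 1 := by exact_mod_cast h'
    omega
  -- the exchange translates the intervals from the `i`-th to the `j`-th in parallel, because none
  -- of the endpoints between them is a cut point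
  have key : ∀ m (hm : m < q), (i : ℕ) ≤ m → m ≤ (j : ℕ) →
      (π ⟨m, hm⟩ : ℕ) + (i : ℕ) = (π i : ℕ) + m := by
    intro m hm him
    induction m, him using Nat.le_induction with
    | base => intro _; rfl
    | succ m him ih =>
      intro hmj
      have h4 := ih (by omega) (by omega)
      have h5 := hΔ.cont m hm fun hmem => by
        have h6 := hJ.2 _ hmem (nat_div_mem_lattice N (m + 1)) (by
          rw [div_lt_div_iff_of_pos_right hq]
          have : ((i : ℕ) : ℝ) ≤ m := by exact_mod_cast him
          push_cast
          linarith)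
        rw [div_lt_div_iff_of_pos_right hq] at h6
        have : ((m + 1 : ℕ) : ℝ) ≤ (j : ℕ) := by exact_mod_cast hmj
        linarith
      omega
  have h4 : (((π j : ℕ) + (i : ℕ) : ℕ) : ℝ) = ((π i : ℕ) + (j : ℕ) : ℕ) := by
    exact_mod_cast key j j.2 hij le_rfl
  push_cast at h4
  rw [exchange_rep i h0 h1, exchange_rep j h2 h3]
  field_simp
  linarith

/-- Away from the section, the map `F_π` is a translation on `[x, y]` if there is no cut point in
`(x, y]`, and its image has no cut point either. -/
theorem Joined.map (hΔ : Admissible q π Δ) {x y : ℝ} (hx : x ∈ Ico (0 : ℝ) 1)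
    (hy : y ∈ Ico (0 : ℝ) 1) (hJ : Joined q N Δ x y)
    (h : F q π x ∉ Ico (0 : ℝ) ((1 / 2) ^ N)) :
    F q π y - F q π x = y - x ∧ F q π y ∉ Ico (0 : ℝ) ((1 / 2) ^ N) ∧
      Joined q N Δ (F q π x) (F q π y) := by
  rw [F_mem_section_iff hx, not_le] at h
  have hbetween : ∀ z, x ≤ z → z ≤ y → Joined q N Δ x z := fun z h1 h2 =>
    ⟨h1, fun p hp hp' hxp => h2.trans_lt (hJ.2 p hp hp' hxp)⟩
  have key : ∀ z, x ≤ z → z ≤ y →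
      F q π z - F q π x = z - x ∧ exchange q π z < 1 - (1 / 2) ^ N := by
    intro z h1 h2
    have hz : z ∈ Ico (0 : ℝ) 1 := ⟨hx.1.trans h1, h2.trans_lt hy.2⟩
    have hsub := (hbetween z h1 h2).exchange_sub hΔ hx hz
    obtain ⟨n, h3, h4⟩ := exists_piece (exchange_mem (π := π) hx)
    have hn : n < N := half_pow_lt_iff.1 (show ((1 : ℝ) / 2) ^ N < (1 / 2) ^ n by linarith)
    have h5 : exchange q π z < 1 - (1 / 2) ^ (n + 1) := by
      by_contra hge
      have hge := not_lt.1 hge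
      -- otherwise a point between `x` and `z` is mapped to an endpoint of a piece
      set p := x + (1 - (1 / 2 : ℝ) ^ (n + 1) - exchange q π x) with hp
      have hxp : x < p := by linarith
      have hpz : p ≤ z := by linarith
      have hp1 : p ∈ Ico (0 : ℝ) 1 := ⟨hx.1.trans hxp.le, (hpz.trans h2).trans_lt hy.2⟩
      have hpe := (hbetween p hxp.le (hpz.trans h2)).exchange_sub hΔ hx hp1
      have hpe' : exchange q π p = 1 - (1 / 2) ^ (n + 1) := by linarith
      have hlat : p ∈ lattice q N := by
        have h6 := sub_mem (sub_mem (one_mem_lattice (q := q) N)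
          (half_pow_mem_lattice (q := q) (show n + 1 ≤ N by omega)))
          (exchange_sub_mem_lattice (π := π) N hp1)
        rwa [hpe', sub_sub_cancel] at h6
      exact absurd (hJ.2 p (hΔ.special p hp1 _ hpe') hlat hxp) (not_lt.2 (hpz.trans h2))
    refine ⟨?_, h5.trans_le ?_⟩
    · have hle : 1 - (1 / 2 : ℝ) ^ n ≤ exchange q π z := by linarith
      rw [F, F, kakutani_eq h3 h4, kakutani_eq hle h5]
      linarith
    · have := half_pow_le_iff.2 (show n + 1 ≤ N by omega)
      linarith
  obtain ⟨h1, h2⟩ := key y hJ.1 le_rfl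
  refine ⟨h1, ?_, by linarith [hJ.1], fun p hp hp' hxp => ?_⟩
  · rw [F_mem_section_iff hy]
    exact not_le.2 h2
  · by_contra hpy
    have hpy := not_lt.1 hpy
    -- a cut point in the image would come from a cut point in `(x, y]`
    set p' := x + (p - F q π x) with hp'_def
    have hxp' : x < p' := by linarith
    have hpy' : p' ≤ y := by linarith
    have hp1 : p' ∈ Ico (0 : ℝ) 1 := ⟨hx.1.trans hxp'.le, hpy'.trans_lt hy.2⟩
    obtain ⟨h3, h4⟩ := key p' hxp'.le hpy'
    have h5 : F q π p' = p := by linarith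
    refine absurd (hJ.2 p' ((hΔ.map_mem_iff p' hp1).1 (h5 ▸ hp)) ?_ hxp') (not_lt.2 hpy')
    have h6 := sub_mem hp' (h5 ▸ F_sub_mem_lattice hp1 h4)
    rwa [sub_sub_cancel] at h6

theorem Joined.iterate (hΔ : Admissible q π Δ) {x y : ℝ} (hx : x ∈ Ico (0 : ℝ) 1)
    (hy : y ∈ Ico (0 : ℝ) 1) (hJ : Joined q N Δ x y) {n : ℕ}
    (h : ∀ m, 0 < m → m ≤ n → (F q π)^[m] x ∉ Ico (0 : ℝ) ((1 / 2) ^ N)) :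
    (F q π)^[n] y - (F q π)^[n] x = y - x ∧ Joined q N Δ ((F q π)^[n] x) ((F q π)^[n] y) ∧
      ∀ m, 0 < m → m ≤ n → (F q π)^[m] y ∉ Ico (0 : ℝ) ((1 / 2) ^ N) := by
  induction n with
  | zero => exact ⟨rfl, hJ, fun m h1 h2 => absurd h1 (by omega)⟩
  | succ n ih =>
    obtain ⟨h1, h2, h3⟩ := ih fun m hm hm' => h m hm (by omega)
    have h4 := h (n + 1) (by omega) le_rfl
    rw [Function.iterate_succ_apply'] at h4
    obtain ⟨h5, h6, h7⟩ := h2.map hΔ (F_mapsTo.iterate n hx) (F_mapsTo.iterate n hy) h4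
    simp only [Function.iterate_succ_apply']
    refine ⟨by rw [h5, h1], h7, fun m hm hm' => ?_⟩
    rcases hm'.eq_or_lt with rfl | hlt
    · rw [Function.iterate_succ_apply']; exact h6
    · exact h3 m hm (by omega)

/-- Points of the section with no cut point between them have the same return time, and move in
parallel until they return. -/
theorem Joined.return (hΔ : Admissible q π Δ) {x y : ℝ} (hx : x ∈ Ico (0 : ℝ) ((1 / 2) ^ N))
    (hy : y ∈ Ico (0 : ℝ) ((1 / 2) ^ N)) (hJ : Joined q N Δ x y) :
    retTime (F q π) (Ico (0 : ℝ) ((1 / 2) ^ N)) y =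
      retTime (F q π) (Ico (0 : ℝ) ((1 / 2) ^ N)) x ∧
    (∀ s < retTime (F q π) (Ico (0 : ℝ) ((1 / 2) ^ N)) x,
      (F q π)^[s] y - (F q π)^[s] x = y - x ∧ Joined q N Δ ((F q π)^[s] x) ((F q π)^[s] y)) ∧
    returnPoint q N π y - returnPoint q N π x = y - x := by
  have hx1 := section_subset hx
  have hy1 := section_subset hy
  obtain ⟨n, h1, h2, h3, h4, h5⟩ := returnPoint_spec (π := π) hx
  have hit := fun s (hs : s ≤ n) => hJ.iterate (N := N) hΔ hx1 hy1 (n := s)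
    fun m hm hm' => h3 m hm (hm'.trans hs)
  obtain ⟨h6, h7, h8⟩ := hit n le_rfl
  have hxn := F_mapsTo.iterate (f := F q π) n hx1
  have hyn := F_mapsTo.iterate (f := F q π) n hy1
  have h9 := h7.exchange_sub hΔ hxn hyn
  have h10 : retTime (F q π) (Ico (0 : ℝ) ((1 / 2) ^ N)) y = n + 1 := by
    refine retTime_eq (by omega) ?_ fun m hm hm' => h8 m hm (by omega)
    rw [Function.iterate_succ_apply', F_mem_section_iff hyn]
    linarith [h7.1]
  refine ⟨by rw [h10, h1], fun s hs => ?_, ?_⟩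
  · obtain ⟨h11, h12, -⟩ := hit s (by omega)
    exact ⟨h11, h12⟩
  · obtain ⟨n', h1', -, -, -, h5'⟩ := returnPoint_spec (π := π) hy
    obtain rfl : n' = n := by omega
    rw [h5, h5', ← h6]
    linarith

/-! ### The grid of all lattice points -/

theorem mem_gridPoints_iff {x : ℝ} :
    x ∈ gridPoints q ↔ x ∈ Ico (0 : ℝ) 1 ∧ ∃ K, x ∈ lattice q K := by
  have hq : (0 : ℝ) < q := by exact_mod_cast NeZero.pos q
  constructor
  · rintro ⟨hx, p, n, rfl⟩
    refine ⟨hx, n, mem_lattice_iff.2 ⟨p, ?_⟩⟩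
    push_cast
    rw [one_div, inv_pow]
    field_simp
  · rintro ⟨hx, K, hK⟩
    refine ⟨hx, ?_⟩
    obtain ⟨m, rfl⟩ := mem_lattice_iff.1 hK
    have h0 : (0 : ℝ) ≤ m := by
      by_contra hneg
      have := mul_neg_of_neg_of_pos (not_le.1 hneg) (div_pos (half_pow_pos K) hq)
      linarith [hx.1]
    have h0' : 0 ≤ m := by exact_mod_cast h0
    lift m to ℕ using h0'
    refine ⟨m, K, ?_⟩
    push_cast
    rw [one_div, inv_pow]
    field_simp

theorem exists_F_sub_mem_lattice {x : ℝ} (hx : x ∈ Ico (0 : ℝ) 1) :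
    ∃ K, F q π x - x ∈ lattice q K := by
  obtain ⟨n, -, h2⟩ := exists_piece (exchange_mem (π := π) hx)
  exact ⟨n + 1, F_sub_mem_lattice hx h2⟩

theorem F_mem_gridPoints_iff {x : ℝ} (hx : x ∈ Ico (0 : ℝ) 1) :
    F q π x ∈ gridPoints q ↔ x ∈ gridPoints q := by
  rw [mem_gridPoints_iff, mem_gridPoints_iff]
  obtain ⟨K, hK⟩ := exists_F_sub_mem_lattice (π := π) hx
  constructor
  · rintro ⟨-, K', hK'⟩
    have := sub_mem (lattice_mono (le_max_right K K') hK') (lattice_mono (le_max_left K K') hK)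
    exact ⟨hx, _, by rwa [sub_sub_cancel] at this⟩
  · rintro ⟨-, K', hK'⟩
    have := add_mem (lattice_mono (le_max_left K K') hK) (lattice_mono (le_max_right K K') hK')
    exact ⟨F_mapsTo hx, _, by rwa [sub_add_cancel] at this⟩

theorem mem_gridPoints_of_exchange_eq {x : ℝ} (hx : x ∈ Ico (0 : ℝ) 1) {n : ℕ}
    (h : exchange q π x = 1 - (1 / 2) ^ n) : x ∈ gridPoints q := by
  refine mem_gridPoints_iff.2 ⟨hx, n, ?_⟩
  have := sub_mem (sub_mem (one_mem_lattice (q := q) n) (half_pow_mem_lattice le_rfl))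
    (exchange_sub_mem_lattice (π := π) n hx)
  rwa [h, sub_sub_cancel] at this

theorem div_mem_gridPoints (i : Fin q) : ((i : ℕ) : ℝ) / q ∈ gridPoints q := by
  refine mem_gridPoints_iff.2 ⟨by simpa using rep_mem i le_rfl zero_lt_one, 0, ?_⟩
  exact nat_div_mem_lattice 0 i

theorem admissible_gridPoints : Admissible q π (gridPoints q) where
  subset := fun x hx => hx.1
  zero_mem := mem_gridPoints_iff.2 ⟨by simp, 0, zero_mem _⟩
  lattice := fun x hx => (mem_gridPoints_iff.1 hx).2
  map_mem_iff := fun x hx => F_mem_gridPoints_iff hx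
  special := fun x hx n h => mem_gridPoints_of_exchange_eq hx h
  cont := fun i hi h => absurd (div_mem_gridPoints ⟨i + 1, hi⟩) h

/-! ### Renormalization -/

/-- The first return map to the section is, up to scale, again a rotated odometer. -/
theorem exists_renorm (q N : ℕ) [NeZero q] (π : Equiv.Perm (Fin q)) :
    ∃ π' : Equiv.Perm (Fin q), ∀ v ∈ Ico (0 : ℝ) 1,
      returnPoint q N π ((1 / 2) ^ N * v) = (1 / 2) ^ N * exchange q π' v := by
  have hq : (0 : ℝ) < q := by exact_mod_cast NeZero.pos q
  have hN := half_pow_pos N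
  have hsec : ∀ v ∈ Ico (0 : ℝ) 1, (1 / 2 : ℝ) ^ N * v ∈ Ico (0 : ℝ) ((1 / 2) ^ N) :=
    fun v hv => ⟨mul_nonneg hN.le hv.1, by nlinarith [hv.2]⟩
  have hbase : ∀ i : Fin q, ((i : ℕ) : ℝ) / q ∈ Ico (0 : ℝ) 1 := fun i => by
    simpa using rep_mem i le_rfl zero_lt_one
  have hlat : ∀ i : Fin q, (1 / 2 : ℝ) ^ N * (((i : ℕ) : ℝ) / q) ∈ lattice q N := fun i =>
    half_pow_mul_mem_lattice (K := 0) N (nat_div_mem_lattice 0 i)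
  have hex : ∀ i : Fin q, ∃ j : Fin q,
      returnPoint q N π ((1 / 2) ^ N * ((i : ℕ) / q)) = (1 / 2) ^ N * ((j : ℕ) / q) := fun i => by
    refine lattice_section ?_ (returnPoint_mem (hsec _ (hbase i)))
    have := add_mem (returnPoint_sub_mem_lattice (π := π) (hsec _ (hbase i))) (hlat i)
    rwa [sub_add_cancel] at this
  choose g hg using hex
  have hginj : Function.Injective g := by
    intro i j hij
    have h1 := hg i
    rw [hij, ← hg j] at h1
    have h2 := returnPoint_injOn (hsec _ (hbase i)) (hsec _ (hbase j)) h1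
    have h3 := mul_left_cancel₀ hN.ne' h2
    rw [div_left_inj' hq.ne'] at h3
    exact Fin.ext (by exact_mod_cast h3)
  refine ⟨Equiv.ofBijective g (Finite.injective_iff_bijective.1 hginj), fun v hv => ?_⟩
  obtain ⟨i, t, h0, h1, rfl⟩ := exists_rep (q := q) hv
  rw [exchange_rep i h0 h1, Equiv.ofBijective_apply]
  -- no lattice point separates `v` from the left endpoint of its interval
  have hJ : Joined q N (gridPoints q) ((1 / 2) ^ N * ((i : ℕ) / q))
      ((1 / 2) ^ N * (((i : ℕ) + t) / q)) := by
    refine ⟨by gcongr; linarith, fun p hp hpl hlt => ?_⟩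
    obtain ⟨m, rfl⟩ := mem_lattice_iff.1 hpl
    have h2 : (1 / 2 : ℝ) ^ N * ((i : ℕ) / q) = ((i : ℕ) : ℤ) * ((1 / 2 : ℝ) ^ N / q) := by
      push_cast; ring
    rw [h2] at hlt
    have hη : (0 : ℝ) < (1 / 2) ^ N / q := div_pos hN hq
    have h3 : ((i : ℕ) : ℤ) < m := by exact_mod_cast lt_of_mul_lt_mul_right hlt hη.le
    have h4 : ((i : ℕ) : ℝ) + 1 ≤ m := by exact_mod_cast h3
    have h5 : (1 / 2 : ℝ) ^ N * (((i : ℕ) + t) / q) = ((i : ℕ) + t) * ((1 / 2) ^ N / q) := by ring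
    rw [h5]
    exact mul_lt_mul_of_pos_right (by linarith) hη
  have h2 := (hJ.return (π := π) admissible_gridPoints (hsec _ (hbase i)) (hsec _ hv)).2.2
  rw [hg] at h2
  rw [add_div, add_div, mul_add, mul_add, ← sub_eq_iff_eq_add'] at *
  linarith

/-- The permutation of the rescaled first return map to the section `[0, 2 ^ -N)`. -/
def renorm (q N : ℕ) [NeZero q] (π : Equiv.Perm (Fin q)) : Equiv.Perm (Fin q) :=
  (exists_renorm q N π).choose

theorem returnPoint_eq {v : ℝ} (hv : v ∈ Ico (0 : ℝ) 1) :
    returnPoint q N π ((1 / 2) ^ N * v) = (1 / 2) ^ N * exchange q (renorm q N π) v :=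
  (exists_renorm q N π).choose_spec v hv

theorem half_pow_mul_mem {v : ℝ} (hv : v ∈ Ico (0 : ℝ) 1) (N : ℕ) :
    (1 / 2 : ℝ) ^ N * v ∈ Ico (0 : ℝ) ((1 / 2) ^ N) :=
  ⟨mul_nonneg (half_pow_pos N).le hv.1, by nlinarith [hv.2, half_pow_pos N]⟩

theorem ret_half_pow_mul {v : ℝ} (hv : v ∈ Ico (0 : ℝ) 1) :
    ret (F q π) (Ico (0 : ℝ) ((1 / 2) ^ N)) ((1 / 2) ^ N * v) =
      (1 / 2) ^ N * F q (renorm q N π) v := by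
  rw [ret_eq_returnPoint (half_pow_mul_mem hv N), returnPoint_eq hv,
    mul_div_cancel_left₀ _ (half_pow_pos N).ne', F]

/-- The cut points of the rescaled section. -/
def rescale (N : ℕ) (Δ : Set ℝ) : Set ℝ := {v | v ∈ Ico (0 : ℝ) 1 ∧ (1 / 2 : ℝ) ^ N * v ∈ Δ}

theorem mem_rescale {v : ℝ} : v ∈ rescale N Δ ↔ v ∈ Ico (0 : ℝ) 1 ∧ (1 / 2 : ℝ) ^ N * v ∈ Δ :=
  Iff.rfl

theorem rescale_rescale (M N : ℕ) (Δ : Set ℝ) : rescale M (rescale N Δ) = rescale (N + M) Δ := by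
  ext v
  simp only [mem_rescale, pow_add, mul_assoc]
  exact ⟨fun h => ⟨h.1, h.2.2⟩, fun h => ⟨h.1, section_subset (half_pow_mul_mem h.1 M), h.2⟩⟩

/-- Admissibility passes to the rescaled section. -/
theorem Admissible.admissible_rescale (hΔ : Admissible q π Δ) :
    Admissible q (renorm q N π) (rescale N Δ) where
  subset := fun x hx => hx.1
  zero_mem := ⟨by simp, by rw [mul_zero]; exact hΔ.zero_mem⟩
  lattice := fun x hx => by
    obtain ⟨K, hK⟩ := hΔ.lattice _ hx.2
    exact ⟨K, mem_lattice_of_half_pow_mul_mem (lattice_mono (Nat.le_add_left K N) hK)⟩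
  map_mem_iff := fun x hx => by
    rw [mem_rescale, mem_rescale, ← ret_half_pow_mul hx, ret,
      hΔ.iterate_mem_iff (section_subset (half_pow_mul_mem hx N))]
    exact ⟨fun h => ⟨hx, h.2⟩, fun h => ⟨F_mapsTo hx, h.2⟩⟩
  special := fun x hx n h => by
    refine ⟨hx, ?_⟩
    rw [← hΔ.iterate_mem_iff (section_subset (half_pow_mul_mem hx N))
      (retTime (F q π) (Ico (0 : ℝ) ((1 / 2) ^ N)) ((1 / 2) ^ N * x)), ← ret,
      ret_half_pow_mul hx, F, h, kakutani_special, ← pow_add, ← add_assoc]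
    exact hΔ.half_pow_mem _
  cont := fun i hi h => by
    have hq : (0 : ℝ) < q := by exact_mod_cast NeZero.pos q
    have hN := half_pow_pos N
    have hη : (0 : ℝ) < (1 / 2) ^ N / q := div_pos hN hq
    have hm1 : ((i + 1 : ℕ) : ℝ) / q ∈ Ico (0 : ℝ) 1 := by
      simpa using rep_mem (⟨i + 1, hi⟩ : Fin q) le_rfl zero_lt_one
    have hm0 : (i : ℝ) / q ∈ Ico (0 : ℝ) 1 := by
      simpa using rep_mem (⟨i, by omega⟩ : Fin q) le_rfl zero_lt_one
    have hJ : Joined q N Δ ((1 / 2) ^ N * (i / q)) ((1 / 2) ^ N * ((i + 1 : ℕ) / q)) := by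
      refine ⟨by gcongr; linarith, fun p hp hpl hlt => ?_⟩
      obtain ⟨m, rfl⟩ := mem_lattice_iff.1 hpl
      rw [show (1 / 2 : ℝ) ^ N * (i / q) = (i : ℤ) * ((1 / 2 : ℝ) ^ N / q) by push_cast; ring]
        at hlt
      have h3 : (i : ℤ) < m := by exact_mod_cast lt_of_mul_lt_mul_right hlt hη.le
      rw [show (1 / 2 : ℝ) ^ N * ((i + 1 : ℕ) / q) = ((i + 1 : ℤ) : ℝ) * ((1 / 2 : ℝ) ^ N / q) by
        push_cast; ring]
      refine mul_lt_mul_of_pos_right ?_ hη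
      rcases (show (i + 1 : ℤ) ≤ m from h3).eq_or_lt with heq | hlt'
      · refine absurd ⟨hm1, ?_⟩ h
        rw [← heq] at hp
        convert hp using 1
        push_cast
        ring
      · exact_mod_cast hlt'
    have h2 := (hJ.return (π := π) hΔ (half_pow_mul_mem hm0 N) (half_pow_mul_mem hm1 N)).2.2
    rw [returnPoint_eq hm0, returnPoint_eq hm1, ← mul_sub, ← mul_sub] at h2
    have h3 := mul_left_cancel₀ hN.ne' h2
    have h4 := exchange_rep (π := renorm q N π) (⟨i + 1, hi⟩ : Fin q) le_rfl zero_lt_one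
    have h5 := exchange_rep (π := renorm q N π) (⟨i, by omega⟩ : Fin q) le_rfl zero_lt_one
    simp only [add_zero] at h4 h5
    rw [h4, h5] at h3
    field_simp at h3
    push_cast at h3
    have h6 : ((renorm q N π ⟨i + 1, hi⟩ : ℕ) : ℝ) =
        ((renorm q N π ⟨i, by omega⟩ : ℕ) + 1 : ℕ) := by push_cast; linarith
    exact_mod_cast h6

end RotatedOdometer

namespace RotatedOdometer

open FirstReturn

/-! ### Coding by the intervals between cut points -/

variable {q : ℕ} {S : Set (Fin q)}

/-- The labels of the cut points of mesh `1 / q`. -/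
def labelSet (q : ℕ) (Δ : Set ℝ) : Set (Fin q) := {i | ((i : ℕ) : ℝ) / q ∈ Δ}

theorem mem_labelSet {Δ : Set ℝ} {i : Fin q} : i ∈ labelSet q Δ ↔ ((i : ℕ) : ℝ) / q ∈ Δ := Iff.rfl

/-- The interval with label `i` when `[0,1)` is cut at the points `j / q` with `j ∈ S`. -/
def coding (q : ℕ) (S : Set (Fin q)) (i : Fin q) : Set ℝ :=
  {x | x ∈ Ico (0 : ℝ) 1 ∧ i ∈ S ∧ ((i : ℕ) : ℝ) / q ≤ x ∧
    ∀ j : Fin q, i < j → j ∈ S → x < ((j : ℕ) : ℝ) / q}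

theorem rep_mem_coding_iff {i j : Fin q} {t : ℝ} (h0 : 0 ≤ t) (h1 : t < 1) :
    ((j : ℕ) + t) / (q : ℝ) ∈ coding q S i ↔ i ∈ S ∧ i ≤ j ∧ ∀ l, i < l → l ∈ S → j < l := by
  have hq : (0 : ℝ) < q := by exact_mod_cast j.pos
  have key : ∀ l : Fin q, ((l : ℕ) : ℝ) / q ≤ ((j : ℕ) + t) / (q : ℝ) ↔ l ≤ j := by
    intro l
    rw [div_le_div_iff_of_pos_right hq, Fin.le_def]
    constructor
    · intro h
      have : ((l : ℕ) : ℝ) < ((j : ℕ) + 1 : ℕ) := by push_cast; linarith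
      have : (l : ℕ) < (j : ℕ) + 1 := by exact_mod_cast this
      omega
    · intro h
      have : ((l : ℕ) : ℝ) ≤ (j : ℕ) := by exact_mod_cast h
      linarith
  refine ⟨fun h => ⟨h.2.1, (key i).1 h.2.2.1, fun l h2 h3 => ?_⟩,
    fun h => ⟨rep_mem j h0 h1, h.1, (key i).2 h.2.1, fun l h2 h3 => ?_⟩⟩
  · exact not_le.1 (mt (key l).2 (not_le.2 (h.2.2.2 l h2 h3)))
  · exact not_le.1 (mt (key l).1 (not_le.2 (h.2.2 l h2 h3)))

theorem coding_unique {i j : Fin q} {x : ℝ} (hi : x ∈ coding q S i) (hj : x ∈ coding q S j) :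
    i = j := by
  rcases lt_trichotomy i j with h | h | h
  · exact absurd (hi.2.2.2 j h hj.2.1) (not_lt.2 hj.2.2.1)
  · exact h
  · exact absurd (hj.2.2.2 i h hi.2.1) (not_lt.2 hi.2.2.1)

theorem div_mem (i : Fin q) : ((i : ℕ) : ℝ) / q ∈ Ico (0 : ℝ) 1 := by
  simpa using rep_mem i le_rfl zero_lt_one

theorem Joined.mem_coding {N : ℕ} {Δ : Set ℝ} {x y : ℝ} {i : Fin q} (hJ : Joined q N Δ x y)
    (hy : y ∈ Ico (0 : ℝ) 1) (hx : x ∈ coding q (labelSet q Δ) i) : y ∈ coding q (labelSet q Δ) i :=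
  ⟨hy, hx.2.1, hx.2.2.1.trans hJ.1, fun j hij hj =>
    hJ.2 _ hj (nat_div_mem_lattice N j) (hx.2.2.2 j hij hj)⟩

variable [NeZero q]

theorem exists_mem_coding (h0 : (0 : Fin q) ∈ S) {x : ℝ} (hx : x ∈ Ico (0 : ℝ) 1) :
    ∃ i, x ∈ coding q S i := by
  obtain ⟨i, hi, hmax⟩ := exists_max_image {i : Fin q | i ∈ S ∧ ((i : ℕ) : ℝ) / q ≤ x} id
    (toFinite _) ⟨0, h0, by simpa using hx.1⟩
  exact ⟨i, hx, hi.1, hi.2, fun j hij hj => not_le.1 fun hle =>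
    absurd (hmax j ⟨hj, hle⟩) (not_le.2 hij)⟩

/-- The label of the coding interval that contains `x`. -/
def labelAt (S : Set (Fin q)) (x : ℝ) : Fin q := Classical.epsilon fun i => x ∈ coding q S i

theorem labelAt_eq {i : Fin q} {x : ℝ} (h : x ∈ coding q S i) : labelAt S x = i :=
  coding_unique (Classical.epsilon_spec (p := fun i => x ∈ coding q S i) ⟨i, h⟩) h

theorem labelAt_rep (j : Fin q) {t : ℝ} (h0 : 0 ≤ t) (h1 : t < 1) :
    labelAt S (((j : ℕ) + t) / (q : ℝ)) = labelAt S (((j : ℕ) : ℝ) / q) := by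
  have h := fun i => rep_mem_coding_iff (S := S) (i := i) (j := j) le_rfl zero_lt_one
  simp only [add_zero] at h
  unfold labelAt
  congr 1
  ext i
  rw [rep_mem_coding_iff h0 h1, h]

/-- The itinerary, up to the first return to `[0, 2 ^ -N)`, of the point `2 ^ -N i / q`. If this is
a cut point, it is the left endpoint of the `i`-th coding interval of the section, and all points of
that interval have the same itinerary. -/
def word (q N : ℕ) [NeZero q] (π : Equiv.Perm (Fin q)) (S : Set (Fin q)) (i : Fin q) :
    List (Fin q) :=
  (List.range (retTime (F q π) (Ico (0 : ℝ) ((1 / 2) ^ N)) ((1 / 2) ^ N * ((i : ℕ) / q)))).map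
    fun s => labelAt S ((F q π)^[s] ((1 / 2) ^ N * ((i : ℕ) / q)))

variable {π : Equiv.Perm (Fin q)} {N : ℕ} {Δ : Set ℝ}

theorem mem_coding_zero (h0 : (0 : Fin q) ∈ S) : (0 : ℝ) ∈ coding q S 0 := by
  refine ⟨by simp, h0, by simp, fun j hj _ => ?_⟩
  have hq : (0 : ℝ) < q := by exact_mod_cast NeZero.pos q
  have : (0 : ℝ) < (j : ℕ) := by exact_mod_cast hj
  positivity

theorem Admissible.zero_mem_labelSet (hΔ : Admissible q π Δ) : (0 : Fin q) ∈ labelSet q Δ := by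
  simpa [mem_labelSet] using hΔ.zero_mem

/-- No cut point separates a point of the section from the left endpoint of its coding interval. -/
theorem joined_of_mem_coding {i : Fin q} {v : ℝ} (hv : v ∈ coding q (labelSet q (rescale N Δ)) i)
    (hΔ : Δ ⊆ Ico 0 1) : Joined q N Δ ((1 / 2) ^ N * ((i : ℕ) / q)) ((1 / 2) ^ N * v) := by
  have hN := half_pow_pos N
  refine ⟨mul_le_mul_of_nonneg_left hv.2.2.1 hN.le, fun p hp hpl hlt => ?_⟩
  by_contra hle
  have hsec : p ∈ Ico (0 : ℝ) ((1 / 2) ^ N) :=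
    ⟨(hΔ hp).1, (not_lt.1 hle).trans_lt (half_pow_mul_mem hv.1 N).2⟩
  obtain ⟨j, rfl⟩ := lattice_section hpl hsec
  have h1 := lt_of_mul_lt_mul_left hlt hN.le
  have h2 := le_of_mul_le_mul_left (not_lt.1 hle) hN
  have hq : (0 : ℝ) < q := by exact_mod_cast NeZero.pos q
  rw [div_lt_div_iff_of_pos_right hq] at h1
  exact absurd (hv.2.2.2 j (Fin.lt_def.2 (by exact_mod_cast h1)) ⟨div_mem j, hp⟩) (not_lt.2 h2)

theorem iterate_sub_mem_lattice {x : ℝ} (hx : x ∈ Ico (0 : ℝ) ((1 / 2) ^ N)) {s : ℕ}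
    (hs : s < retTime (F q π) (Ico (0 : ℝ) ((1 / 2) ^ N)) x) : (F q π)^[s] x - x ∈ lattice q N := by
  obtain ⟨n, h1, h2, -⟩ := returnPoint_spec (π := π) hx
  rw [← h2 s (by omega)]
  exact trunc_iterate_sub_mem_lattice (section_subset hx) s

theorem word_length_of_mem_coding (hΔ : Admissible q π Δ) {i : Fin q} {v : ℝ}
    (hv : v ∈ coding q (labelSet q (rescale N Δ)) i) :
    retTime (F q π) (Ico (0 : ℝ) ((1 / 2) ^ N)) ((1 / 2) ^ N * v) =
      (word q N π (labelSet q Δ) i).length := by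
  rw [word, List.length_map, List.length_range]
  exact ((joined_of_mem_coding hv hΔ.subset).return (π := π) hΔ (half_pow_mul_mem (div_mem i) N)
    (half_pow_mul_mem hv.1 N)).1

theorem iterate_mem_coding (hΔ : Admissible q π Δ) {i : Fin q} {v : ℝ}
    (hv : v ∈ coding q (labelSet q (rescale N Δ)) i) {s : ℕ}
    (hs : s < (word q N π (labelSet q Δ) i).length) :
    (F q π)^[s] ((1 / 2) ^ N * v) ∈ coding q (labelSet q Δ) (word q N π (labelSet q Δ) i)[s] := by
  have hi := section_subset (half_pow_mul_mem (div_mem i) N)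
  have hv' := section_subset (half_pow_mul_mem hv.1 N)
  have hs' := hs
  rw [word, List.length_map, List.length_range] at hs'
  have hJ := (((joined_of_mem_coding hv hΔ.subset).return (π := π) hΔ
    (half_pow_mul_mem (div_mem i) N) (half_pow_mul_mem hv.1 N)).2.1 s hs').2
  refine hJ.mem_coding (F_mapsTo.iterate s hv') ?_
  simp only [word, List.getElem_map, List.getElem_range]
  obtain ⟨j, hj⟩ := exists_mem_coding hΔ.zero_mem_labelSet (F_mapsTo.iterate (f := F q π) s hi)
  rwa [labelAt_eq hj]

theorem exists_iterate_eq_add (hΔ : Admissible q π Δ) (i : Fin q) {s : ℕ}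
    (hs : s < (word q N π (labelSet q Δ) i).length) :
    ∃ c ∈ lattice q N, ∀ v ∈ coding q (labelSet q (rescale N Δ)) i,
      (F q π)^[s] ((1 / 2) ^ N * v) = (1 / 2) ^ N * v + c := by
  rw [word, List.length_map, List.length_range] at hs
  refine ⟨_, iterate_sub_mem_lattice (half_pow_mul_mem (div_mem i) N) hs, fun v hv => ?_⟩
  have := (((joined_of_mem_coding hv hΔ.subset).return (π := π) hΔ
    (half_pow_mul_mem (div_mem i) N) (half_pow_mul_mem hv.1 N)).2.1 s hs).1
  linarith

/-- Each word starts with the label of `0`, as `[0, 2 ^ -N)` lies in the first of the `q` intervals,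
and it ends with the label of the interval that the exchange maps to the last one. -/
theorem isProper_word (hN : q ≤ 2 ^ N) : IsProperSubstitution (word q N π S) := by
  have hq : (0 : ℝ) < q := by exact_mod_cast NeZero.pos q
  have hN0 := half_pow_pos N
  have hqN : (q : ℝ) * (1 / 2) ^ N ≤ 1 := by
    have : (q : ℝ) ≤ 2 ^ N := by exact_mod_cast hN
    calc (q : ℝ) * (1 / 2) ^ N ≤ 2 ^ N * (1 / 2) ^ N := by gcongr
      _ = 1 := by rw [← mul_pow]; norm_num
  have hlast : q - 1 < q := Nat.sub_lt (NeZero.pos q) one_pos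
  refine ⟨labelAt S ((((0 : Fin q) : ℕ) : ℝ) / q),
    labelAt S (((π.symm ⟨q - 1, hlast⟩ : Fin q) : ℕ) / q), fun i => ?_⟩
  have hx := half_pow_mul_mem (div_mem i) N
  obtain ⟨n, h1, h2, h3, h4, h5⟩ := returnPoint_spec (π := π) hx
  rw [word, h1]
  constructor
  · rw [List.range_succ_eq_map, List.map_cons, List.head?_cons, Option.some_inj]
    rw [← labelAt_rep 0 (t := (q : ℝ) * ((1 / 2) ^ N * ((i : ℕ) / q)))
      (mul_nonneg hq.le hx.1) (by nlinarith [hx.2])]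
    congr 1
    simp only [Fin.val_zero, Nat.cast_zero, zero_add, Function.iterate_zero, id]
    field_simp
  · rw [List.range_succ, List.map_append, List.map_singleton, List.getLast?_append_of_ne_nil _
      (List.cons_ne_nil _ _), List.getLast?_singleton, Option.some_inj]
    obtain ⟨j, t, h6, h7, h8⟩ := exists_rep (q := q)
      (F_mapsTo.iterate (f := F q π) n (section_subset hx))
    rw [h8, exchange_rep j h6 h7] at h4
    have h9 : π j = ⟨q - 1, hlast⟩ := by
      rw [le_div_iff₀ hq] at h4
      have h10 : (q : ℝ) < ((π j : ℕ) + 2 : ℕ) := by push_cast; nlinarith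
      have h11 : q < (π j : ℕ) + 2 := by exact_mod_cast h10
      have h12 := (π j).2
      exact Fin.ext (by simp only; omega)
    rw [h8, labelAt_rep j h6 h7, ← h9, π.symm_apply_apply]

/-! ### Cut points that come from the discontinuities -/

/-- The points `i / q` with `i ∈ S` and the points `2 ^ -n` with `n ≥ 1`. The latter are the images
of the endpoints `1 - 2 ^ (1 - n)` under the von Neumann–Kakutani map. -/
def generators (q : ℕ) (S : Set (Fin q)) : Set ℝ :=
  {e | (∃ i ∈ S, e = ((i : ℕ) : ℝ) / q) ∨ ∃ n : ℕ, e = (1 / 2) ^ (n + 1)}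

/-- The union of the `F_π`-orbits of the generators. It depends only on finite data. -/
def generated (q : ℕ) (π : Equiv.Perm (Fin q)) (S : Set (Fin q)) : Set ℝ :=
  {x | x ∈ Ico (0 : ℝ) 1 ∧ ∃ e ∈ generators q S, SameOrbit (F q π) x e}

theorem half_pow_succ_mem (n : ℕ) : (1 / 2 : ℝ) ^ (n + 1) ∈ Ico (0 : ℝ) 1 :=
  ⟨(half_pow_pos _).le, by simpa using half_pow_lt_iff.2 (Nat.succ_pos n)⟩

theorem generators_subset {q : ℕ} {S : Set (Fin q)} : generators q S ⊆ Ico 0 1 := by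
  rintro e (⟨i, -, rfl⟩ | ⟨n, rfl⟩)
  · exact div_mem i
  · exact half_pow_succ_mem n

theorem F_renorm_conj : ∀ v ∈ Ico (0 : ℝ) 1, ret (F q π) (Ico (0 : ℝ) ((1 / 2) ^ N))
    ((1 / 2) ^ N * v) = (1 / 2) ^ N * F q (renorm q N π) v := fun _ hv => ret_half_pow_mul hv

theorem sameOrbit_half_pow_mul_iff {v w : ℝ} (hv : v ∈ Ico (0 : ℝ) 1) (hw : w ∈ Ico (0 : ℝ) 1) :
    SameOrbit (F q π) ((1 / 2) ^ N * v) ((1 / 2) ^ N * w) ↔ SameOrbit (F q (renorm q N π)) v w := by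
  rw [← sameOrbit_ret_iff (recurrent_section (N := N)) (half_pow_mul_mem hv N)
    (half_pow_mul_mem hw N)]
  refine exists_congr fun m => exists_congr fun n => ?_
  rw [iterate_conj (φ := fun v => (1 / 2 : ℝ) ^ N * v) F_mapsTo F_renorm_conj hv,
    iterate_conj (φ := fun v => (1 / 2 : ℝ) ^ N * v) F_mapsTo F_renorm_conj hw]
  exact mul_right_inj' (half_pow_pos N).ne'

/-- The generated sets of cut points are compatible with renormalization: going back along the orbit
of a generator that visits the section, one reaches the section in a lattice point. -/
theorem rescale_generated : rescale N (generated q π S) =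
    generated q (renorm q N π) (labelSet q (rescale N (generated q π S))) := by
  ext v
  constructor
  · rintro ⟨hv, -, e, he, hve⟩
    refine ⟨hv, ?_⟩
    have hvs := half_pow_mul_mem hv N
    have hlat : (∃ n, e = (1 / 2) ^ (N + (n + 1))) ∨ e ∈ lattice q N := by
      rcases he with ⟨i, hi, rfl⟩ | ⟨n, rfl⟩
      · exact Or.inr (nat_div_mem_lattice N i)
      · rcases Nat.lt_or_ge N (n + 1) with h | h
        · exact Or.inl ⟨n - N, by congr 1; omega⟩
        · exact Or.inr (half_pow_mem_lattice h)
    rcases hlat with ⟨n, rfl⟩ | hlat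
    · refine ⟨_, Or.inr ⟨n, rfl⟩, ?_⟩
      rw [pow_add] at hve
      exact (sameOrbit_half_pow_mul_iff hv (half_pow_succ_mem n)).1 hve
    · have hvisit : ∃ n, (F q π)^[n] e ∈ Ico (0 : ℝ) ((1 / 2) ^ N) := by
        obtain ⟨m, n, hmn⟩ := hve
        have hmem := ret_iterate_mem (recurrent_section (π := π) (N := N)) hvs m
        have hle := (visitTime_strictMono (recurrent_section (π := π) (N := N)) hvs).le_apply
          (x := m)
        rw [ret_iterate] at hmem
        obtain ⟨l, hl⟩ := Nat.exists_eq_add_of_le' hle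
        rw [hl, Function.iterate_add_apply, hmn, ← Function.iterate_add_apply] at hmem
        exact ⟨_, hmem⟩
      obtain ⟨u, hu, s, -, hus, hul⟩ := exists_tower (generators_subset he) (Or.inl hvisit)
      have hul' := sub_mem hlat hul
      rw [sub_sub_cancel] at hul'
      obtain ⟨j, rfl⟩ := lattice_section hul' hu
      have hju : SameOrbit (F q π) ((1 / 2) ^ N * ((j : ℕ) / q)) e := hus ▸ sameOrbit_iterate s
      exact ⟨_, Or.inl ⟨j, ⟨div_mem j, section_subset hu, e, he, hju⟩, rfl⟩,
        (sameOrbit_half_pow_mul_iff hv (div_mem j)).1 (hve.trans hju.symm)⟩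
  · rintro ⟨hv, e, he, hve⟩
    refine ⟨hv, section_subset (half_pow_mul_mem hv N), ?_⟩
    have h1 := (sameOrbit_half_pow_mul_iff (N := N) (π := π) hv (generators_subset he)).2 hve
    rcases he with ⟨i, ⟨-, -, e', he', hie'⟩, rfl⟩ | ⟨n, rfl⟩
    · exact ⟨e', he', h1.trans hie'⟩
    · rw [← pow_add, ← add_assoc] at h1
      exact ⟨_, Or.inr ⟨N + n, rfl⟩, h1⟩

/-- As `F_π` is injective, one of two points of the same orbit is an iterate of the other. -/
theorem SameOrbit.iterate_eq {x y : ℝ} (hx : x ∈ Ico (0 : ℝ) 1) (hy : y ∈ Ico (0 : ℝ) 1)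
    (h : SameOrbit (F q π) x y) : ∃ n, (F q π)^[n] x = y ∨ (F q π)^[n] y = x := by
  obtain ⟨m, n, h⟩ := h
  rcases le_total m n with hmn | hmn
  · obtain ⟨l, rfl⟩ := Nat.exists_eq_add_of_le hmn
    rw [Function.iterate_add_apply] at h
    exact ⟨l, Or.inr (F_injOn.iterate F_mapsTo m hx (F_mapsTo.iterate l hy) h).symm⟩
  · obtain ⟨l, rfl⟩ := Nat.exists_eq_add_of_le hmn
    rw [Function.iterate_add_apply] at h
    exact ⟨l, Or.inl (F_injOn.iterate F_mapsTo n (F_mapsTo.iterate l hx) hy h)⟩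

theorem mem_discOrbits_iff {x : ℝ} : x ∈ discOrbits q π ↔
    x ∈ Ico (0 : ℝ) 1 ∧ ∃ d ∈ discPoints q π, SameOrbit (F q π) x d := by
  refine and_congr_right fun hx => exists_congr fun d => and_congr_right fun hd => ?_
  constructor
  · rintro ⟨n, rfl | rfl⟩
    · exact (sameOrbit_iterate n).symm
    · exact sameOrbit_iterate n
  · intro h
    obtain ⟨n, h | h⟩ := SameOrbit.iterate_eq hx hd.1 h
    · exact ⟨n, Or.inr h⟩
    · exact ⟨n, Or.inl h⟩

/-- Inside the intervals of the exchange, `F_π` is continuous at all points that are not mapped to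
an endpoint of a piece of the von Neumann–Kakutani map. -/
theorem continuousAt_F {j : Fin q} {t : ℝ} (h0 : 0 < t) (h1 : t < 1)
    (hsp : ∀ n : ℕ, exchange q π (((j : ℕ) + t) / q) ≠ 1 - (1 / 2) ^ n) :
    ContinuousAt (F q π) (((j : ℕ) + t) / q) := by
  have hq : (0 : ℝ) < q := by exact_mod_cast NeZero.pos q
  obtain ⟨n, h2, h3⟩ := exists_piece (exchange_mem (π := π) (rep_mem j h0.le h1))
  have h2 := lt_of_le_of_ne h2 (hsp n).symm
  rw [exchange_rep j h0.le h1] at h2 h3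
  have hmem : ∀ᶠ y in 𝓝 (((j : ℕ) + t) / (q : ℝ)),
      F q π y = y + (((π j : ℕ) : ℝ) - (j : ℕ)) / q - 1 + 3 * (1 / 2) ^ (n + 1) := by
    have e1 : ∀ᶠ y in 𝓝 (((j : ℕ) + t) / (q : ℝ)), ((j : ℕ) : ℝ) / q < y :=
      lt_mem_nhds (by gcongr; linarith)
    have e2 : ∀ᶠ y in 𝓝 (((j : ℕ) + t) / (q : ℝ)), y < (((j : ℕ) : ℝ) + 1) / q :=
      gt_mem_nhds (by gcongr)
    have e3 : ∀ᶠ y in 𝓝 (((j : ℕ) + t) / (q : ℝ)),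
        1 - (1 / 2 : ℝ) ^ n - (((π j : ℕ) : ℝ) - (j : ℕ)) / q < y :=
      lt_mem_nhds (by linear_combination h2)
    have e4 : ∀ᶠ y in 𝓝 (((j : ℕ) + t) / (q : ℝ)),
        y < 1 - (1 / 2 : ℝ) ^ (n + 1) - (((π j : ℕ) : ℝ) - (j : ℕ)) / q :=
      gt_mem_nhds (by linear_combination h3)
    filter_upwards [e1, e2, e3, e4] with y h4 h5 h6 h7
    obtain ⟨s, rfl⟩ : ∃ s, y = ((j : ℕ) + s) / q := ⟨q * y - (j : ℕ), by field_simp; ring⟩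
    rw [div_lt_div_iff_of_pos_right hq] at h4 h5
    have h8 : exchange q π (((j : ℕ) + s) / q) = ((j : ℕ) + s) / q +
        (((π j : ℕ) : ℝ) - (j : ℕ)) / q := by
      rw [exchange_rep j (by linarith) (by linarith)]; ring
    rw [F, h8, kakutani_eq (n := n) (by linarith) (by linarith)]
  rw [continuousAt_congr hmem]
  fun_prop

/-- If `F_π` is continuous at an endpoint of an interval of the exchange, the exchange does not
separate the neighbouring intervals. -/
theorem exchange_cont {i : ℕ} (hi : i + 1 < q)
    (hc : ContinuousWithinAt (F q π) (Ico (0 : ℝ) 1) (((i + 1 : ℕ) : ℝ) / q))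
    (hsp : ∀ n : ℕ, exchange q π (((i + 1 : ℕ) : ℝ) / q) ≠ 1 - (1 / 2) ^ n) :
    (π ⟨i + 1, hi⟩ : ℕ) = (π ⟨i, by omega⟩ : ℕ) + 1 := by
  have hq : (0 : ℝ) < q := by exact_mod_cast NeZero.pos q
  set y : ℝ := ((i + 1 : ℕ) : ℝ) / q with hy
  have hyI : y ∈ Ico (0 : ℝ) 1 := div_mem ⟨i + 1, hi⟩
  set w : ℝ := ((π ⟨i, by omega⟩ : ℕ) + 1) / (q : ℝ) with hw
  have hw0 : 0 < w := by positivity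
  have hw1 : w ≤ 1 := by
    rw [hw, div_le_one hq]
    exact_mod_cast (π ⟨i, by omega⟩).2
  -- the exchange is a translation to the left of `y`, with left limit `w`
  have hR : ∀ t : ℝ, 0 < t → t ≤ 1 / q → exchange q π (y - t) = w - t := by
    intro t h0 h1
    rw [le_div_iff₀ hq] at h1
    have h2 := exchange_rep (π := π) (⟨i, by omega⟩ : Fin q) (t := 1 - q * t) (by linarith)
      (by nlinarith)
    have h3 : ((((⟨i, by omega⟩ : Fin q) : ℕ) : ℝ) + (1 - q * t)) / q = y - t := by
      rw [hy]; push_cast; field_simp; ring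
    rw [h3] at h2
    rw [h2, hw]; field_simp; ring
  have hlim : Tendsto (fun t : ℝ => F q π (y - t)) (𝓝[>] 0) (𝓝 (F q π y)) := by
    refine hc.tendsto.comp (tendsto_nhdsWithin_iff.2 ⟨?_, ?_⟩)
    · have : Tendsto (fun t : ℝ => y - t) (𝓝 0) (𝓝 (y - 0)) := by
        exact (continuous_const.sub continuous_id).tendsto 0
      rw [sub_zero] at this
      exact this.mono_left nhdsWithin_le_nhds
    · have hy0 : 0 < y := by rw [hy]; positivity
      filter_upwards [Ioo_mem_nhdsGT hy0] with t ht
      exact ⟨by linarith [ht.2], by linarith [ht.1, hyI.2]⟩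
  have hsmall : ∀ᶠ t : ℝ in 𝓝[>] 0, 0 < t ∧ t ≤ 1 / q := by
    filter_upwards [Ioo_mem_nhdsGT (show (0 : ℝ) < 1 / q by positivity)] with t ht
    exact ⟨ht.1, ht.2.le⟩
  rcases hw1.eq_or_lt with hw1 | hw1
  · -- the values to the left of `y` tend to `0`, which is not a value of `F_π`
    exfalso
    obtain ⟨n, hn⟩ := exists_pow_lt_of_lt_one (F_mem_Ioo (π := π) hyI).1
      (show (1 / 2 : ℝ) < 1 by norm_num)
    have hle : F q π y ≤ (1 / 2) ^ n := by
      refine le_of_tendsto hlim ?_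
      filter_upwards [hsmall, Ioo_mem_nhdsGT (half_pow_pos n)] with t ht htn
      have hmem : w - t ∈ Ico (0 : ℝ) 1 :=
        ⟨by linarith [htn.2, half_pow_le_one n], by linarith [htn.1]⟩
      rw [F, hR t ht.1 ht.2]
      exact ((kakutani_lt_iff hmem n).2 (by linarith [htn.2])).le
    linarith
  · obtain ⟨n, h1, h2⟩ := exists_half_pow_near (y := 1 - w) ⟨by linarith, by linarith⟩
    have hval : F q π y = w - 1 + 3 * (1 / 2) ^ (n + 1) := by
      refine tendsto_nhds_unique hlim ?_
      have : Tendsto (fun t : ℝ => w - t - 1 + 3 * (1 / 2) ^ (n + 1)) (𝓝[>] 0)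
          (𝓝 (w - 0 - 1 + 3 * (1 / 2) ^ (n + 1))) :=
        Tendsto.mono_left (Continuous.tendsto (by fun_prop) _) nhdsWithin_le_nhds
      rw [sub_zero] at this
      refine this.congr' ?_
      filter_upwards [hsmall, Ioo_mem_nhdsGT (show (0 : ℝ) < (1 / 2) ^ n - (1 - w) by linarith)]
        with t ht htn
      rw [F, hR t ht.1 ht.2, kakutani_eq (n := n) (by linarith [htn.2]) (by linarith [htn.1])]
    obtain ⟨m, h3, h4⟩ := exists_piece (exchange_mem (π := π) hyI)
    have h3 := lt_of_le_of_ne h3 (hsp m).symm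
    have hF : F q π y = exchange q π y - 1 + 3 * (1 / 2) ^ (m + 1) := kakutani_eq h3.le h4
    have hmn : m = n := by
      have e1 : (1 / 2 : ℝ) ^ (m + 1) < (1 / 2) ^ n := by rw [pow_succ] at *; linarith
      have e2 : (1 / 2 : ℝ) ^ (n + 1) < (1 / 2) ^ m := by rw [pow_succ] at *; linarith
      have := half_pow_lt_iff.1 e1
      have := half_pow_lt_iff.1 e2
      omega
    subst hmn
    have h5 : exchange q π y = w := by linarith
    have h6 := exchange_rep (π := π) (⟨i + 1, hi⟩ : Fin q) le_rfl zero_lt_one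
    simp only [add_zero] at h6
    rw [← hy, h5, hw] at h6
    field_simp at h6
    exact_mod_cast h6.symm

theorem discPoints_subset_gridPoints : discPoints q π ⊆ gridPoints q := by
  rintro x ⟨hx, rfl | ⟨n, hn⟩ | hc⟩
  · exact admissible_gridPoints (π := π).zero_mem
  · exact mem_gridPoints_of_exchange_eq hx hn
  · by_contra hgrid
    obtain ⟨j, t, h0, h1, rfl⟩ := exists_rep (q := q) hx
    rcases h0.eq_or_lt with rfl | h0
    · rw [add_zero] at hgrid
      exact hgrid (div_mem_gridPoints j)
    · exact hc (continuousAt_F h0 h1 fun n hn =>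
        hgrid (mem_gridPoints_of_exchange_eq hx hn)).continuousWithinAt

theorem iterate_mem_gridPoints_iff {x : ℝ} (hx : x ∈ Ico (0 : ℝ) 1) (n : ℕ) :
    (F q π)^[n] x ∈ gridPoints q ↔ x ∈ gridPoints q :=
  admissible_gridPoints.iterate_mem_iff hx n

theorem discPoints_subset_discOrbits : discPoints q π ⊆ discOrbits q π := fun x hx =>
  mem_discOrbits_iff.2 ⟨hx.1, x, hx, ⟨0, 0, rfl⟩⟩

theorem admissible_discOrbits : Admissible q π (discOrbits q π) where
  subset := fun x hx => hx.1
  zero_mem := discPoints_subset_discOrbits ⟨by simp, Or.inl rfl⟩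
  lattice := fun x hx => by
    obtain ⟨hx, d, hd, m, n, h⟩ := mem_discOrbits_iff.1 hx
    have h1 := (iterate_mem_gridPoints_iff (π := π) hd.1 n).2 (discPoints_subset_gridPoints hd)
    rw [← h, iterate_mem_gridPoints_iff hx] at h1
    exact (mem_gridPoints_iff.1 h1).2
  map_mem_iff := fun x hx => by
    have h : SameOrbit (F q π) x (F q π x) := sameOrbit_iterate 1
    rw [mem_discOrbits_iff, mem_discOrbits_iff]
    exact ⟨fun ⟨_, d, hd, hxd⟩ => ⟨hx, d, hd, h.trans hxd⟩,
      fun ⟨_, d, hd, hxd⟩ => ⟨F_mapsTo hx, d, hd, h.symm.trans hxd⟩⟩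
  special := fun x hx n h => discPoints_subset_discOrbits ⟨hx, Or.inr (Or.inl ⟨n, h⟩)⟩
  cont := fun i hi h => by
    have hy : ((i + 1 : ℕ) : ℝ) / q ∈ Ico (0 : ℝ) 1 := div_mem ⟨i + 1, hi⟩
    refine exchange_cont hi ?_ fun n hn => ?_
    · by_contra hc
      exact h (discPoints_subset_discOrbits ⟨hy, Or.inr (Or.inr hc)⟩)
    · exact h (discPoints_subset_discOrbits ⟨hy, Or.inr (Or.inl ⟨n, hn⟩)⟩)

/-- Up to orbits, the discontinuities are the generators: a point inside an interval of the exchange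
is a discontinuity only if the exchange maps it to an endpoint of a piece. -/
theorem discOrbits_eq_generated :
    discOrbits q π = generated q π (labelSet q (discOrbits q π)) := by
  ext x
  rw [mem_discOrbits_iff]
  refine and_congr_right fun hx => ⟨?_, ?_⟩
  · rintro ⟨d, hd, hxd⟩
    have hspecial : ∀ n : ℕ, exchange q π d = 1 - (1 / 2) ^ n →
        ∃ e ∈ generators q (labelSet q (discOrbits q π)), SameOrbit (F q π) x e := by
      intro n hn
      refine ⟨_, Or.inr ⟨n, rfl⟩, hxd.trans ?_⟩
      rw [← kakutani_special, ← hn]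
      exact sameOrbit_iterate (f := F q π) 1
    obtain ⟨j, t, h0, h1, hjt⟩ := exists_rep (q := q) hd.1
    rcases h0.eq_or_lt with rfl | h0
    · rw [add_zero] at hjt
      refine ⟨d, Or.inl ⟨j, ?_, hjt⟩, hxd⟩
      rw [mem_labelSet, ← hjt]
      exact discPoints_subset_discOrbits hd
    · rcases hd.2 with rfl | ⟨n, hn⟩ | hc
      · have hq : (0 : ℝ) < q := by exact_mod_cast NeZero.pos q
        exact absurd hjt (by positivity)
      · exact hspecial n hn
      · by_contra hno
        refine hc ?_
        rw [hjt]
        refine (continuousAt_F h0 h1 fun n hn => hno (hspecial n ?_)).continuousWithinAt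
        rw [hjt, hn]
  · rintro ⟨e, he, hxe⟩
    have : e ∈ discOrbits q π := by
      rcases he with ⟨i, hi, rfl⟩ | ⟨n, rfl⟩
      · exact hi
      · exact admissible_discOrbits.half_pow_mem n
    obtain ⟨-, d, hd, hed⟩ := mem_discOrbits_iff.1 this
    exact ⟨d, hd, hxe.trans hed⟩

end RotatedOdometer

/-! ### Positions in lists of lengths -/

theorem List.exists_eq_sum_take_add {L : List ℕ} {s : ℕ} (hs : s < L.sum) :
    ∃ (p : ℕ) (hp : p < L.length) (s' : ℕ), s' < L[p] ∧ s = (L.take p).sum + s' := by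
  induction L generalizing s with
  | nil => simp at hs
  | cons a L ih =>
    rcases Nat.lt_or_ge s a with h | h
    · exact ⟨0, by simp, s, h, by simp⟩
    · obtain ⟨p, hp, s', h1, h2⟩ := ih (s := s - a) (by simp at hs; omega)
      exact ⟨p + 1, by simpa using hp, s', by simpa using h1, by simp; omega⟩

theorem List.sum_take_mono (L : List ℕ) : Monotone fun p => (L.take p).sum :=
  monotone_nat_of_le_succ fun p => by
    rcases Nat.lt_or_ge p L.length with h | h
    · rw [List.sum_take_succ L p h]; exact Nat.le_add_right _ _
    · rw [List.take_of_length_le h, List.take_of_length_le (by omega)]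

theorem List.sum_take_add_inj {L : List ℕ} {p p' s s' : ℕ} (hp : p < L.length)
    (hp' : p' < L.length) (hs : s < L[p]) (hs' : s' < L[p'])
    (h : (L.take p).sum + s = (L.take p').sum + s') : p = p' := by
  wlog hlt : p < p' generalizing p p' s s'
  · by_contra hne
    exact hne (this hp' hp hs' hs h.symm (by omega)).symm
  have h1 := L.sum_take_mono (show p + 1 ≤ p' from hlt)
  simp only [List.sum_take_succ L p hp] at h1
  omega

theorem List.sum_take_add_lt {L : List ℕ} {p s : ℕ} (hp : p < L.length) (hs : s < L[p]) :
    (L.take p).sum + s < L.sum := by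
  have h1 := L.sum_take_mono (show p + 1 ≤ L.length from hp)
  simp only [List.sum_take_succ L p hp, List.take_length] at h1
  omega

namespace RotatedOdometer

open FirstReturn

variable {q : ℕ} {π : Equiv.Perm (Fin q)} {N : ℕ} {Δ : Set ℝ}

/-! ### Heights of towers -/

/-- The return times to `L_k` of the coding intervals, computed from the substitutions. -/
def height (χ : ℕ → Fin q → List (Fin q)) : ℕ → Fin q → ℕ
  | 0, _ => 1
  | k + 1, i => ((χ k i).map (height χ k)).sum

/-- The time of the `p`-th return to `L_k` of the points of the `i`-th coding interval of
`L_{k+1}`, computed from the substitutions. -/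
def offset (χ : ℕ → Fin q → List (Fin q)) (k : ℕ) (i : Fin q) (p : ℕ) : ℕ :=
  (((χ k i).map (height χ k)).take p).sum

theorem offset_succ (χ : ℕ → Fin q → List (Fin q)) {k : ℕ} {i : Fin q} {p : ℕ}
    (hp : p < (χ k i).length) :
    offset χ k i (p + 1) = offset χ k i p + height χ k (χ k i)[p] := by
  rw [offset, List.sum_take_succ _ _ (by simpa using hp), List.getElem_map, offset]

theorem offset_length (χ : ℕ → Fin q → List (Fin q)) (k : ℕ) (i : Fin q) :
    offset χ k i (χ k i).length = height χ (k + 1) i := by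
  rw [offset, List.take_of_length_le (by simp), height]

theorem exists_eq_offset_add (χ : ℕ → Fin q → List (Fin q)) {k : ℕ} {i : Fin q} {s : ℕ}
    (hs : s < height χ (k + 1) i) : ∃ (p : ℕ) (hp : p < (χ k i).length) (s' : ℕ),
      s' < height χ k (χ k i)[p] ∧ s = offset χ k i p + s' := by
  obtain ⟨p, hp, s', h1, h2⟩ := List.exists_eq_sum_take_add (show s < _ from hs)
  exact ⟨p, by simpa using hp, s', by simpa using h1, h2⟩

theorem offset_add_lt (χ : ℕ → Fin q → List (Fin q)) {k : ℕ} {i : Fin q} {p s : ℕ}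
    (hp : p < (χ k i).length) (hs : s < height χ k (χ k i)[p]) :
    offset χ k i p + s < height χ (k + 1) i :=
  List.sum_take_add_lt (by simpa using hp) (by simpa using hs)

theorem offset_add_inj (χ : ℕ → Fin q → List (Fin q)) {k : ℕ} {i : Fin q} {p p' s s' : ℕ}
    (hp : p < (χ k i).length) (hp' : p' < (χ k i).length) (hs : s < height χ k (χ k i)[p])
    (hs' : s' < height χ k (χ k i)[p']) (h : offset χ k i p + s = offset χ k i p' + s') :
    p = p' :=
  List.sum_take_add_inj (by simpa using hp) (by simpa using hp') (by simpa using hs)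
    (by simpa using hs') h

/-- The `s`-th floor of the tower over the `i`-th coding interval of `L_k`. -/
def floor (q N : ℕ) (π : Equiv.Perm (Fin q)) (Δ : Set ℝ) (k : ℕ) (i : Fin q) (s : ℕ) : Set ℝ :=
  (F q π)^[s] '' codingInterval q N Δ k i

theorem F_mem_floor {k : ℕ} {i : Fin q} {s : ℕ} {x : ℝ} (hx : x ∈ floor q N π Δ k i s) :
    F q π x ∈ floor q N π Δ k i (s + 1) := by
  obtain ⟨u, hu, rfl⟩ := hx
  exact ⟨u, hu, Function.iterate_succ_apply' _ _ _⟩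

theorem mem_Ico_of_mem_section {k : ℕ} {x : ℝ} (hx : x ∈ section_ N k) : x ∈ Ico (0 : ℝ) 1 :=
  ⟨hx.1, hx.2.trans_le (half_pow_le_one _)⟩

theorem codingInterval_subset {k : ℕ} {i : Fin q} {x : ℝ} (hx : x ∈ codingInterval q N Δ k i) :
    x ∈ Ico (0 : ℝ) 1 := mem_Ico_of_mem_section hx.1

variable [NeZero q]

/-! ### The levels of the renormalization -/

/-- The permutation of the rescaled first return map to `L_k`. -/
def permAt (q N : ℕ) [NeZero q] (π : Equiv.Perm (Fin q)) (k : ℕ) : Equiv.Perm (Fin q) :=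
  (renorm q N)^[k] π

/-- The labels of the cut points of `L_k`. -/
def labelsAt (q N : ℕ) (Δ : Set ℝ) (k : ℕ) : Set (Fin q) := labelSet q (rescale (k * N) Δ)

/-- The substitutions of the successive first return maps. -/
def returnSubst (q N : ℕ) [NeZero q] (π : Equiv.Perm (Fin q)) (Δ : Set ℝ) (k : ℕ) :
    Fin q → List (Fin q) :=
  word q N (permAt q N π k) (labelsAt q N Δ k)

theorem permAt_succ (k : ℕ) : permAt q N π (k + 1) = renorm q N (permAt q N π k) :=
  Function.iterate_succ_apply' _ _ _

theorem rescale_succ (k : ℕ) :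
    rescale ((k + 1) * N) Δ = rescale N (rescale (k * N) Δ) := by
  rw [rescale_rescale, add_mul, one_mul]

/-- The rescaled cut points of `L_k` are admissible for the `k`-th permutation. -/
theorem Admissible.level (hΔ : Admissible q π Δ) (k : ℕ) :
    Admissible q (permAt q N π k) (rescale (k * N) Δ) := by
  induction k with
  | zero =>
    have : rescale (0 * N) Δ = Δ := by
      ext v
      rw [mem_rescale, zero_mul, pow_zero, one_mul]
      exact ⟨fun h => h.2, fun h => ⟨hΔ.subset h, h⟩⟩
    rw [this]
    exact hΔ
  | succ k ih =>
    rw [permAt_succ, rescale_succ]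
    exact ih.admissible_rescale

theorem cutPoint_eq (k : ℕ) (i : Fin q) :
    cutPoint q N k i = (1 / 2) ^ (k * N) * (((i : ℕ) : ℝ) / q) := by
  have hq : (0 : ℝ) < q := by exact_mod_cast NeZero.pos q
  rw [cutPoint, one_div, inv_pow]
  field_simp

theorem cutPoint_mem_iff {k : ℕ} {i : Fin q} : cutPoint q N k i ∈ Δ ↔ i ∈ labelsAt q N Δ k := by
  rw [cutPoint_eq]
  exact ⟨fun h => ⟨div_mem i, h⟩, fun h => h.2⟩

theorem mem_section_iff {k : ℕ} {v : ℝ} :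
    (1 / 2 : ℝ) ^ (k * N) * v ∈ section_ N k ↔ v ∈ Ico (0 : ℝ) 1 := by
  have hk := half_pow_pos (k * N)
  refine ⟨fun h => ⟨?_, ?_⟩, fun h => half_pow_mul_mem h _⟩
  · exact nonneg_of_mul_nonneg_right h.1 hk
  · exact lt_of_mul_lt_mul_left (by simpa using h.2) hk.le

theorem mul_mem_codingInterval_iff {k : ℕ} {i : Fin q} {v : ℝ} :
    (1 / 2 : ℝ) ^ (k * N) * v ∈ codingInterval q N Δ k i ↔ v ∈ coding q (labelsAt q N Δ k) i := by
  have hk := half_pow_pos (k * N)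
  refine and_congr mem_section_iff (and_congr cutPoint_mem_iff (and_congr ?_ ?_))
  · rw [cutPoint_eq, mul_le_mul_iff_right₀ hk]
  · refine forall_congr' fun j => imp_congr_right fun _ => imp_congr cutPoint_mem_iff ?_
    rw [cutPoint_eq, mul_lt_mul_iff_right₀ hk]

theorem exists_eq_mul (k N : ℕ) (x : ℝ) : ∃ v : ℝ, x = (1 / 2) ^ (k * N) * v :=
  ⟨x / (1 / 2) ^ (k * N), (mul_div_cancel₀ _ (half_pow_pos _).ne').symm⟩

theorem recurrent_level (k : ℕ) : Recurrent (F q π) (section_ N k) := recurrent_section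

theorem section_antitone (k : ℕ) : section_ N (k + 1) ⊆ section_ N k := fun _ hx =>
  ⟨hx.1, hx.2.trans_le (half_pow_le_iff.2 (Nat.mul_le_mul_right N (Nat.le_succ k)))⟩

theorem mul_mem_section_succ_iff {k : ℕ} {v : ℝ} :
    (1 / 2 : ℝ) ^ (k * N) * v ∈ section_ N (k + 1) ↔ v ∈ Ico (0 : ℝ) ((1 / 2) ^ N) := by
  have hk := half_pow_pos (k * N)
  have hpow : (1 / 2 : ℝ) ^ ((k + 1) * N) = (1 / 2) ^ (k * N) * (1 / 2) ^ N := by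
    rw [← pow_add, add_mul, one_mul]
  rw [section_, hpow]
  exact and_congr (mul_nonneg_iff_of_pos_left hk) (mul_lt_mul_iff_right₀ hk)

/-- The rescaled first return map to `L_k` is the rotated odometer of the `k`-th permutation. -/
theorem firstReturn_mul (k : ℕ) : ∀ v ∈ Ico (0 : ℝ) 1,
    firstReturn q N π k ((1 / 2) ^ (k * N) * v) =
      (1 / 2) ^ (k * N) * F q (permAt q N π k) v := by
  induction k with
  | zero =>
    intro v hv
    have h : retTime (F q π) (section_ N 0) v = 1 := by
      refine retTime_eq one_pos ?_ fun m h1 h2 => absurd h1 (by omega)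
      simpa [section_] using F_mapsTo (π := π) hv
    simp only [zero_mul, pow_zero, one_mul]
    change (F q π)^[retTime (F q π) (section_ N 0) v] v = _
    rw [h]
    rfl
  | succ k ih =>
    intro v hv
    have hv' := half_pow_mul_mem hv N
    have hpow : (1 / 2 : ℝ) ^ ((k + 1) * N) = (1 / 2) ^ (k * N) * (1 / 2) ^ N := by
      rw [← pow_add, add_mul, one_mul]
    rw [hpow, mul_assoc]
    have hmem : (1 / 2 : ℝ) ^ (k * N) * ((1 / 2) ^ N * v) ∈ section_ N (k + 1) :=
      mul_mem_section_succ_iff.2 hv'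
    have h1 : firstReturn q N π (k + 1) ((1 / 2 : ℝ) ^ (k * N) * ((1 / 2) ^ N * v)) =
        ret (firstReturn q N π k) (section_ N (k + 1))
          ((1 / 2 : ℝ) ^ (k * N) * ((1 / 2) ^ N * v)) :=
      (ret_ret (recurrent_level k) (section_antitone k) (section_antitone k hmem)
        (recurrent_level (k + 1) _ hmem)).symm
    have h2 := retTime_conj (φ := fun v => (1 / 2 : ℝ) ^ (k * N) * v) (B := section_ N (k + 1))
      (C := Ico (0 : ℝ) ((1 / 2) ^ N)) F_mapsTo ih (fun v _ => mul_mem_section_succ_iff)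
      (section_subset hv')
    rw [h1, ret, h2, iterate_conj (φ := fun v => (1 / 2 : ℝ) ^ (k * N) * v) F_mapsTo ih
      (section_subset hv'), permAt_succ, mul_assoc, ← ret_half_pow_mul hv]
    rfl

theorem firstReturn_iterate_mul (k : ℕ) {v : ℝ} (hv : v ∈ Ico (0 : ℝ) 1) (n : ℕ) :
    (firstReturn q N π k)^[n] ((1 / 2) ^ (k * N) * v) =
      (1 / 2) ^ (k * N) * (F q (permAt q N π k))^[n] v :=
  iterate_conj (φ := fun v => (1 / 2 : ℝ) ^ (k * N) * v) F_mapsTo (firstReturn_mul k) hv n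

theorem exists_of_mem_codingInterval_succ {k : ℕ} {i : Fin q} {x : ℝ}
    (hx : x ∈ codingInterval q N Δ (k + 1) i) :
    ∃ v ∈ coding q (labelSet q (rescale N (rescale (k * N) Δ))) i,
      x = (1 / 2) ^ (k * N) * ((1 / 2) ^ N * v) := by
  obtain ⟨v, rfl⟩ := exists_eq_mul (k + 1) N x
  refine ⟨v, ?_, ?_⟩
  · rw [← rescale_succ]; exact mul_mem_codingInterval_iff.1 hx
  · rw [add_mul, one_mul, pow_add, mul_assoc]

/-- The substitutions record the first return maps. -/
theorem isReturnWord (hΔ : Admissible q π Δ) (k : ℕ) (i : Fin q) {x : ℝ}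
    (hx : x ∈ codingInterval q N Δ (k + 1) i) :
    IsReturnWord q N π Δ k x (returnSubst q N π Δ k i) := by
  obtain ⟨v, hv, rfl⟩ := exists_of_mem_codingInterval_succ hx
  have hv' := half_pow_mul_mem hv.1 N
  have hlev := hΔ.level (N := N) k
  constructor
  · have h := retTime_isLeast (recurrent_section (π := permAt q N π k) (N := N) _ hv')
    rw [word_length_of_mem_coding hlev hv] at h
    refine ⟨⟨h.1.1, ?_⟩, fun n hn => h.2 ⟨hn.1, ?_⟩⟩
    · rw [firstReturn_iterate_mul k (section_subset hv'), mul_mem_section_succ_iff]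
      exact h.1.2
    · have h2 := hn.2
      rwa [firstReturn_iterate_mul k (section_subset hv'), mul_mem_section_succ_iff] at h2
  · intro s hs
    rw [firstReturn_iterate_mul k (section_subset hv'), mul_mem_codingInterval_iff]
    exact iterate_mem_coding hlev hv hs

theorem isProper_returnSubst (hN : q ≤ 2 ^ N) (k : ℕ) :
    IsProperSubstitution (returnSubst q N π Δ k) := isProper_word hN

theorem rescale_gridPoints (M : ℕ) : rescale M (gridPoints q) = gridPoints q := by
  ext v
  rw [mem_rescale, mem_gridPoints_iff, mem_gridPoints_iff]
  constructor
  · rintro ⟨hv, -, K, hK⟩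
    exact ⟨hv, K, mem_lattice_of_half_pow_mul_mem (lattice_mono (Nat.le_add_left K M) hK)⟩
  · rintro ⟨hv, K, hK⟩
    exact ⟨hv, section_subset (half_pow_mul_mem hv M), _, half_pow_mul_mem_lattice M hK⟩

theorem rescale_discOrbits (k : ℕ) : rescale (k * N) (discOrbits q π) =
    generated q (permAt q N π k) (labelsAt q N (discOrbits q π) k) := by
  induction k with
  | zero =>
    have : rescale (0 * N) (discOrbits q π) = discOrbits q π := by
      ext v
      rw [mem_rescale, zero_mul, pow_zero, one_mul]
      exact ⟨fun h => h.2, fun h => ⟨h.1, h⟩⟩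
    rw [labelsAt, this]
    exact discOrbits_eq_generated
  | succ k ih =>
    rw [labelsAt, rescale_succ, permAt_succ, ih]
    exact rescale_generated

/-- An orbit in a finite set is eventually periodic. -/
theorem exists_eventually_periodic {α : Type*} [Finite α] (a : ℕ → α) (T : α → α)
    (h : ∀ k, a (k + 1) = T (a k)) : ∃ k₀ p₀ : ℕ, 0 < p₀ ∧ ∀ k, k₀ ≤ k → a (k + p₀) = a k := by
  obtain ⟨m, n, hne, heq⟩ := Finite.exists_ne_map_eq_of_infinite a
  wlog hlt : m < n generalizing m n
  · exact this n m hne.symm heq.symm (by omega)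
  refine ⟨m, n - m, by omega, fun k hk => ?_⟩
  induction k, hk using Nat.le_induction with
  | base => rw [Nat.add_sub_cancel' hlt.le, heq]
  | succ k hk ih => rw [h k, ← ih, Nat.add_right_comm, h]

/-- The permutation and the labels of the cut points at one level determine those at the next level,
and there are finitely many possibilities. -/
theorem returnSubst_eventually_periodic
    (hΔ : Δ = discOrbits q π ∨ Δ = gridPoints q) : ∃ k₀ p₀ : ℕ, 0 < p₀ ∧
      ∀ k, k₀ ≤ k → returnSubst q N π Δ (k + p₀) = returnSubst q N π Δ k := by
  have hT : ∃ T : Equiv.Perm (Fin q) × Set (Fin q) → Equiv.Perm (Fin q) × Set (Fin q),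
      ∀ k, (permAt q N π (k + 1), labelsAt q N Δ (k + 1)) =
        T (permAt q N π k, labelsAt q N Δ k) := by
    rcases hΔ with rfl | rfl
    · refine ⟨fun x => (renorm q N x.1, labelSet q (rescale N (generated q x.1 x.2))),
        fun k => Prod.ext (permAt_succ k) ?_⟩
      simp only
      rw [← rescale_discOrbits, ← rescale_succ]
      rfl
    · refine ⟨fun x => (renorm q N x.1, x.2), fun k => Prod.ext (permAt_succ k) ?_⟩
      simp only [labelsAt, rescale_gridPoints]
  obtain ⟨T, hT⟩ := hT
  obtain ⟨k₀, p₀, hp, h⟩ := exists_eventually_periodic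
    (fun k => (permAt q N π k, labelsAt q N Δ k)) T hT
  refine ⟨k₀, p₀, hp, fun k hk => ?_⟩
  have h1 := Prod.ext_iff.1 (h k hk)
  simp only at h1
  rw [returnSubst, h1.1, h1.2, returnSubst]

/-! ### Towers over the coding intervals -/

section Towers

local notation "χ" => returnSubst q N π Δ

theorem codingInterval_unique {k : ℕ} {i j : Fin q} {x : ℝ} (hi : x ∈ codingInterval q N Δ k i)
    (hj : x ∈ codingInterval q N Δ k j) : i = j := by
  obtain ⟨v, rfl⟩ := exists_eq_mul k N x
  exact coding_unique (mul_mem_codingInterval_iff.1 hi) (mul_mem_codingInterval_iff.1 hj)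

theorem exists_mem_codingInterval (hΔ : Admissible q π Δ) {k : ℕ} {x : ℝ}
    (hx : x ∈ section_ N k) : ∃ i, x ∈ codingInterval q N Δ k i := by
  obtain ⟨v, rfl⟩ := exists_eq_mul k N x
  simp only [mul_mem_codingInterval_iff]
  exact exists_mem_coding (hΔ.level (N := N) k).zero_mem_labelSet (mem_section_iff.1 hx)

theorem zero_mem_codingInterval (hΔ : Admissible q π Δ) (k : ℕ) :
    (0 : ℝ) ∈ codingInterval q N Δ k 0 := by
  have h := (mul_mem_codingInterval_iff (N := N) (k := k)).2
    (mem_coding_zero (hΔ.level (N := N) k).zero_mem_labelSet)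
  rwa [mul_zero] at h

theorem visitTime_eq_offset (hΔ : Admissible q π Δ) {k : ℕ} {i : Fin q} {u : ℝ}
    (hk : ∀ j, ∀ u ∈ codingInterval q N Δ k j,
      retTime (F q π) (section_ N k) u = height χ k j)
    (hu : u ∈ codingInterval q N Δ (k + 1) i) {p : ℕ} (hp : p ≤ (χ k i).length) :
    visitTime (F q π) (section_ N k) u p = offset χ k i p := by
  induction p with
  | zero => rfl
  | succ p ih =>
    rw [visitTime_succ, ih (by omega), offset_succ χ (by omega)]
    congr 1
    exact hk _ _ ((isReturnWord hΔ k i hu).2 p (by omega))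

/-- The height of a tower is the return time of its base. -/
theorem retTime_eq_height (hΔ : Admissible q π Δ) (k : ℕ) (i : Fin q) :
    ∀ u ∈ codingInterval q N Δ k i, retTime (F q π) (section_ N k) u = height χ k i := by
  induction k generalizing i with
  | zero =>
    intro u hu
    refine retTime_eq one_pos ?_ fun m h1 h2 => absurd h1 (by simp [height] at h2; omega)
    simpa [section_, height] using F_mapsTo (π := π) (codingInterval_subset hu)
  | succ k ih =>
    intro u hu
    rw [← (retTime_retTime (recurrent_level k) (section_antitone k) (section_antitone k hu.1)
      (recurrent_level (k + 1) u hu.1)).2, ← offset_length]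
    have h := (isReturnWord hΔ k i hu).1
    have h' : retTime (firstReturn q N π k) (section_ N (k + 1)) u = (χ k i).length :=
      h.csInf_eq
    change visitTime (F q π) (section_ N k) u (retTime (firstReturn q N π k) _ u) = _
    rw [h']
    exact visitTime_eq_offset hΔ ih hu le_rfl

theorem iterate_offset (hΔ : Admissible q π Δ) {k : ℕ} {i : Fin q} {u : ℝ}
    (hu : u ∈ codingInterval q N Δ (k + 1) i) {p : ℕ} (hp : p ≤ (χ k i).length) :
    (F q π)^[offset χ k i p] u = (firstReturn q N π k)^[p] u := by
  rw [← visitTime_eq_offset hΔ (retTime_eq_height hΔ k) hu hp]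
  exact (ret_iterate p).symm

theorem iterate_offset_mem (hΔ : Admissible q π Δ) {k : ℕ} {i : Fin q} {u : ℝ}
    (hu : u ∈ codingInterval q N Δ (k + 1) i) {p : ℕ} (hp : p < (χ k i).length) :
    (F q π)^[offset χ k i p] u ∈ codingInterval q N Δ k (χ k i)[p] := by
  rw [iterate_offset hΔ hu hp.le]
  exact (isReturnWord hΔ k i hu).2 p hp

/-- Until it returns to `L_k`, a coding interval is moved by translations. -/
theorem exists_translation (hΔ : Admissible q π Δ) (k : ℕ) (i : Fin q) {s : ℕ}
    (hs : s < height χ k i) : ∃ c ∈ lattice q (k * N), ∀ u ∈ codingInterval q N Δ k i,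
      (F q π)^[s] u = u + c := by
  induction k generalizing i s with
  | zero =>
    obtain rfl : s = 0 := by simp [height] at hs; omega
    exact ⟨0, zero_mem _, fun u _ => by simp⟩
  | succ k ih =>
    obtain ⟨p, hp, s', h1, rfl⟩ := exists_eq_offset_add χ hs
    obtain ⟨c, hc, hcu⟩ := ih _ h1
    obtain ⟨c', hc', hcu'⟩ := exists_iterate_eq_add (hΔ.level (N := N) k) i hp
    refine ⟨(1 / 2) ^ (k * N) * c' + c, add_mem ?_ (lattice_mono (Nat.mul_le_mul_right N
      (Nat.le_succ k)) hc), fun u hu => ?_⟩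
    · rw [add_mul, one_mul]; exact half_pow_mul_mem_lattice _ hc'
    · rw [add_comm, Function.iterate_add_apply, hcu _ (iterate_offset_mem hΔ hu hp),
        iterate_offset hΔ hu hp.le]
      obtain ⟨v, hv, rfl⟩ := exists_of_mem_codingInterval_succ hu
      rw [firstReturn_iterate_mul k (section_subset (half_pow_mul_mem hv.1 N)), hcu' v hv]
      ring

theorem floor_subset {k : ℕ} {i : Fin q} {s : ℕ} : floor q N π Δ k i s ⊆ Ico 0 1 := by
  rintro _ ⟨u, hu, rfl⟩
  exact F_mapsTo.iterate s (codingInterval_subset hu)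

/-- The floors of the towers of one level are disjoint. -/
theorem floor_unique (hΔ : Admissible q π Δ) {k : ℕ} {i j : Fin q} {s t : ℕ} {x : ℝ}
    (hs : s < height χ k i) (ht : t < height χ k j) (hx : x ∈ floor q N π Δ k i s)
    (hx' : x ∈ floor q N π Δ k j t) : i = j ∧ s = t := by
  wlog hst : s ≤ t generalizing i j s t
  · obtain ⟨h1, h2⟩ := this ht hs hx' hx (by omega)
    exact ⟨h1.symm, h2.symm⟩
  obtain ⟨u, hu, rfl⟩ := hx
  obtain ⟨v, hv, hvu⟩ := hx'
  obtain ⟨l, rfl⟩ := Nat.exists_eq_add_of_le hst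
  rw [Function.iterate_add_apply] at hvu
  have h1 := F_injOn.iterate F_mapsTo s (F_mapsTo.iterate l (codingInterval_subset hv))
    (codingInterval_subset hu) hvu
  rcases Nat.eq_zero_or_pos l with rfl | hl
  · have h1 : v = u := h1
    subst h1
    exact ⟨codingInterval_unique hu hv, rfl⟩
  · rw [← retTime_eq_height hΔ k j v hv] at ht
    exact absurd (h1 ▸ hu.1) (notMem_of_lt_retTime (f := F q π) hl (by omega))

/-- The towers of level `k + 1` are obtained by stacking pieces of the towers of level `k`, in the
order of the letters of the substitution. -/
theorem floor_succ_subset (hΔ : Admissible q π Δ) {k : ℕ} {i : Fin q} {p : ℕ}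
    (hp : p < (χ k i).length) (s : ℕ) :
    floor q N π Δ (k + 1) i (offset χ k i p + s) ⊆ floor q N π Δ k (χ k i)[p] s := by
  rintro _ ⟨u, hu, rfl⟩
  exact ⟨_, iterate_offset_mem hΔ hu hp, by rw [← Function.iterate_add_apply, add_comm]⟩

/-! ### Floors are intervals between cut points -/

/-- To the left of a point that is not a cut point, `F_π` is a translation. -/
theorem exists_left_translation (hΔ : Admissible q π Δ) {y : ℝ} (hy : y ∈ Ico (0 : ℝ) 1)
    (hyΔ : y ∉ Δ) : ∃ x₀ < y, 0 ≤ x₀ ∧ ∀ x, x₀ ≤ x → x ≤ y → F q π y - F q π x = y - x := by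
  have hq : (0 : ℝ) < q := by exact_mod_cast NeZero.pos q
  obtain ⟨n, -, h2⟩ := exists_piece (exchange_mem (π := π) hy)
  have hη : (0 : ℝ) < (1 / 2) ^ (n + 1) / q := div_pos (half_pow_pos _) hq
  set η : ℝ := (1 / 2) ^ (n + 1) / q with hηdef
  have hy0 : 0 < y := lt_of_le_of_ne hy.1 fun h => hyΔ (h ▸ hΔ.zero_mem)
  set m : ℤ := ⌈y / η⌉ - 1 with hm
  have hm1 : m * η < y := by
    rw [← lt_div_iff₀ hη, hm]
    push_cast
    linarith [Int.ceil_lt_add_one (y / η)]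
  have hm2 : y ≤ (m + 1) * η := by
    rw [← div_le_iff₀ hη, hm]
    push_cast
    linarith [Int.le_ceil (y / η)]
  have hm0 : 0 ≤ m := by
    have : 0 < ⌈y / η⌉ := Int.ceil_pos.2 (div_pos hy0 hη)
    omega
  have hm0' : (0 : ℝ) ≤ m := by exact_mod_cast hm0
  -- the point `m η` is the last one of mesh `η` to the left of `y`
  refine ⟨m * η, hm1, mul_nonneg hm0' hη.le, fun x h3 h4 => ?_⟩
  have hx : x ∈ Ico (0 : ℝ) 1 := ⟨(mul_nonneg hm0' hη.le).trans h3, h4.trans_lt hy.2⟩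
  have hJ : Joined q (n + 1) Δ x y := by
    refine ⟨h4, fun p hp hpl hxp => ?_⟩
    obtain ⟨l, rfl⟩ := mem_lattice_iff.1 hpl
    have h5 : m < l := by exact_mod_cast lt_of_mul_lt_mul_right (h3.trans_lt hxp) hη.le
    have h6 : (m : ℝ) + 1 ≤ l := by exact_mod_cast h5
    have h7 : y ≤ l * η := hm2.trans (mul_le_mul_of_nonneg_right h6 hη.le)
    exact lt_of_le_of_ne h7 fun h => hyΔ (h ▸ hp)
  have h5 := hJ.exchange_sub hΔ hx hy
  refine (hJ.map hΔ hx hy ?_).1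
  rw [F_mem_section_iff hx]
  linarith

/-- A coding interval as an interval between consecutive cut points. -/
theorem exists_coding_eq_Ico {S : Set (Fin q)} {i : Fin q} (hi : i ∈ S) :
    ∃ d : ℝ, ((i : ℕ) : ℝ) / q < d ∧ d ≤ 1 ∧ (d = 1 ∨ ∃ j ∈ S, d = ((j : ℕ) : ℝ) / q) ∧
      coding q S i = Ico (((i : ℕ) : ℝ) / q) d := by
  have hq : (0 : ℝ) < q := by exact_mod_cast NeZero.pos q
  have hi0 := div_mem i
  by_cases h : ∃ j, i < j ∧ j ∈ S
  · obtain ⟨j, hj, hmin⟩ := exists_min_image {j : Fin q | i < j ∧ j ∈ S} id (toFinite _) h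
    have hij : ((i : ℕ) : ℝ) / q < ((j : ℕ) : ℝ) / q := by
      rw [div_lt_div_iff_of_pos_right hq]
      exact_mod_cast hj.1
    refine ⟨((j : ℕ) : ℝ) / q, hij, (div_mem j).2.le, Or.inr ⟨j, hj.2, rfl⟩, ?_⟩
    ext x
    refine ⟨fun hx => ⟨hx.2.2.1, hx.2.2.2 j hj.1 hj.2⟩, fun hx => ⟨⟨hi0.1.trans hx.1,
      hx.2.trans (div_mem j).2⟩, hi, hx.1, fun l h1 h2 => hx.2.trans_le ?_⟩⟩
    rw [div_le_div_iff_of_pos_right hq]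
    exact_mod_cast hmin l ⟨h1, h2⟩
  · refine ⟨1, hi0.2, le_rfl, Or.inl rfl, ?_⟩
    ext x
    exact ⟨fun hx => ⟨hx.2.2.1, hx.1.2⟩, fun hx => ⟨⟨hi0.1.trans hx.1, hx.2⟩, hi, hx.1,
      fun l h1 h2 => absurd ⟨l, h1, h2⟩ h⟩⟩

theorem exists_codingInterval_eq_Ico (hΔ : Admissible q π Δ) {k : ℕ} {i : Fin q}
    (hi : i ∈ labelsAt q N Δ k) : ∃ a b : ℝ, a < b ∧ b - a ≤ (1 / 2) ^ (k * N) ∧ a ∈ Δ ∧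
      (b ∈ Δ ∨ b = 1) ∧ a ∈ lattice q (k * N) ∧ b ∈ lattice q (k * N) ∧
      codingInterval q N Δ k i = Ico a b := by
  have hk := half_pow_pos (k * N)
  obtain ⟨d, h1, h2, h3, h4⟩ := exists_coding_eq_Ico hi
  have hlat : ∀ j : Fin q, (1 / 2 : ℝ) ^ (k * N) * (((j : ℕ) : ℝ) / q) ∈ lattice q (k * N) :=
    fun j => half_pow_mul_mem_lattice (K := 0) _ (nat_div_mem_lattice 0 j)
  refine ⟨(1 / 2) ^ (k * N) * (((i : ℕ) : ℝ) / q), (1 / 2) ^ (k * N) * d, by gcongr, ?_, hi.2, ?_,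
    hlat i, ?_, ?_⟩
  · have := (div_mem i).1
    nlinarith
  · rcases h3 with rfl | ⟨j, hj, rfl⟩
    · rw [mul_one]
      rcases Nat.eq_zero_or_pos (k * N) with h | h
      · rw [h, pow_zero]; exact Or.inr rfl
      · obtain ⟨n, hn⟩ := Nat.exists_eq_add_of_lt h
        rw [hn, zero_add]
        exact Or.inl (hΔ.half_pow_mem n)
    · exact Or.inl hj.2
  · rcases h3 with rfl | ⟨j, hj, rfl⟩
    · rw [mul_one]; exact half_pow_mem_lattice le_rfl
    · exact hlat j
  · ext x
    obtain ⟨v, rfl⟩ := exists_eq_mul k N x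
    rw [mul_mem_codingInterval_iff, h4]
    exact and_congr (mul_le_mul_iff_right₀ hk).symm (mul_lt_mul_iff_right₀ hk).symm

/-- The floors of a tower are intervals of length at most `2 ^ (-kN)` whose endpoints are cut
points, and no cut point of mesh `1 / (q 2 ^ (kN))` lies inside. -/
theorem exists_floor_eq_Ico (hΔ : Admissible q π Δ) {k : ℕ} {i : Fin q} {s : ℕ}
    (hi : i ∈ labelsAt q N Δ k) (hs : s < height χ k i) :
    ∃ a b : ℝ, a < b ∧ b - a ≤ (1 / 2) ^ (k * N) ∧ a ∈ Δ ∧ (b ∈ Δ ∨ b = 1) ∧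
      a ∈ lattice q (k * N) ∧ b ∈ lattice q (k * N) ∧
      floor q N π Δ k i s = Ico a b ∧ ∀ p ∈ Δ, p ∈ lattice q (k * N) → a < p → b ≤ p := by
  obtain ⟨a, b, hab, hlen, ha, hb, hal, hbl, hJ⟩ := exists_codingInterval_eq_Ico hΔ hi
  have hfloor : ∀ s c, (∀ u ∈ codingInterval q N Δ k i, (F q π)^[s] u = u + c) →
      floor q N π Δ k i s = Ico (a + c) (b + c) := by
    intro s c hc
    rw [floor, image_congr hc, hJ, image_add_const_Ico]
  -- The right endpoint of a floor is a cut point, by induction on the floor: otherwise it is the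
  -- image of a point `y` that is not a cut point, to the left of which the map is a translation.
  -- By injectivity, `y` is then the right endpoint of the previous floor.
  have hright : ∀ s c, s < height χ k i →
      (∀ u ∈ codingInterval q N Δ k i, (F q π)^[s] u = u + c) → b + c ∈ Δ ∨ b + c = 1 := by
    intro s
    induction s with
    | zero =>
      intro c _ hc
      have := hc a (hJ ▸ ⟨le_rfl, hab⟩)
      have hc0 : c = 0 := by simpa using this
      rw [hc0, add_zero]
      exact hb
    | succ s ih =>
      intro c hs hc
      obtain ⟨c', -, hc'⟩ := exists_translation hΔ k i (show s < height χ k i by omega)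
      have hd := ih c' (by omega) hc'
      have hsub : Ico (a + c) (b + c) ⊆ Ico (0 : ℝ) 1 := hfloor _ c hc ▸ floor_subset
      have h1 := (Ico_subset_Ico_iff (show a + c < b + c by linarith)).1 hsub
      by_contra hno
      have hno := not_or.1 hno
      obtain ⟨y, hy, hyF⟩ := F_surjOn (π := π) (show b + c ∈ Ioo (0 : ℝ) 1 from
        ⟨by linarith [h1.1], lt_of_le_of_ne h1.2 hno.2⟩)
      have hyΔ : y ∉ Δ := fun h => hno.1 (hyF ▸ (hΔ.map_mem_iff y hy).2 h)
      obtain ⟨x₀, h2, h3, h4⟩ := exists_left_translation hΔ hy hyΔ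
      -- a common translation length to the left of `y` and of the right endpoint
      set e := min (y - x₀) (b - a) with he
      have he0 : 0 < e := lt_min (by linarith) (by linarith)
      have he1 : e ≤ y - x₀ := min_le_left _ _
      have he2 : e ≤ b - a := min_le_right _ _
      have h5 := h4 (y - e) (by linarith) (by linarith)
      have hu : b - e ∈ codingInterval q N Δ k i := by rw [hJ]; exact ⟨by linarith, by linarith⟩
      have h6 := hc _ hu
      rw [Function.iterate_succ_apply', hc' _ hu] at h6
      have h7 : F q π (b - e + c') = F q π (y - e) := by linarith
      have h8 : b - e + c' ∈ Ico (0 : ℝ) 1 := by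
        rw [← hc' _ hu]; exact F_mapsTo.iterate s (codingInterval_subset hu)
      have h9 := F_injOn h8 (⟨by linarith, by linarith [hy.2]⟩ : y - e ∈ Ico (0 : ℝ) 1) h7
      have h10 : b + c' = y := by linarith
      rcases hd with hd | hd
      · exact hyΔ (h10 ▸ hd)
      · linarith [hy.2]
  obtain ⟨c, hcl, hc⟩ := exists_translation hΔ k i hs
  have haJ : a ∈ codingInterval q N Δ k i := hJ ▸ ⟨le_rfl, hab⟩
  refine ⟨a + c, b + c, by linarith, by linarith, ?_, hright s c hs hc,
    add_mem hal hcl, add_mem hbl hcl, hfloor s c hc, ?_⟩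
  · rw [← hc a haJ, hΔ.iterate_mem_iff (codingInterval_subset haJ)]
    exact ha
  · intro p hp hpl hap
    by_contra hpb
    have hmem : p - c ∈ codingInterval q N Δ k i := by
      rw [hJ]; exact ⟨by linarith, by linarith [not_le.1 hpb]⟩
    have h1 : p - c ∈ Δ := by
      rw [← hΔ.iterate_mem_iff (codingInterval_subset hmem) s, hc _ hmem, sub_add_cancel]
      exact hp
    obtain ⟨j, hj⟩ := lattice_section (sub_mem hpl hcl) hmem.1
    have hcut : p - c = cutPoint q N k j := hj.trans (cutPoint_eq k j).symm
    have hq : (0 : ℝ) < q := by exact_mod_cast NeZero.pos q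
    have hai : a = cutPoint q N k i := by
      have h2 : cutPoint q N k i ≤ a := haJ.2.2.1
      have h3 : cutPoint q N k i ∈ codingInterval q N Δ k i := by
        rw [cutPoint_eq, mul_mem_codingInterval_iff]
        refine ⟨div_mem i, hi, le_rfl, fun l hl _ => ?_⟩
        rw [div_lt_div_iff_of_pos_right hq]
        exact_mod_cast hl
      rw [hJ] at h3
      exact le_antisymm h3.1 h2
    have hij : i < j := by
      have h2 : cutPoint q N k i < cutPoint q N k j := by rw [← hai, ← hcut]; linarith
      rw [cutPoint_eq, cutPoint_eq, mul_lt_mul_iff_right₀ (half_pow_pos _),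
        div_lt_div_iff_of_pos_right hq] at h2
      exact_mod_cast h2
    exact absurd (hmem.2.2.2 j hij (hcut ▸ h1)) (by rw [hcut]; exact lt_irrefl _)

/-! ### Periodic and aperiodic points -/

theorem iterate_mem_Iper_iff {x : ℝ} (hx : x ∈ Ico (0 : ℝ) 1) (n : ℕ) :
    (F q π)^[n] x ∈ Iper q π ↔ x ∈ Iper q π := by
  constructor
  · rintro ⟨-, m, hm, h⟩
    rw [← Function.iterate_add_apply, add_comm, Function.iterate_add_apply] at h
    exact ⟨hx, m, hm, F_injOn.iterate F_mapsTo n (F_mapsTo.iterate m hx) hx h⟩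
  · rintro ⟨-, m, hm, h⟩
    refine ⟨F_mapsTo.iterate n hx, m, hm, ?_⟩
    rw [← Function.iterate_add_apply, add_comm, Function.iterate_add_apply, h]

theorem iterate_mem_Inp_iff {x : ℝ} (hx : x ∈ Ico (0 : ℝ) 1) (n : ℕ) :
    (F q π)^[n] x ∈ Inp q π ↔ x ∈ Inp q π := by
  rw [Inp, Set.mem_sdiff, Set.mem_sdiff, iterate_mem_Iper_iff hx]
  exact and_congr_left fun _ => ⟨fun _ => hx, fun _ => F_mapsTo.iterate n hx⟩

/-- The point `0` is not periodic because it is not in the image of `F_π`. -/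
theorem zero_mem_Inp : (0 : ℝ) ∈ Inp q π := by
  refine ⟨by simp, ?_⟩
  rintro ⟨-, n, hn, h⟩
  obtain ⟨n, rfl⟩ := Nat.exists_eq_succ_of_ne_zero hn.ne'
  rw [Function.iterate_succ_apply'] at h
  have := (F_mem_Ioo (π := π) (F_mapsTo.iterate (f := F q π) n
    (show (0 : ℝ) ∈ Ico (0 : ℝ) 1 by simp))).1
  linarith

theorem aperiodicLabels_nonempty (hΔ : Admissible q π Δ) (k : ℕ) :
    (aperiodicLabels q N π Δ k).Nonempty :=
  ⟨0, 0, zero_mem_codingInterval hΔ k, zero_mem_Inp⟩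

theorem aperiodicLabels_subset {k : ℕ} {i : Fin q} (hi : i ∈ aperiodicLabels q N π Δ k) :
    i ∈ labelsAt q N Δ k := by
  obtain ⟨x, hx, -⟩ := hi
  exact cutPoint_mem_iff.1 hx.2.1

/-- Every aperiodic point lies in a tower of each level. -/
theorem exists_mem_floor (hΔ : Admissible q π Δ) {x : ℝ} (hx : x ∈ Inp q π) (k : ℕ) :
    ∃ i s, s < height χ k i ∧ x ∈ floor q N π Δ k i s := by
  obtain ⟨u, hu, s, hs, hus, -⟩ := exists_tower (N := k * N) (π := π) hx.1
    (Or.inr fun ⟨n, hn, h⟩ => hx.2 ⟨hx.1, n, hn, h⟩)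
  obtain ⟨i, hi⟩ := exists_mem_codingInterval (k := k) hΔ hu
  exact ⟨i, s, (retTime_eq_height hΔ k i u hi) ▸ hs, u, hi, hus⟩

theorem mem_aperiodicLabels_of_mem_floor {k : ℕ} {i : Fin q} {s : ℕ} {x : ℝ} (hx : x ∈ Inp q π)
    (h : x ∈ floor q N π Δ k i s) : i ∈ aperiodicLabels q N π Δ k := by
  obtain ⟨u, hu, rfl⟩ := h
  exact ⟨u, hu, (iterate_mem_Inp_iff (codingInterval_subset hu) s).1 hx⟩

theorem not_floor_subset_Iper {k : ℕ} {i : Fin q} (hi : i ∈ aperiodicLabels q N π Δ k) (s : ℕ) :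
    ¬ floor q N π Δ k i s ⊆ Iper q π := by
  obtain ⟨u, hu, hup⟩ := hi
  exact fun h => hup.2 ((iterate_mem_Iper_iff (codingInterval_subset hu) s).1 (h ⟨u, hu, rfl⟩))

theorem letterClosed_returnSubst (hΔ : Admissible q π Δ) :
    SubstPath.LetterClosed χ (aperiodicLabels q N π Δ) := by
  rintro k i ⟨x, hx, hxp⟩ a ha
  obtain ⟨p, hp, rfl⟩ := List.getElem_of_mem ha
  exact ⟨_, iterate_offset_mem hΔ hx hp, (iterate_mem_Inp_iff (codingInterval_subset hx) _).2 hxp⟩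

theorem height_pos (hΔ : Admissible q π Δ) {k : ℕ} {i : Fin q} (hi : i ∈ labelsAt q N Δ k) :
    0 < height χ k i := by
  obtain ⟨a, b, hab, -, -, -, -, -, hJ⟩ := exists_codingInterval_eq_Ico hΔ hi
  have ha : a ∈ codingInterval q N Δ k i := hJ ▸ ⟨le_rfl, hab⟩
  rw [← retTime_eq_height hΔ k i a ha]
  exact retTime_pos (recurrent_level k a ha.1)

/-- The tower of an aperiodic label contains an aperiodic point of its base, which lies in some
tower of the next level. -/
theorem exists_mem_returnSubst (hΔ : Admissible q π Δ) (k : ℕ) :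
    ∀ a ∈ aperiodicLabels q N π Δ k, ∃ i ∈ aperiodicLabels q N π Δ (k + 1), a ∈ χ k i := by
  intro a ha
  have hpos := height_pos (N := N) hΔ (aperiodicLabels_subset ha)
  obtain ⟨x, hx, hxp⟩ := ha
  obtain ⟨i, s, hs, hxs⟩ := exists_mem_floor (N := N) hΔ hxp (k + 1)
  obtain ⟨p, hp, s', h1, rfl⟩ := exists_eq_offset_add χ hs
  obtain ⟨h2, -⟩ := floor_unique hΔ h1 hpos (floor_succ_subset hΔ hp s' hxs) ⟨x, hx, rfl⟩
  exact ⟨i, mem_aperiodicLabels_of_mem_floor hxp hxs, h2 ▸ List.getElem_mem hp⟩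

end Towers

end RotatedOdometer

namespace RotatedOdometer

/-! ### The doubled interval -/

namespace Doubled

variable {Δ : Set ℝ} {z w : Doubled Δ}

theorem lt_iff : z < w ↔ z.val < w.val ∨ z.val = w.val ∧ z.IsMinus ∧ ¬ w.IsMinus := by
  change z.1 < w.1 ↔ _
  rw [Prod.Lex.lt_iff]
  refine or_congr Iff.rfl (and_congr Iff.rfl ?_)
  unfold IsMinus
  cases (ofLex z.1).2 <;> cases (ofLex w.1).2 <;> simp

theorem val_mem_of_not_isMinus (h : ¬ z.IsMinus) : z.val ∈ Ico (0 : ℝ) 1 := by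
  rcases z.2 with h1 | h1
  · exact h1.2
  · exact absurd h1.1 h

theorem val_of_isMinus (h : z.IsMinus) : z.val ∈ Δ ∧ z.val ∈ Ioo (0 : ℝ) 1 ∨ z.val = 1 := by
  rcases z.2 with h1 | h1
  · exact absurd (h1.1.symm.trans h) (by simp)
  · exact h1.2

theorem val_pos_of_isMinus (h : z.IsMinus) : 0 < z.val := by
  rcases val_of_isMinus h with h1 | h1
  · exact h1.2.1
  · rw [h1]; exact one_pos

theorem val_le_one_of_isMinus (h : z.IsMinus) : z.val ≤ 1 := by
  rcases val_of_isMinus h with h1 | h1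
  · exact h1.2.2.le
  · exact h1.le

theorem exists_plus (Δ : Set ℝ) {x : ℝ} (hx : x ∈ Ico (0 : ℝ) 1) :
    ∃ z : Doubled Δ, z.val = x ∧ ¬ z.IsMinus ∧ z = incl Δ x := by
  have h : incl Δ x = ⟨toLex (x, true), Or.inl ⟨rfl, hx⟩⟩ := dif_pos hx
  rw [h]
  exact ⟨_, rfl, fun h => Bool.noConfusion h, rfl⟩

theorem exists_minus {x : ℝ} (hx : x ∈ Δ ∨ x = 1) (h0 : 0 < x) (h1 : x ≤ 1) :
    ∃ z : Doubled Δ, z.val = x ∧ z.IsMinus := by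
  refine ⟨⟨toLex (x, false), Or.inr ⟨rfl, ?_⟩⟩, rfl, rfl⟩
  rcases h1.eq_or_lt with h | h
  · exact Or.inr h
  · exact Or.inl ⟨hx.resolve_right h.ne, h0, h⟩

theorem incl_val {x : ℝ} (hx : x ∈ Ico (0 : ℝ) 1) : (incl Δ x).val = x := by
  obtain ⟨z, h1, -, rfl⟩ := exists_plus Δ hx
  exact h1

theorem not_isMinus_incl {x : ℝ} (hx : x ∈ Ico (0 : ℝ) 1) : ¬ (incl Δ x).IsMinus := by
  obtain ⟨z, -, h2, rfl⟩ := exists_plus Δ hx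
  exact h2

/-- The filter of the points of `[0,1)` near `z`: the left neighbourhoods of `x` if `z = x⁻`, and
the point `x` itself if `z = x⁺`. -/
def germ (z : Doubled Δ) : Filter ℝ :=
  open Classical in if z.IsMinus then 𝓝[<] z.val else pure z.val

theorem germ_minus (h : z.IsMinus) : z.germ = 𝓝[<] z.val := if_pos h

theorem germ_plus (h : ¬ z.IsMinus) : z.germ = pure z.val := if_neg h

instance : z.germ.NeBot := by
  by_cases h : z.IsMinus
  · rw [germ_minus h]; infer_instance
  · rw [germ_plus h]; infer_instance

theorem Ico_mem_germ_iff {a b : ℝ} : Ico a b ∈ z.germ ↔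
    z.IsMinus ∧ a < z.val ∧ z.val ≤ b ∨ ¬ z.IsMinus ∧ a ≤ z.val ∧ z.val < b := by
  by_cases h : z.IsMinus
  · simp only [h, true_and, not_true, false_and, or_false, germ_minus h]
    constructor
    · intro hm
      constructor
      · obtain ⟨y, h1, h2⟩ := Filter.nonempty_of_mem (inter_mem hm self_mem_nhdsWithin)
        exact h1.1.trans_lt h2
      · by_contra hlt
        obtain ⟨y, h1, h2⟩ := Filter.nonempty_of_mem (inter_mem hm (Ioo_mem_nhdsLT (not_le.1 hlt)))
        exact absurd h1.2 (not_lt.2 h2.1.le)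
    · rintro ⟨h1, h2⟩
      filter_upwards [Ioo_mem_nhdsLT h1] with y hy
      exact ⟨hy.1.le, hy.2.trans_le h2⟩
  · simp only [h, false_and, not_false_eq_true, true_and, false_or, germ_plus h]
    exact mem_pure

theorem le_val_of_mem_germ {a b : ℝ} (h : Ico a b ∈ z.germ) : a ≤ z.val := by
  rcases Ico_mem_germ_iff.1 h with h | h
  · exact h.2.1.le
  · exact h.2.1

theorem val_le_of_mem_germ {a b : ℝ} (h : Ico a b ∈ z.germ) : z.val ≤ b := by
  rcases Ico_mem_germ_iff.1 h with h | h
  · exact h.2.2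
  · exact h.2.2.le

/-- An interval between cut points is open in the doubled interval. -/
theorem isOpen_setOf_Ico_mem_germ {a b : ℝ} (ha : a ∈ Δ) (ha0 : a ∈ Ico (0 : ℝ) 1)
    (hb : b ∈ Δ ∨ b = 1) (hb0 : 0 < b) (hb1 : b ≤ 1) :
    IsOpen {z : Doubled Δ | Ico a b ∈ z.germ} := by
  have h1 : IsOpen {z : Doubled Δ | z.IsMinus ∧ a < z.val ∨ ¬ z.IsMinus ∧ a ≤ z.val} := by
    rcases ha0.1.eq_or_lt with rfl | h
    · convert isOpen_univ
      refine eq_univ_of_forall fun z => ?_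
      by_cases hz : z.IsMinus
      · exact Or.inl ⟨hz, val_pos_of_isMinus hz⟩
      · exact Or.inr ⟨hz, (val_mem_of_not_isMinus hz).1⟩
    · obtain ⟨m, hm, hm'⟩ := exists_minus (Or.inl ha) h ha0.2.le
      convert isOpen_Ioi (a := m)
      ext z
      change (z.IsMinus ∧ a < z.val ∨ ¬ z.IsMinus ∧ a ≤ z.val) ↔ m < z
      rw [lt_iff, hm, le_iff_lt_or_eq]
      tauto
  have h2 : IsOpen {z : Doubled Δ | z.IsMinus ∧ z.val ≤ b ∨ ¬ z.IsMinus ∧ z.val < b} := by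
    rcases hb1.eq_or_lt with rfl | h
    · convert isOpen_univ
      refine eq_univ_of_forall fun z => ?_
      by_cases hz : z.IsMinus
      · exact Or.inl ⟨hz, val_le_one_of_isMinus hz⟩
      · exact Or.inr ⟨hz, (val_mem_of_not_isMinus hz).2⟩
    · obtain ⟨m, hm, hm', -⟩ := exists_plus Δ (⟨hb0.le, h⟩ : b ∈ Ico (0 : ℝ) 1)
      convert isOpen_Iio (a := m)
      ext z
      change (z.IsMinus ∧ z.val ≤ b ∨ ¬ z.IsMinus ∧ z.val < b) ↔ z < m
      rw [lt_iff, hm, le_iff_lt_or_eq]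
      tauto
  convert h1.inter h2
  ext z
  change _ ↔ (z.IsMinus ∧ a < z.val ∨ ¬ z.IsMinus ∧ a ≤ z.val) ∧
    (z.IsMinus ∧ z.val ≤ b ∨ ¬ z.IsMinus ∧ z.val < b)
  refine Ico_mem_germ_iff.trans ?_
  tauto

/-- A point of the doubled interval lies in one of the intervals into which finitely many cut points
divide it. -/
theorem exists_Ico_mem_germ (z : Doubled Δ) {P : Set ℝ} (hP : P.Finite) (h0 : (0 : ℝ) ∈ P) :
    ∃ a ∈ P, ∃ b, (b ∈ P ∨ b = 1) ∧ Ico a b ∈ z.germ ∧ ∀ p, p ∈ P ∨ p = 1 → p ≤ a ∨ b ≤ p := by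
  let C : ℝ → Prop := fun p => z.IsMinus ∧ p < z.val ∨ ¬ z.IsMinus ∧ p ≤ z.val
  have hC0 : C 0 := by
    by_cases hz : z.IsMinus
    · exact Or.inl ⟨hz, val_pos_of_isMinus hz⟩
    · exact Or.inr ⟨hz, (val_mem_of_not_isMinus hz).1⟩
  have hC1 : ¬ C 1 := by
    rintro (⟨hz, h⟩ | ⟨hz, h⟩)
    · exact absurd (val_le_one_of_isMinus hz) (not_le.2 h)
    · exact absurd (val_mem_of_not_isMinus hz).2 (not_lt.2 h)
  obtain ⟨a, ha, hmax⟩ := exists_max_image {p | p ∈ P ∧ C p} id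
    (hP.subset fun p hp => hp.1) ⟨0, h0, hC0⟩
  obtain ⟨b, hb, hmin⟩ := exists_min_image {p | (p ∈ P ∨ p = 1) ∧ ¬ C p} id
    ((hP.insert 1).subset fun p hp => hp.1.symm) ⟨1, Or.inr rfl, hC1⟩
  refine ⟨a, ha.1, b, hb.1, Ico_mem_germ_iff.2 ?_, fun p hp => ?_⟩
  · have h1 : C a := ha.2
    have h2 : ¬ C b := hb.2
    by_cases hz : z.IsMinus
    · simp only [C, hz, true_and, not_true, false_and, or_false, not_lt] at h1 h2
      exact Or.inl ⟨hz, h1, h2⟩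
    · simp only [C, hz, false_and, not_false_eq_true, true_and, false_or, not_le] at h1 h2
      exact Or.inr ⟨hz, h1, h2⟩
  · by_cases hCp : C p
    · rcases hp with hp | rfl
      · exact Or.inl (hmax p ⟨hp, hCp⟩)
      · exact absurd hCp hC1
    · exact Or.inr (hmin p ⟨hp, hCp⟩)

/-- The points of `[0,1)` to the left of `x` converge to `x⁻` in the doubled interval. -/
theorem tendsto_incl (h : z.IsMinus) : Tendsto (incl Δ) (𝓝[<] z.val) (𝓝 z) := by
  have h0 := val_pos_of_isMinus h
  have h1 := val_le_one_of_isMinus h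
  refine tendsto_order.2 ⟨fun a ha => ?_, fun a ha => ?_⟩
  · have hav : a.val < z.val := by
      rcases lt_iff.1 ha with ha | ha
      · exact ha
      · exact absurd h ha.2.2
    filter_upwards [Ioo_mem_nhdsLT h0, Ioo_mem_nhdsLT hav] with y hy hy'
    refine lt_iff.2 (Or.inl ?_)
    rw [incl_val ⟨hy.1.le, hy.2.trans_le h1⟩]
    exact hy'.1
  · filter_upwards [Ioo_mem_nhdsLT h0] with y hy
    refine lt_trans (lt_iff.2 (Or.inl ?_)) ha
    rw [incl_val ⟨hy.1.le, hy.2.trans_le h1⟩]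
    exact hy.2

end Doubled

open Doubled

variable {q : ℕ} {π : Equiv.Perm (Fin q)} {N : ℕ} {Δ : Set ℝ}

theorem mem_IperStar_iff (hΔ : Δ ⊆ Ico 0 1) {z : Doubled Δ} : z ∈ IperStar q π Δ ↔
    ∃ a ∈ Δ, ∃ b, (b ∈ Δ ∨ b = 1) ∧ Ico a b ⊆ Iper q π ∧ Ico a b ∈ z.germ := by
  constructor
  · rintro ⟨a, b, ha, haΔ, hb, hab, haz, hzb⟩
    refine ⟨a.val, haΔ, b.val, ?_, hab, Ico_mem_germ_iff.2 ?_⟩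
    · exact (val_of_isMinus hb).imp (fun h => h.1) id
    · have h1 := not_lt.2 haz
      have h2 := not_lt.2 hzb
      rw [lt_iff, not_or, not_lt] at h1 h2
      by_cases hz : z.IsMinus
      · refine Or.inl ⟨hz, lt_of_le_of_ne h1.1 fun h => h1.2 ⟨h.symm, hz, ha⟩, h2.1⟩
      · exact Or.inr ⟨hz, h1.1, lt_of_le_of_ne h2.1 fun h => h2.2 ⟨h.symm, hb, hz⟩⟩
  · rintro ⟨a, ha, b, hb, hab, hz⟩
    obtain ⟨y, hy⟩ := Filter.nonempty_of_mem hz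
    have ha0 := hΔ ha
    have hb1 : b ≤ 1 := by
      rcases hb with hb | rfl
      · exact (hΔ hb).2.le
      · exact le_rfl
    obtain ⟨A, hA, hA', -⟩ := exists_plus Δ ha0
    obtain ⟨B, hB, hB'⟩ := exists_minus hb (by linarith [hy.1, hy.2, ha0.1]) hb1
    refine ⟨A, B, hA', hA ▸ ha, hB', by rw [hA, hB]; exact hab, not_lt.1 fun h => ?_,
      not_lt.1 fun h => ?_⟩
    · rcases Ico_mem_germ_iff.1 hz with h1 | h1 <;> rcases lt_iff.1 h with h2 | h2
      · linarith [h1.2.1]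
      · linarith [h1.2.1, h2.1]
      · linarith [h1.2.1]
      · exact h1.1 h2.2.1
    · rcases Ico_mem_germ_iff.1 hz with h1 | h1 <;> rcases lt_iff.1 h with h2 | h2
      · linarith [h1.2.2]
      · exact h2.2.2 h1.1
      · linarith [h1.2.2]
      · linarith [h1.2.2, h2.1]

theorem Fstar_plus {z : Doubled Δ} (h : ¬ z.IsMinus) :
    Fstar q π Δ z = incl Δ (F q π z.val) := if_neg h

theorem Fstar_minus {z w : Doubled Δ} (h : z.IsMinus)
    (hw : Tendsto (fun y => incl Δ (F q π y)) (𝓝[<] z.val) (𝓝 w)) : Fstar q π Δ z = w := by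
  rw [Fstar, if_pos h]
  exact hw.limUnder_eq

variable [NeZero q]

local notation "χ" => returnSubst q N π Δ

/-- Below the top of a tower, the extended map sends each floor to the next one. -/
theorem floor_succ_mem_germ (hΔ : Admissible q π Δ) {k : ℕ} {i : Fin q} {s : ℕ}
    (hi : i ∈ labelsAt q N Δ k) (hs : s + 1 < height χ k i) {z : Doubled Δ}
    (hz : floor q N π Δ k i s ∈ z.germ) :
    floor q N π Δ k i (s + 1) ∈ (Fstar q π Δ z).germ := by
  by_cases h : z.IsMinus
  swap
  · rw [germ_plus h] at hz
    have hz := F_mem_floor (mem_pure.1 hz)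
    have hF := F_mapsTo (π := π) (val_mem_of_not_isMinus h)
    rw [Fstar_plus h, germ_plus (not_isMinus_incl hF), incl_val hF]
    exact mem_pure.2 hz
  obtain ⟨c₁, -, hc₁⟩ := exists_translation hΔ k i (show s < height χ k i by omega)
  obtain ⟨c₂, -, hc₂⟩ := exists_translation hΔ k i hs
  have hF : ∀ y ∈ floor q N π Δ k i s, F q π y = y + (c₂ - c₁) := by
    rintro _ ⟨u, hu, rfl⟩
    rw [← Function.iterate_succ_apply' (F q π), hc₁ u hu, hc₂ u hu]
    ring
  obtain ⟨a, b, hab, -, -, -, -, -, hfl, -⟩ := exists_floor_eq_Ico hΔ hi (Nat.lt_of_succ_lt hs)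
  obtain ⟨a', b', hab', -, -, hb', -, -, hfl', -⟩ := exists_floor_eq_Ico hΔ hi hs
  have heq : Ico a' b' = Ico (a + (c₂ - c₁)) (b + (c₂ - c₁)) := by
    rw [← hfl', ← image_add_const_Ico, ← hfl, ← image_congr hF, floor, floor, ← image_comp,
      ← Function.iterate_succ']
  have e1 := (Ico_subset_Ico_iff hab').1 heq.subset
  have e2 := (Ico_subset_Ico_iff (by linarith)).1 heq.superset
  have hsub := (Ico_subset_Ico_iff hab').1 (hfl' ▸ floor_subset)
  have hz' := hz
  rw [hfl] at hz'
  have hzv : a < z.val ∧ z.val ≤ b :=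
    (Ico_mem_germ_iff.1 hz').elim (fun h => h.2) (fun h' => absurd h h'.1)
  -- the shifted point is again a right endpoint of a floor or a cut point, so it is doubled
  have hnew : z.val + (c₂ - c₁) ∈ Δ ∨ z.val + (c₂ - c₁) = 1 := by
    rcases hzv.2.eq_or_lt with hb | hb
    · rw [hb, show b + (c₂ - c₁) = b' by linarith]
      exact hb'
    · have hmem : z.val ∈ floor q N π Δ k i s := hfl ▸ ⟨hzv.1.le, hb⟩
      have hI := floor_subset hmem
      rw [← hF _ hmem, hΔ.map_mem_iff _ hI]
      exact Or.inl ((val_of_isMinus h).resolve_right hI.2.ne).1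
  obtain ⟨m, hm, hm'⟩ := exists_minus hnew (by linarith) (by linarith)
  have hlim : Tendsto (fun y => incl Δ (F q π y)) (𝓝[<] z.val) (𝓝 m) := by
    have hshift : Tendsto (fun y => y + (c₂ - c₁)) (𝓝[<] z.val) (𝓝[<] m.val) := by
      rw [hm]
      refine tendsto_nhdsWithin_iff.2 ⟨?_, ?_⟩
      · exact ((continuous_add_const (c₂ - c₁)).tendsto z.val).mono_left nhdsWithin_le_nhds
      · filter_upwards [self_mem_nhdsWithin] with y hy
        exact add_lt_add_left (show y < z.val from hy) _
    refine ((tendsto_incl hm').comp hshift).congr' ?_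
    rw [germ_minus h] at hz
    filter_upwards [hz] with y hy
    rw [Function.comp, hF y hy]
  rw [Fstar_minus h hlim, hfl', Ico_mem_germ_iff]
  exact Or.inl ⟨hm', by rw [hm]; linarith, by rw [hm]; linarith⟩

theorem exists_half_pow_mul_lt (hN : 1 ≤ N) {ε : ℝ} (hε : 0 < ε) :
    ∃ k₀, ∀ k, k₀ ≤ k → (1 / 2 : ℝ) ^ (k * N) < ε := by
  obtain ⟨n, hn⟩ := exists_pow_lt_of_lt_one hε (show (1 / 2 : ℝ) < 1 by norm_num)
  exact ⟨n, fun k hk => (half_pow_le_iff.2 (hk.trans (Nat.le_mul_of_pos_right k hN))).trans_lt hn⟩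

/-- A point in the top floors of all levels is mapped to `0`. -/
theorem Fstar_eq_incl_zero (hN : 1 ≤ N) (hΔ : Admissible q π Δ) {z : Doubled Δ}
    (h : ∀ k, ∃ i s, s + 1 = height χ k i ∧ floor q N π Δ k i s ∈ z.germ) :
    Fstar q π Δ z = incl Δ 0 := by
  have hsmall : ∀ ε > 0, ∀ᶠ y in z.germ, y ∈ Ico (0 : ℝ) 1 ∧ F q π y < ε := by
    intro ε hε
    obtain ⟨k, hk⟩ := exists_half_pow_mul_lt hN hε
    obtain ⟨i, s, hs, hfl⟩ := h k
    filter_upwards [hfl] with y hy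
    refine ⟨floor_subset hy, ?_⟩
    obtain ⟨u, hu, rfl⟩ := hy
    rw [← Function.iterate_succ_apply' (F q π), Nat.succ_eq_add_one, hs,
      ← retTime_eq_height hΔ k i u hu]
    have hmem : (F q π)^[FirstReturn.retTime (F q π) (section_ N k) u] u ∈ section_ N k :=
      FirstReturn.ret_mem (recurrent_level k u hu.1)
    exact hmem.2.trans (hk k le_rfl)
  by_cases hz : z.IsMinus
  swap
  · exfalso
    have hpos := (F_mem_Ioo (π := π) (val_mem_of_not_isMinus hz)).1
    have h1 := hsmall _ hpos
    rw [germ_plus hz, eventually_pure] at h1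
    exact lt_irrefl _ h1.2
  -- `F_π` does not take the value `0`, so `z` is an added point, and `F_π` tends to `0` there
  refine Fstar_minus hz (tendsto_order.2 ⟨fun a ha => ?_, fun a ha => ?_⟩)
  · have h0 : (0 : ℝ) ∈ Ico (0 : ℝ) 1 := by simp
    rcases lt_iff.1 ha with h1 | h1
    · rw [incl_val h0] at h1
      by_cases ham : a.IsMinus
      · exact absurd (val_pos_of_isMinus ham) (not_lt.2 h1.le)
      · exact absurd (val_mem_of_not_isMinus ham).1 (not_le.2 h1)
    · rw [incl_val h0] at h1
      exact absurd (val_pos_of_isMinus h1.2.1) (by rw [h1.1]; exact lt_irrefl _)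
  · have h0 : (0 : ℝ) ∈ Ico (0 : ℝ) 1 := by simp
    have hav : 0 < a.val := by
      rcases lt_iff.1 ha with h1 | h1
      · rwa [incl_val h0] at h1
      · exact absurd h1.2.1 (not_isMinus_incl h0)
    have h1 := hsmall _ hav
    rw [germ_minus hz] at h1
    filter_upwards [h1] with y hy
    refine lt_iff.2 (Or.inl ?_)
    rw [incl_val (F_mapsTo hy.1)]
    exact hy.2

/-- The aperiodic part consists of the points that lie, at every level, in the tower of a label of
an aperiodic point. -/
theorem mem_InpStar_iff (hN : 1 ≤ N) (hΔ : Admissible q π Δ) {z : Doubled Δ} :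
    z ∈ InpStar q π Δ ↔ ∀ k, ∃ i ∈ aperiodicLabels q N π Δ k, ∃ s < height χ k i,
      floor q N π Δ k i s ∈ z.germ := by
  rw [InpStar, Set.mem_compl_iff, mem_IperStar_iff hΔ.subset]
  constructor
  · intro hz k
    have hfin : {p | p ∈ Δ ∧ p ∈ lattice q (k * N)}.Finite :=
      (finite_lattice_coset (q := q) (show (0 : ℝ) ∈ Ico (0 : ℝ) 1 by simp) (k * N)).subset
        fun p hp => ⟨hΔ.subset hp.1, by simpa using hp.2⟩
    obtain ⟨a, ha, b, hb, hgerm, hsep⟩ :=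
      exists_Ico_mem_germ z hfin ⟨hΔ.zero_mem, zero_mem _⟩
    -- the interval of the partition that contains `z` contains an aperiodic point
    have hnot : ¬ Ico a b ⊆ Iper q π := fun h =>
      hz ⟨a, ha.1, b, hb.imp (fun h => h.1) id, h, hgerm⟩
    obtain ⟨y, hy, hyp⟩ := not_subset.1 hnot
    have hb1 : b ≤ 1 := by
      rcases hb with hb | rfl
      · exact (hΔ.subset hb.1).2.le
      · exact le_rfl
    have hyI : y ∈ Inp q π := ⟨⟨(hΔ.subset ha.1).1.trans hy.1, hy.2.trans_le hb1⟩, hyp⟩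
    obtain ⟨i, s, hs, hys⟩ := exists_mem_floor (N := N) hΔ hyI k
    have hi := mem_aperiodicLabels_of_mem_floor hyI hys
    obtain ⟨c, d, hcd, -, hc, hd, hcl, hdl, hfl, -⟩ :=
      exists_floor_eq_Ico hΔ (aperiodicLabels_subset hi) hs
    rw [hfl] at hys
    refine ⟨i, hi, s, hs, mem_of_superset hgerm ?_⟩
    rw [hfl]
    refine Ico_subset_Ico ?_ ?_
    · rcases hsep c (Or.inl ⟨hc, hcl⟩) with h | h
      · exact h
      · linarith [hy.2, hys.1]
    · rcases hsep d (hd.imp (fun h => ⟨h, hdl⟩) id) with h | h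
      · linarith [hy.1, hys.2]
      · exact h
  · rintro h ⟨a, ha, b, hb, hab, hgerm⟩
    have hlat : ∃ K, a ∈ lattice q K ∧ b ∈ lattice q K := by
      obtain ⟨K₁, h1⟩ := hΔ.lattice a ha
      obtain ⟨K₂, h2⟩ : ∃ K, b ∈ lattice q K := by
        rcases hb with hb | rfl
        · exact hΔ.lattice b hb
        · exact ⟨0, one_mem_lattice 0⟩
      exact ⟨max K₁ K₂, lattice_mono (le_max_left _ _) h1, lattice_mono (le_max_right _ _) h2⟩
    obtain ⟨K, hKa, hKb⟩ := hlat
    -- at a level where `a` and `b` are lattice points, the floor around `z` lies in `[a, b)`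
    obtain ⟨i, hi, s, hs, hfz⟩ := h K
    refine not_floor_subset_Iper hi s (Subset.trans ?_ hab)
    obtain ⟨c, d, hcd, -, hc, hd, -, -, hfl, hsep⟩ :=
      exists_floor_eq_Ico hΔ (aperiodicLabels_subset hi) hs
    have hsub := (Ico_subset_Ico_iff hcd).1 (hfl ▸ floor_subset)
    obtain ⟨y, h1, h2⟩ := Filter.nonempty_of_mem (inter_mem hgerm hfz)
    have hmono := lattice_mono (q := q) (Nat.le_mul_of_pos_right K hN)
    rw [hfl] at h2 ⊢
    refine Ico_subset_Ico ?_ ?_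
    · by_contra hlt
      have := hsep a ha (hmono hKa) (not_le.1 hlt)
      linarith [h1.1, h2.2]
    · rcases hb with hb | rfl
      · exact hsep b hb (hmono hKb) (h2.1.trans_lt h1.2)
      · exact hsub.2

end RotatedOdometer

namespace RotatedOdometer

open SubstPath Doubled

/-! ### Paths and nested floors -/

section Depth

variable {q : ℕ} {χ : ℕ → Fin q → List (Fin q)} {S : ℕ → Set (Fin q)}

/-- The number of the floor that a path determines in the tower of its `k`-th letter: the sum of the
numbers of floors that it passes at the levels below. -/
def depth (x : (substDiagram χ S).Path) : ℕ → ℕ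
  | 0 => 0
  | k + 1 => offset χ k (letter x (k + 1)) (pos x k) + depth x k

theorem depth_lt (x : (substDiagram χ S).Path) (k : ℕ) : depth x k < height χ k (letter x k) := by
  induction k with
  | zero => exact one_pos
  | succ k ih => exact offset_add_lt χ (pos_lt x k) (by rwa [getElem_pos])

theorem depth_congr {x y : (substDiagram χ S).Path} {n : ℕ}
    (h : ∀ k ≤ n, letter y k = letter x k ∧ pos y k = pos x k) : ∀ k ≤ n, depth y k = depth x k
  | 0, _ => rfl
  | k + 1, hk => by
    rw [depth, depth, (h _ hk).1, (h k (by omega)).2, depth_congr h k (by omega)]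

theorem depth_eq_zero {x : (substDiagram χ S).Path} {k : ℕ} (h : ∀ j < k, pos x j = 0) :
    depth x k = 0 := by
  induction k with
  | zero => rfl
  | succ k ih =>
    rw [depth, h k (Nat.lt_succ_self k), ih fun j hj => h j (by omega)]
    simp [offset]

theorem depth_add_one_eq_height {x : (substDiagram χ S).Path} {k : ℕ}
    (h : ∀ j < k, pos x j + 1 = (χ j (letter x (j + 1))).length) :
    depth x k + 1 = height χ k (letter x k) := by
  induction k with
  | zero => rfl
  | succ k ih =>
    have h1 := ih fun j hj => h j (by omega)
    have h2 := offset_succ χ (pos_lt x k)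
    rw [h k (Nat.lt_succ_self k), offset_length, getElem_pos] at h2
    rw [depth]
    omega

/-- Above the level where it changes, the successor of a path is one floor higher. -/
theorem SuccAt.depth_eq {x y : (substDiagram χ S).Path} {k : ℕ} (h : SuccAt x y k) {j : ℕ}
    (hj : k < j) : depth y j = depth x j + 1 := by
  obtain ⟨h1, h2, h3, h4⟩ := h
  induction j, hj using Nat.le_induction with
  | base =>
    have h5 := depth_add_one_eq_height h1
    have h6 := offset_succ χ (pos_lt x k)
    rw [getElem_pos] at h6
    rw [depth, depth, depth_eq_zero h2, (h4 (k + 1) k.lt_succ_self).1, h3, h6]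
    omega
  | succ j hj ih =>
    rw [depth, depth, ih, (h4 (j + 1) (by omega)).1, (h4 j hj).2]
    omega

end Depth

/-! ### The conjugacy -/

section Conjugacy

variable {q : ℕ} {π : Equiv.Perm (Fin q)} {N : ℕ} {Δ : Set ℝ} [NeZero q]

local notation "χ" => returnSubst q N π Δ

/-- The paths of the ordered Bratteli diagram of the substitutions of the first return maps, with
the labels of aperiodic points as vertices. -/
abbrev ReturnPath (q N : ℕ) [NeZero q] (π : Equiv.Perm (Fin q)) (Δ : Set ℝ) : Type :=
  (substDiagram (returnSubst q N π Δ) (aperiodicLabels q N π Δ)).Path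

local notation "𝕏" => ReturnPath q N π Δ

/-- The floor of level `k` that a path determines, a subset of `[0,1)`. -/
def pathFloor (x : 𝕏) (k : ℕ) : Set ℝ := floor q N π Δ k (letter x k) (depth x k)

/-- The point of the doubled interval lies in all floors that the path determines; for an added
point `x⁻`, this means that the floors contain the points immediately to the left of `x`. -/
def Codes (z : Doubled Δ) (x : 𝕏) : Prop := ∀ k, pathFloor x k ∈ z.germ

theorem pathFloor_succ_subset (hΔ : Admissible q π Δ) (x : 𝕏) (k : ℕ) :
    pathFloor x (k + 1) ⊆ pathFloor x k := by
  have h := floor_succ_subset hΔ (pos_lt x k) (depth x k)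
  rwa [getElem_pos] at h

theorem pathFloor_antitone (hΔ : Admissible q π Δ) (x : 𝕏) : Antitone (pathFloor x) :=
  antitone_nat_of_succ_le (pathFloor_succ_subset hΔ x)

theorem pathFloor_congr {x y : 𝕏} {n : ℕ}
    (h : ∀ k ≤ n, letter y k = letter x k ∧ pos y k = pos x k) : pathFloor y n = pathFloor x n := by
  rw [pathFloor, pathFloor, (h n le_rfl).1, depth_congr h n le_rfl]

theorem exists_pathFloor_eq_Ico (hΔ : Admissible q π Δ) (x : 𝕏) (k : ℕ) :
    ∃ a b : ℝ, a < b ∧ b - a ≤ (1 / 2) ^ (k * N) ∧ a ∈ Δ ∧ (b ∈ Δ ∨ b = 1) ∧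
      pathFloor x k = Ico a b ∧ (∀ p ∈ Δ, p ∈ lattice q (k * N) → a < p → b ≤ p) ∧
      0 ≤ a ∧ b ≤ 1 := by
  obtain ⟨a, b, hab, hlen, ha, hb, -, -, hfl, hsep⟩ :=
    exists_floor_eq_Ico hΔ (aperiodicLabels_subset (letter_mem x k)) (depth_lt x k)
  exact ⟨a, b, hab, hlen, ha, hb, hfl, hsep, (Ico_subset_Ico_iff hab).1 (hfl ▸ floor_subset)⟩

theorem isOpen_setOf_pathFloor_mem_germ (hΔ : Admissible q π Δ) (x : 𝕏) (k : ℕ) :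
    IsOpen {z : Doubled Δ | pathFloor x k ∈ z.germ} := by
  obtain ⟨a, b, hab, -, ha, hb, hfl, -, ha0, hb1⟩ := exists_pathFloor_eq_Ico hΔ x k
  rw [hfl]
  exact isOpen_setOf_Ico_mem_germ ha ⟨ha0, hab.trans_le hb1⟩ hb (ha0.trans_lt hab) hb1

/-- A floor of level `n` around a point determines the first coordinates of its path. -/
theorem agree_of_pathFloor_mem_germ (hΔ : Admissible q π Δ) {z : Doubled Δ} {x y : 𝕏} {n : ℕ}
    (hx : pathFloor x (n + 1) ∈ z.germ) (hy : pathFloor y (n + 1) ∈ z.germ) :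
    ∀ k ≤ n, letter x k = letter y k ∧ pos x k = pos y k := by
  have key : ∀ k ≤ n + 1, letter x k = letter y k ∧ depth x k = depth y k := by
    intro k hk
    obtain ⟨u, hu, hu'⟩ := Filter.nonempty_of_mem (inter_mem
      (mem_of_superset hx (pathFloor_antitone hΔ x hk))
      (mem_of_superset hy (pathFloor_antitone hΔ y hk)))
    exact floor_unique hΔ (depth_lt x k) (depth_lt y k) hu hu'
  intro k hk
  obtain ⟨h1, h2⟩ := key (k + 1) (by omega)
  have hy1 := pos_lt y k
  have hy2 := depth_lt y k
  have hg := getElem_pos y k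
  refine ⟨(key k (by omega)).1, ?_⟩
  rw [depth, depth, h1] at h2
  have hx1 := pos_lt x k
  have hx2 := depth_lt x k
  have hg' := getElem_pos x k
  simp only [h1] at hx1 hg'
  exact offset_add_inj χ hx1 hy1 (by rwa [hg']) (by rwa [hg]) h2

theorem Codes.path_unique (hΔ : Admissible q π Δ) {z : Doubled Δ} {x y : 𝕏} (hx : Codes z x)
    (hy : Codes z y) : x = y :=
  path_ext
    (fun k => (agree_of_pathFloor_mem_germ hΔ (hx (k + 1)) (hy (k + 1)) k le_rfl).1)
    (fun k => (agree_of_pathFloor_mem_germ hΔ (hx (k + 1)) (hy (k + 1)) k le_rfl).2)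

theorem Codes.mem_InpStar (hN : 1 ≤ N) (hΔ : Admissible q π Δ) {z : Doubled Δ} {x : 𝕏}
    (h : Codes z x) : z ∈ InpStar q π Δ :=
  (mem_InpStar_iff hN hΔ).2 fun k => ⟨_, letter_mem x k, _, depth_lt x k, h k⟩

theorem exists_codes_path (hN : 1 ≤ N) (hΔ : Admissible q π Δ) {z : Doubled Δ}
    (hz : z ∈ InpStar q π Δ) : ∃ x : 𝕏, Codes z x := by
  choose i hi s hs hfl using (mem_InpStar_iff hN hΔ).1 hz
  have hp : ∀ k, ∃ p, ∃ h : p < (χ k (i (k + 1))).length, (χ k (i (k + 1)))[p] = i k ∧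
      s (k + 1) = offset χ k (i (k + 1)) p + s k := by
    intro k
    obtain ⟨p, hp, s', hs', heq⟩ := exists_eq_offset_add χ (hs (k + 1))
    have h1 := hfl (k + 1)
    rw [heq] at h1
    obtain ⟨u, hu, hu'⟩ := Filter.nonempty_of_mem (inter_mem
      (mem_of_superset h1 (floor_succ_subset hΔ hp s')) (hfl k))
    obtain ⟨h2, h3⟩ := floor_unique hΔ hs' (hs k) hu hu'
    exact ⟨p, hp, h2, h3 ▸ heq⟩
  choose p hp hpi hps using hp
  obtain ⟨x, hx, hx'⟩ := exists_path hi fun k => ⟨hp k, hpi k⟩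
  refine ⟨x, fun k => ?_⟩
  have hd : depth x k = s k := by
    induction k with
    | zero => exact (Nat.lt_one_iff.1 (hs 0)).symm
    | succ k ih => rw [depth, ih, hx, hx', hps]
  rw [pathFloor, hx, hd]
  exact hfl k

/-- The floors of a path have a common point, an added point if their right endpoints are
eventually constant. -/
theorem exists_codes_point (hΔ : Admissible q π Δ) (x : 𝕏) : ∃ z : Doubled Δ, Codes z x := by
  choose a b hab hlen ha hb hfl hsep ha0 hb1 using exists_pathFloor_eq_Ico hΔ x
  have hanti := pathFloor_antitone hΔ x
  have hsub : ∀ {k l}, k ≤ l → a k ≤ a l ∧ b l ≤ b k := by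
    intro k l hkl
    have h := hanti hkl
    rw [hfl, hfl] at h
    exact (Ico_subset_Ico_iff (hab l)).1 h
  have hX := mem_iInter.1 (Monotone.ciSup_mem_iInter_Icc_of_antitone
    (fun _ _ h => (hsub h).1) (fun _ _ h => (hsub h).2) (fun k => (hab k).le))
  set X := ⨆ k, a k
  by_cases h : ∃ k, b k = X
  · obtain ⟨k, hk⟩ := h
    have haX : ∀ l, a l < X := by
      intro l
      rw [← hk]
      exact (hsub (le_max_left l k)).1.trans_lt ((hab _).trans_le (hsub (le_max_right l k)).2)
    obtain ⟨z, hz, hz'⟩ := exists_minus (hk ▸ hb k) ((ha0 0).trans_lt (haX 0)) (hk ▸ hb1 k)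
    refine ⟨z, fun l => ?_⟩
    rw [hfl, Ico_mem_germ_iff, hz]
    exact Or.inl ⟨hz', haX l, (hX l).2⟩
  · have hXb : ∀ l, X < b l := fun l => lt_of_le_of_ne (hX l).2 fun h' => h ⟨l, h'.symm⟩
    obtain ⟨z, hz, hz', -⟩ :=
      exists_plus Δ (⟨(ha0 0).trans (hX 0).1, (hXb 0).trans_le (hb1 0)⟩ : X ∈ Ico (0 : ℝ) 1)
    refine ⟨z, fun l => ?_⟩
    rw [hfl, Ico_mem_germ_iff, hz]
    exact Or.inr ⟨hz', (hX l).1, hXb l⟩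

/-- The floors of the path of `z` eventually lie to the right of each point to the left of `z`. -/
theorem Codes.exists_forall_lt (hN : 1 ≤ N) (hΔ : Admissible q π Δ) {z c : Doubled Δ} {x : 𝕏}
    (h : Codes z x) (hc : c < z) : ∃ k, ∀ w : Doubled Δ, pathFloor x k ∈ w.germ → c < w := by
  rcases lt_iff.1 hc with hlt | ⟨heq, hcm, hzm⟩
  · obtain ⟨k, hk⟩ := exists_half_pow_mul_lt hN (sub_pos.2 hlt)
    obtain ⟨a, b, -, hlen, -, -, hfl, -⟩ := exists_pathFloor_eq_Ico hΔ x k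
    have hzb := val_le_of_mem_germ (hfl ▸ h k)
    refine ⟨k, fun w hw => lt_iff.2 (Or.inl ?_)⟩
    have hwa := le_val_of_mem_germ (hfl ▸ hw)
    linarith [hk k le_rfl]
  · have hcΔ : c.val ∈ Δ := by
      rcases val_of_isMinus hcm with h1 | h1
      · exact h1.1
      · exact absurd (val_mem_of_not_isMinus hzm).2 (by rw [← heq, h1]; exact lt_irrefl _)
    obtain ⟨k, hk⟩ := hΔ.lattice _ hcΔ
    obtain ⟨a, b, -, -, -, -, hfl, hsep, -⟩ := exists_pathFloor_eq_Ico hΔ x k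
    have hz : Ico a b ∈ z.germ := hfl ▸ h k
    have hz := (Ico_mem_germ_iff.1 hz).resolve_left fun h => hzm h.1
    -- the cut point `c.val` is not in the interior of the floor
    have hca : c.val ≤ a := by
      by_contra hlt
      have := hsep _ hcΔ (lattice_mono (Nat.le_mul_of_pos_right k hN) hk) (not_le.1 hlt)
      linarith [hz.2.2]
    refine ⟨k, fun w hw => lt_iff.2 ?_⟩
    rw [hfl] at hw
    rcases Ico_mem_germ_iff.1 hw with hw | hw
    · exact Or.inl (hca.trans_lt hw.2.1)
    · rcases (hca.trans hw.2.1).lt_or_eq with h1 | h1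
      · exact Or.inl h1
      · exact Or.inr ⟨h1, hcm, hw.1⟩

/-- The floors of the path of `z` eventually lie to the left of each point to the right of `z`. -/
theorem Codes.exists_forall_gt (hN : 1 ≤ N) (hΔ : Admissible q π Δ) {z c : Doubled Δ} {x : 𝕏}
    (h : Codes z x) (hc : z < c) : ∃ k, ∀ w : Doubled Δ, pathFloor x k ∈ w.germ → w < c := by
  rcases lt_iff.1 hc with hlt | ⟨heq, hzm, hcm⟩
  · obtain ⟨k, hk⟩ := exists_half_pow_mul_lt hN (sub_pos.2 hlt)
    obtain ⟨a, b, -, hlen, -, -, hfl, -⟩ := exists_pathFloor_eq_Ico hΔ x k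
    have hza := le_val_of_mem_germ (hfl ▸ h k)
    refine ⟨k, fun w hw => lt_iff.2 (Or.inl ?_)⟩
    have hwb := val_le_of_mem_germ (hfl ▸ hw)
    linarith [hk k le_rfl]
  · have hzΔ : z.val ∈ Δ := by
      rcases val_of_isMinus hzm with h1 | h1
      · exact h1.1
      · exact absurd (val_mem_of_not_isMinus hcm).2 (by rw [← heq, h1]; exact lt_irrefl _)
    obtain ⟨k, hk⟩ := hΔ.lattice _ hzΔ
    obtain ⟨a, b, -, -, -, -, hfl, hsep, -⟩ := exists_pathFloor_eq_Ico hΔ x k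
    have hz : Ico a b ∈ z.germ := hfl ▸ h k
    have hz := (Ico_mem_germ_iff.1 hz).resolve_right fun h => h.1 hzm
    -- the cut point `z.val` is not in the interior of the floor
    have hbz : b ≤ c.val := heq ▸
      hsep _ hzΔ (lattice_mono (Nat.le_mul_of_pos_right k hN) hk) hz.2.1
    refine ⟨k, fun w hw => lt_iff.2 ?_⟩
    rw [hfl] at hw
    rcases Ico_mem_germ_iff.1 hw with hw | hw
    · rcases (hw.2.2.trans hbz).lt_or_eq with h1 | h1
      · exact Or.inl h1
      · exact Or.inr ⟨h1, hw.1, hcm⟩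
    · exact Or.inl (hw.2.2.trans_le hbz)

theorem Codes.point_unique (hN : 1 ≤ N) (hΔ : Admissible q π Δ) {z w : Doubled Δ} {x : 𝕏}
    (hz : Codes z x) (hw : Codes w x) : z = w := by
  rcases lt_trichotomy z w with h | h | h
  · obtain ⟨k, hk⟩ := hz.exists_forall_gt hN hΔ h
    exact absurd (hk w (hw k)) (lt_irrefl _)
  · exact h
  · obtain ⟨k, hk⟩ := hz.exists_forall_lt hN hΔ h
    exact absurd (hk w (hw k)) (lt_irrefl _)

/-- The extended map corresponds to the successor of paths: above the level of change it moves one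
floor up in the same tower. -/
theorem Codes.Fstar_succ (hΔ : Admissible q π Δ) {z : Doubled Δ} {x y : 𝕏} (h : Codes z x) {k : ℕ}
    (hs : SuccAt x y k) : Codes (Fstar q π Δ z) y := by
  have key : ∀ j, k < j → pathFloor y j ∈ (Fstar q π Δ z).germ := by
    intro j hj
    have h1 := SuccAt.depth_eq hs hj
    have h2 := (hs.2.2.2 j hj).1
    have h3 := depth_lt y j
    rw [h1, h2] at h3
    rw [pathFloor, h1, h2]
    exact floor_succ_mem_germ hΔ (aperiodicLabels_subset (letter_mem x j)) h3 (h j)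
  intro j
  exact mem_of_superset (key (max j (k + 1)) (by omega))
    (pathFloor_antitone hΔ y (le_max_left _ _))

/-- The point `0` lies in the lowest floors, so its path is minimal. -/
theorem exists_codes_zero (hN : 1 ≤ N) (hΔ : Admissible q π Δ) :
    ∃ y : 𝕏, Codes (incl Δ 0) y ∧ OrderedBratteliDiagram.IsMinPath y := by
  have h0 : (0 : ℝ) ∈ Ico (0 : ℝ) 1 := by simp
  have hpos : ∀ k, 0 < height χ k 0 := fun k =>
    height_pos hΔ (cutPoint_mem_iff.1 (zero_mem_codingInterval hΔ k).2.1)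
  have hmem : ∀ k, floor q N π Δ k 0 0 ∈ (incl Δ 0).germ := by
    intro k
    rw [germ_plus (not_isMinus_incl h0), incl_val h0]
    exact mem_pure.2 ⟨0, zero_mem_codingInterval hΔ k, rfl⟩
  obtain ⟨y, hy⟩ := exists_codes_path hN hΔ ((mem_InpStar_iff (N := N) hN hΔ).2 fun k =>
    ⟨0, ⟨0, zero_mem_codingInterval hΔ k, zero_mem_Inp⟩, 0, hpos k, hmem k⟩)
  refine ⟨y, hy, (isMinPath_iff (letterClosed_returnSubst hΔ) y).2 fun k => ?_⟩
  obtain ⟨u, hu, hu'⟩ := Filter.nonempty_of_mem (inter_mem (hy (k + 1)) (hmem (k + 1)))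
  obtain ⟨h1, h2⟩ := floor_unique hΔ (depth_lt y (k + 1)) (hpos _) hu hu'
  obtain ⟨p, hp, s', hs', heq⟩ := exists_eq_offset_add χ (depth_lt y (k + 1))
  have hlen : 0 < (χ k (letter y (k + 1))).length := (Nat.zero_le _).trans_lt (pos_lt y k)
  refine offset_add_inj χ (s' := 0) (pos_lt y k) hlen (by rw [getElem_pos]; exact depth_lt y k)
    (height_pos hΔ (aperiodicLabels_subset (letterClosed_returnSubst hΔ k _ (letter_mem y _) _
      (List.getElem_mem _)))) (h2.trans ?_)
  simp [offset]

/-- The conjugacy between the extended map on its aperiodic part and the Vershik map. -/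
theorem exists_conjugacy (hN : 1 ≤ N) (hΔ : Admissible q π Δ)
    (hmin : ∃! x : 𝕏, OrderedBratteliDiagram.IsMinPath x) (τ : 𝕏 ≃ₜ 𝕏)
    (hτ : OrderedBratteliDiagram.IsVershikMap τ) :
    ∃ (hF : MapsTo (Fstar q π Δ) (InpStar q π Δ) (InpStar q π Δ)) (ψ : InpStar q π Δ ≃ₜ 𝕏),
      ∀ z : InpStar q π Δ, ψ (hF.restrict _ _ _ z) = τ (ψ z) := by
  have hS := letterClosed_returnSubst (N := N) hΔ
  have hstep : ∀ {z : Doubled Δ} {x : 𝕏}, Codes z x → Codes (Fstar q π Δ z) (τ x) := by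
    intro z x h
    by_cases hx : OrderedBratteliDiagram.IsMaxPath x
    · obtain ⟨y, hy, hymin⟩ := exists_codes_zero (N := N) hN hΔ
      have hx' := (isMaxPath_iff hS x).1 hx
      have h0 : Fstar q π Δ z = incl Δ 0 := Fstar_eq_incl_zero hN hΔ fun k =>
        ⟨_, _, depth_add_one_eq_height fun j _ => hx' j, h k⟩
      rw [h0, hmin.unique (hτ.2 x hx) hymin]
      exact hy
    · obtain ⟨k, hk⟩ := (isSuccPath_iff hS _ _).1 (hτ.1 x hx)
      exact h.Fstar_succ hΔ hk
  choose f hf using fun z : InpStar q π Δ => exists_codes_path (N := N) hN hΔ z.2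
  choose g hg using exists_codes_point (N := N) hΔ
  refine ⟨fun z hz => (hstep (hf ⟨z, hz⟩)).mem_InpStar hN hΔ,
    { toFun := f
      invFun := fun x => ⟨g x, (hg x).mem_InpStar hN hΔ⟩
      left_inv := fun z => Subtype.ext ((hg _).point_unique hN hΔ (hf z))
      right_inv := fun x => (hf _).path_unique hΔ (hg x)
      continuous_toFun := continuous_of_eventually_agree fun z n => ?_
      continuous_invFun := ?_ }, fun z => (hf _).path_unique hΔ (hstep (hf z))⟩
  · filter_upwards [((isOpen_setOf_pathFloor_mem_germ hΔ (f z) (n + 1)).preimage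
      continuous_subtype_val).mem_nhds (hf z (n + 1))] with w hw
    exact agree_of_pathFloor_mem_germ hΔ (hf w (n + 1)) hw
  · refine Continuous.subtype_mk (continuous_iff_continuousAt.2 fun x => ?_) _
    have hcyl : ∀ k, ∀ᶠ y in 𝓝 x, pathFloor x k ∈ (g y).germ := by
      intro k
      filter_upwards [cylinder_mem_nhds x k] with y hy
      exact pathFloor_congr hy ▸ hg y k
    refine tendsto_order.2 ⟨fun c hc => ?_, fun c hc => ?_⟩
    · obtain ⟨k, hk⟩ := (hg x).exists_forall_lt hN hΔ hc
      exact (hcyl k).mono fun y hy => hk _ hy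
    · obtain ⟨k, hk⟩ := (hg x).exists_forall_gt hN hΔ hc
      exact (hcyl k).mono fun y hy => hk _ hy

end Conjugacy

end RotatedOdometer

theorem theorem4p9 (q N : ℕ) (hq : 1 ≤ q) (hN1 : 1 ≤ N) (hN : q ≤ 2 ^ N)
    (π : Equiv.Perm (Fin q)) (Δ : Set ℝ)
    (hΔ : Δ = RotatedOdometer.discOrbits q π ∨ Δ = RotatedOdometer.gridPoints q) :
    -- the first return maps to the sections are defined everywhere
    (∀ k, ∀ x ∈ RotatedOdometer.section_ N k,
      ∃ n : ℕ, 0 < n ∧ (RotatedOdometer.F q π)^[n] x ∈ RotatedOdometer.section_ N k) ∧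
    ∃ χ : ℕ → Fin q → List (Fin q),
      -- the substitutions are proper, and their sequence is eventually periodic
      (∀ k, IsProperSubstitution (χ k)) ∧
      (∃ k₀ p₀ : ℕ, 0 < p₀ ∧ ∀ k, k₀ ≤ k → χ (k + p₀) = χ k) ∧
      -- they record the successive first return maps
      (∀ (k : ℕ) (i : Fin q), ∀ x ∈ RotatedOdometer.codingInterval q N Δ (k + 1) i,
        RotatedOdometer.IsReturnWord q N π Δ k x (χ k i)) ∧
      -- the vertex sets, and the edges between them
      (∀ k, (RotatedOdometer.aperiodicLabels q N π Δ k).Nonempty) ∧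
      (∀ k, ∀ i ∈ RotatedOdometer.aperiodicLabels q N π Δ (k + 1),
        ∀ a ∈ χ k i, a ∈ RotatedOdometer.aperiodicLabels q N π Δ k) ∧
      (substDiagram χ (RotatedOdometer.aperiodicLabels q N π Δ)).IsRegular ∧
      -- unique minimal and maximal paths
      (∃! x : (substDiagram χ (RotatedOdometer.aperiodicLabels q N π Δ)).Path,
        OrderedBratteliDiagram.IsMinPath x) ∧
      (∃! x : (substDiagram χ (RotatedOdometer.aperiodicLabels q N π Δ)).Path,
        OrderedBratteliDiagram.IsMaxPath x) ∧
      -- the Vershik map is a homeomorphism, conjugate to the extended map on the aperiodic part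
      ∃ (hF : MapsTo (RotatedOdometer.Fstar q π Δ)
          (RotatedOdometer.InpStar q π Δ) (RotatedOdometer.InpStar q π Δ))
        (τ : (substDiagram χ (RotatedOdometer.aperiodicLabels q N π Δ)).Path ≃ₜ
          (substDiagram χ (RotatedOdometer.aperiodicLabels q N π Δ)).Path),
        OrderedBratteliDiagram.IsVershikMap τ ∧
        ∃ ψ : RotatedOdometer.InpStar q π Δ ≃ₜ
            (substDiagram χ (RotatedOdometer.aperiodicLabels q N π Δ)).Path,
          ∀ z : RotatedOdometer.InpStar q π Δ, ψ (hF.restrict _ _ _ z) = τ (ψ z) := by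
  open RotatedOdometer in
  have : NeZero q := ⟨by omega⟩
  have hadm : Admissible q π Δ := by
    rcases hΔ with rfl | rfl
    · exact admissible_discOrbits
    · exact admissible_gridPoints
  have hproper := isProper_returnSubst (π := π) (Δ := Δ) hN
  choose a b hab using hproper
  have hne := aperiodicLabels_nonempty (N := N) hadm
  have hS := letterClosed_returnSubst (N := N) hadm
  have hmin := SubstPath.existsUnique_minPath (a := a) (b := b) hab hne hS
  obtain ⟨τ, hτ⟩ := SubstPath.exists_vershikHomeo (a := a) (b := b) hab hne hS
  obtain ⟨hF, ψ, hψ⟩ := exists_conjugacy hN1 hadm hmin τ hτ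
  refine ⟨fun k => recurrent_level k, returnSubst q N π Δ, fun k => ⟨a k, b k, hab k⟩,
    returnSubst_eventually_periodic hΔ, fun k i x hx => isReturnWord hadm k i hx, hne, hS,
    SubstPath.isRegular (fun k i h => ?_) hne hS (exists_mem_returnSubst hadm), hmin,
    SubstPath.existsUnique_maxPath (a := a) (b := b) hab hne hS, hF, τ, hτ, ψ, hψ⟩
  have := (hab k i).1
  rw [h] at this
  simp at this

end
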